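/- Let $d,n\ge 0$ and $r_1,\dots,r_n\ge 0$ be integers with $3d-1=n+\sum_k r_k$. Let $\varepsilon>0$ be irrational, $\lambda(x,y)=x-\varepsilon y$, $\Delta_d=\mathrm{conv}\{(0,0),(d,0),(0,d)\}$, $p=(0,d)$, $q=(d,0)$. \emph{Curves.} An $n$-marked rational plane tropical curve $C=(\Gamma,x_1,\dots,x_n,h)$ of degree $d$ is a finite metric tree $\Gamma$ all of whose vertices have valence $\ge 3$ (counting bounded edges and ends), with $n$ marked ends $x_i$ and $3d$ labelled other ends, and a balanced map $h:\Gamma\to\mathbb R^2$ that is affine with integral direction vector on each edge, contracts the marked ends and has direction $(1,1)$, $(-1,0)$, $(0,-1)$ on $d$ of the other ends each; $\mathrm{ev}(C)=(h(x_1),\dots,h(x_n))$. The weight of an edge is the integer length of its direction vector. $C$ lies in (the support of) $X=\prod_k\psi_k^{r_k}\cdot\mathcal M_{0,n}(\mathbb R^2,d)$ if every vertex $V$ has valence at least $3+\sum_{x_i\ni V}r_i$. $C$ is simple if (1) $h$ is injective on vertices; (2) if $h(V)\in h(e)$ for a vertex $V$ and a non-marked edge $e$, then $V$ is adjacent to an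 edge mapped on top of $e$ (i.e. parallel to $e$ and with image of its interior meeting that of $e$); (3) two edges mapped on top of each other share a vertex; (4) the non-marked edges whose interior passes through a given point of the plane have at most two different slopes. \emph{Points.} $P=(P_1,\dots,P_n)\in(\mathbb R^2)^n$ is general if it lies in none of the images $\mathrm{ev}(\sigma)$ with empty interior, where $\sigma$ runs over the cells of $X$ (the sets of curves of $X$ of a fixed combinatorial type); it is restricted general if moreover all $C\in X$ with $\mathrm{ev}(C)=P$ are simple. Let $\mathcal P_\lambda=(P_1,\dots,P_n)$ be restricted general points on a line $G$ orthogonal to $\ker\lambda$, ordered by increasing $\lambda$, with increasing distances $|P_{i+1}-P_i|>|P_i-P_{i-1}|$. Let $H^+$ and $H^-$ be the upper and the lower half plane bounded by $G$. \emph{Dual polygons.} The Newton subdivision of $\Delta_d$ dual to $h(\Gamma)$ has one vertex for each component of $\mathbb R^2\setminus h(\Gamma)$, namely the exponent $(i,j)$ of the monomial that is maximal there in a tropical polynomial with tropical curve $h(\Gamma)$ ($i$ and $j$ are the intersection numbers of $C$ with the horizontal ray to the left and with the vertical ray downwards from a generic point of the component). The polygon $Q_i$ dual to the point $h(x_i)=P_i$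 is the convex hull of the vertices belonging to the components with $P_i$ in their closure. Each edge of $Q_i$, given by its primitive outward normal vector $u$, is labelled by the multiset of the weights of all edges of $\Gamma$ that are mapped onto the edge of $h(\Gamma)$ emanating from $P_i$ in direction $u$; if $Q_i$ is a segment it has two labels, one for each normal vector. \emph{Claim.} Let $C\in X$ with $\mathrm{ev}(C)=\mathcal P_\lambda$. Then the labelled polygons $Q_1,\dots,Q_n$ form a rag rug of the form $(r_1,\dots,r_n)$, that is: (a) each $Q_i$ is a convex polytope in $\Delta_d$ whose vertices are lattice points, and each of its edges is labelled by a partition of the integer length of the edge; (b) if an edge of $Q_i$ lies in an edge of $\Delta_d$ with the same outward normal vector, then all entries of its label are $1$; (c) $Q_i$ and $Q_j$ intersect in at most one point for $i\ne j$; (d) the edges of $Q_1,\dots,Q_n$ whose outward normal vector points into $H^+$, with their labels, are the steps of a labelled lattice path from $p$ to $q$ in $\Delta_d$ on which $\lambda$ is strictly increasing, and the order of the polygons $Q_1,\dots,Q_n$ agrees with the order of their edges along this path; (e) the same holds for the edges whose outward normal vector points into $H^-$; (f) for each $i$ the sum of the sizes of the partitions of all edges of $Q_i$ is $r_i+2$.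 -/

import Mathlib

open Set Filter Topology

noncomputable section

namespace TropicalDescendant

/-! ### Lattice vectors and the plane -/

/-- The inclusion of the lattice `ℤ²` into the plane. -/
def toPlane (m : ℤ × ℤ) : ℝ × ℝ := ((m.1 : ℝ), (m.2 : ℝ))

/-- The standard pairing on the plane. -/
def dot (x y : ℝ × ℝ) : ℝ := x.1 * y.1 + x.2 * y.2

/-- Two lattice vectors are parallel. -/
def Parallel (u v : ℤ × ℤ) : Prop := u.1 * v.2 - u.2 * v.1 = 0

/-- Primitive lattice vectors, used as (outward) normal vectors of edges of lattice polygons. -/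
abbrev Normal : Type := {u : ℤ × ℤ // Int.gcd u.1 u.2 = 1}

/-- The directions `e₁ + e₂`, `-e₁`, `-e₂` of the unbounded ends of a plane tropical curve of
degree `d`. -/
def endDir : Fin 3 → ℤ × ℤ := ![(1, 1), (-1, 0), (0, -1)]

/-! ### Parametrized rational tropical curves in the plane -/

/-- A combinatorial type of `n`-marked rational plane tropical curves of degree `d` with labelled
ends: a finite tree, to whose vertices are attached the marked (contracted) ends `x_i`, `i : Fin n`,
and `d` labelled ends in each of the three directions `endDir j`; all valences are at least `3`. -/
structure CombType (d n : ℕ) where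
  numVert : ℕ
  graph : SimpleGraph (Fin numVert)
  isTree : graph.IsTree
  mark : Fin n → Fin numVert
  endAt : Fin 3 × Fin d → Fin numVert
  three_le_val : ∀ v, 3 ≤ {w | graph.Adj v w}.ncard + {i | mark i = v}.ncard +
    {a | endAt a = v}.ncard

namespace CombType

variable {d n : ℕ} (T : CombType d n)

abbrev Vert : Type := Fin T.numVert

/-- The valence of a vertex; bounded edges, marked ends and unmarked ends all count. -/
def val (v : T.Vert) : ℕ :=
  {w | T.graph.Adj v w}.ncard + {i | T.mark i = v}.ncard + {a | T.endAt a = v}.ncard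

open scoped Classical in
/-- The curves of type `T` belong to (the support of) the intersection product
`∏ ψ_k ^ r_k · M_{0,n}(ℝ², d)`.  Its maximal cells are given by the types with
`val v = 3 + ∑ r_i` at every vertex `v`, the sum being over the marked ends at `v`; contracting
bounded edges of these one obtains precisely the types with `val v ≥ 3 + ∑ r_i` everywhere. -/
def InPsiProduct (r : Fin n → ℕ) : Prop :=
  ∀ v : T.Vert, 3 + ∑ i with T.mark i = v, r i ≤ T.val v

/-- The non-marked edges: the bounded edges, each written once as a pair `(v, w)` with `v < w`,
and the unmarked ends. -/
abbrev Edge : Type :=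
  {e : T.Vert × T.Vert // e.1 < e.2 ∧ T.graph.Adj e.1 e.2} ⊕ (Fin 3 × Fin d)

open scoped Classical in
instance : Fintype T.Edge := inferInstance

/-- The vertex `v` is an endpoint of the edge. -/
def Incident (v : T.Vert) : T.Edge → Prop
  | Sum.inl e => e.1.1 = v ∨ e.1.2 = v
  | Sum.inr a => T.endAt a = v

end CombType

open scoped Classical in
/-- A parametrized tropical curve `(Γ, x_i, h)` of combinatorial type `T`: the bounded edges have
lengths, and `h` (given by its values `pos` on the vertices) is affine with integral direction
vectors `dir v w` on the edge from `v` to `w`, and balanced at each vertex.  Marked ends are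
contracted, the unmarked ends have direction `endDir j`. -/
structure Curve {d n : ℕ} (T : CombType d n) where
  pos : T.Vert → ℝ × ℝ
  len : Sym2 T.Vert → ℝ
  dir : T.Vert → T.Vert → ℤ × ℤ
  len_pos : ∀ v w, T.graph.Adj v w → 0 < len s(v, w)
  pos_eq : ∀ v w, T.graph.Adj v w → pos w = pos v + len s(v, w) • toPlane (dir v w)
  balanced : ∀ v, ∑ w with T.graph.Adj v w, dir v w +
    ∑ a with T.endAt a = v, endDir a.1 = 0

namespace Curve

variable {d n : ℕ} {T : CombType d n} (C : Curve T)

/-- The evaluation at all marked ends. -/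
def ev : Fin n → ℝ × ℝ := fun i => C.pos (T.mark i)

/-- The point of the plane where the parametrization of an edge starts. -/
def base : T.Edge → ℝ × ℝ
  | Sum.inl e => C.pos e.1.1
  | Sum.inr a => C.pos (T.endAt a)

/-- The direction vector (including the weight) of an edge. -/
def edgeDir : T.Edge → ℤ × ℤ
  | Sum.inl e => C.dir e.1.1 e.1.2
  | Sum.inr a => endDir a.1

/-- The parameter interval of an edge, including its endpoints. -/
def closedParam : T.Edge → Set ℝ
  | Sum.inl e => Icc 0 (C.len s(e.1.1, e.1.2))
  | Sum.inr _ => Ici 0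

/-- The parameter interval of an edge, without its endpoints. -/
def openParam : T.Edge → Set ℝ
  | Sum.inl e => Ioo 0 (C.len s(e.1.1, e.1.2))
  | Sum.inr _ => Ioi 0

/-- The image of an edge in the plane, including its endpoints. -/
def closedEdge (e : T.Edge) : Set (ℝ × ℝ) :=
  (fun s : ℝ => C.base e + s • toPlane (C.edgeDir e)) '' C.closedParam e

/-- The image in the plane of the interior of an edge. -/
def openEdge (e : T.Edge) : Set (ℝ × ℝ) :=
  (fun s : ℝ => C.base e + s • toPlane (C.edgeDir e)) '' C.openParam e

/-- The weight of an edge: the integer length of its direction vector. -/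
def weight (e : T.Edge) : ℕ := Int.gcd (C.edgeDir e).1 (C.edgeDir e).2

/-- The image `h(Γ)`. -/
def image : Set (ℝ × ℝ) := ⋃ e, C.closedEdge e

/-- Two edges are mapped on top of each other: they are parallel and their interiors meet. -/
def OnTop (e e' : T.Edge) : Prop :=
  Parallel (C.edgeDir e) (C.edgeDir e') ∧ (C.openEdge e ∩ C.openEdge e').Nonempty

/-- Simple curves. -/
structure IsSimple : Prop where
  inj : Function.Injective C.pos
  vertex_on_edge : ∀ v e, C.pos v ∈ C.closedEdge e → ∃ e', T.Incident v e' ∧ C.OnTop e' e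
  on_top : ∀ e e', C.OnTop e e' → ∃ v, T.Incident v e ∧ T.Incident v e'
  two_slopes : ∀ (x : ℝ × ℝ) (e₁ e₂ e₃ : T.Edge), x ∈ C.openEdge e₁ → x ∈ C.openEdge e₂ →
    x ∈ C.openEdge e₃ → Parallel (C.edgeDir e₁) (C.edgeDir e₂) ∨
      Parallel (C.edgeDir e₁) (C.edgeDir e₃) ∨ Parallel (C.edgeDir e₂) (C.edgeDir e₃)

end Curve

/-! ### Point conditions -/

/-- General point conditions: `P` lies in the image under `ev` of a cell of the intersection
product `∏ ψ_k ^ r_k · M_{0,n}(ℝ², d)` only if this image is full-dimensional in `(ℝ²)ⁿ`. -/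
def IsGeneral (d : ℕ) {n : ℕ} (r : Fin n → ℕ) (P : Fin n → ℝ × ℝ) : Prop :=
  ∀ T : CombType d n, T.InPsiProduct r → P ∈ range (Curve.ev (T := T)) →
    (interior (range (Curve.ev (T := T)))).Nonempty

/-- Restricted general point conditions: general, and all curves in the intersection product
through these points are simple. -/
def IsRestrictedGeneral (d : ℕ) {n : ℕ} (r : Fin n → ℕ) (P : Fin n → ℝ × ℝ) : Prop :=
  IsGeneral d r P ∧
    ∀ (T : CombType d n) (C : Curve T), T.InPsiProduct r → C.ev = P → C.IsSimple

/-- The linear form `λ(x, y) = x - ε y`. -/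
def lam (ε : ℝ) (x : ℝ × ℝ) : ℝ := x.1 - ε * x.2

/-- The point configuration `P_λ`: restricted general points on a line `G` orthogonal to the kernel
of `lam ε` (so `G` has direction `(1, -ε)`), in increasing order, with growing distances. -/
def IsSpecialConfiguration (d : ℕ) {n : ℕ} (r : Fin n → ℕ) (ε : ℝ) (P : Fin n → ℝ × ℝ) : Prop :=
  IsRestrictedGeneral d r P ∧
    ∃ (A : ℝ × ℝ) (t : Fin n → ℝ), (∀ i, P i = A + t i • ((1, -ε) : ℝ × ℝ)) ∧ StrictMono t ∧
      ∀ i j k : Fin n, i.val + 1 = j.val → j.val + 1 = k.val → t j - t i < t k - t j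

/-! ### Labelled polygons and rag rugs -/

/-- The triangle with vertices `(0, 0)`, `(d, 0)`, `(0, d)`. -/
def triangle (d : ℕ) : Set (ℝ × ℝ) :=
  convexHull ℝ {((0 : ℝ), (0 : ℝ)), ((d : ℝ), (0 : ℝ)), ((0 : ℝ), (d : ℝ))}

/-- The face of `K` on which the functional `u` is maximal.  For a polygon and a primitive vector
`u` it is an edge if and only if it has more than one point, and then `u` is an outward normal
vector of this edge. A segment is a face for both of its two normal vectors. -/
def face (K : Set (ℝ × ℝ)) (u : Normal) : Set (ℝ × ℝ) :=
  {m ∈ K | ∀ m' ∈ K, dot (toPlane u.1) m' ≤ dot (toPlane u.1) m}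

/-- The integer length of a lattice segment. -/
def latticeLength (S : Set (ℝ × ℝ)) : ℕ := {m : ℤ × ℤ | toPlane m ∈ S}.ncard - 1

/-- The multiset `α` is a partition of the number `N`. -/
def IsPartitionOf (α : Multiset ℕ) (N : ℕ) : Prop := (∀ a ∈ α, 0 < a) ∧ α.sum = N

/-- A subset of the plane together with labels for its edges, the edges being given by their
primitive outward normal vectors. -/
structure LabelledPolygon where
  carrier : Set (ℝ × ℝ)
  label : Normal → Multiset ℕ

/-- A labelled `λ`-increasing lattice path in the triangle from `p = (0, d)` to `q = (d, 0)`. -/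
structure LabelledPath (d : ℕ) (ε : ℝ) where
  steps : ℕ
  vertex : Fin (steps + 1) → ℤ × ℤ
  label : Fin steps → Multiset ℕ
  mem : ∀ k, toPlane (vertex k) ∈ triangle d
  start : vertex 0 = (0, (d : ℤ))
  finish : vertex (Fin.last steps) = ((d : ℤ), 0)
  increasing : StrictMono fun k => lam ε (toPlane (vertex k))
  partition : ∀ k, IsPartitionOf (label k)
    (latticeLength (segment ℝ (toPlane (vertex k.castSucc)) (toPlane (vertex k.succ))))

/-- The steps of the path `γ` are precisely the edges (with their labels) of the polygons `Q i`
whose outward normal vectors satisfy `side`; along `γ` the edges of the polygons occur in the order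
`Q 0, Q 1, …`. -/
def IsFormedBy {d : ℕ} {ε : ℝ} (γ : LabelledPath d ε) {n : ℕ} (Q : Fin n → LabelledPolygon)
    (side : Normal → Prop) : Prop :=
  ∃ σ : Fin γ.steps → Fin n × Normal,
    Function.Injective σ ∧
    range σ = {x | side x.2 ∧ (face (Q x.1).carrier x.2).Nontrivial} ∧
    (∀ k, face (Q (σ k).1).carrier (σ k).2 =
      segment ℝ (toPlane (γ.vertex k.castSucc)) (toPlane (γ.vertex k.succ))) ∧
    (∀ k, γ.label k = (Q (σ k).1).label (σ k).2) ∧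
    Monotone fun k => (σ k).1

/-- The vector `u` points into the upper half plane `H⁺` bounded by the line `G` of direction
`(1, -ε)`. -/
def PointsUp (ε : ℝ) (u : Normal) : Prop := 0 < dot (ε, 1) (toPlane u.1)

/-- The vector `u` points into the lower half plane `H⁻`. -/
def PointsDown (ε : ℝ) (u : Normal) : Prop := dot (ε, 1) (toPlane u.1) < 0

/-- Rag rugs of the form `(r_1, …, r_n)` in the triangle of size `d`. -/
structure IsRagRug (d : ℕ) {n : ℕ} (r : Fin n → ℕ) (ε : ℝ) (Q : Fin n → LabelledPolygon) :
    Prop where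
  polytope : ∀ i, ∃ S : Finset (ℤ × ℤ), S.Nonempty ∧ (Q i).carrier = convexHull ℝ (toPlane '' S)
  subset_triangle : ∀ i, (Q i).carrier ⊆ triangle d
  partition : ∀ i u, IsPartitionOf ((Q i).label u) (latticeLength (face (Q i).carrier u))
  outside_label : ∀ i u, face (Q i).carrier u ⊆ face (triangle d) u → ∀ a ∈ (Q i).label u, a = 1
  inter : ∀ i j, i ≠ j → ((Q i).carrier ∩ (Q j).carrier).Subsingleton
  upper : ∃ γ : LabelledPath d ε, IsFormedBy γ Q (PointsUp ε)
  lower : ∃ γ : LabelledPath d ε, IsFormedBy γ Q (PointsDown ε)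
  size : ∀ i, ∑ᶠ u, Multiset.card ((Q i).label u) = r i + 2

/-! ### The dual marked polygons of a curve -/

namespace Curve

variable {d n : ℕ} {T : CombType d n} (C : Curve T)

/-- Points off the image such that the horizontal and the vertical line through them avoid all
vertices of the curve. -/
def IsGenericPoint (x : ℝ × ℝ) : Prop :=
  x ∉ C.image ∧ ∀ v, (C.pos v).1 ≠ x.1 ∧ (C.pos v).2 ≠ x.2

open scoped Classical in
/-- The vertex of the Newton subdivision dual to the component of `ℝ² ∖ h(Γ)` containing the
generic point `x`, i.e. the exponent `(i, j)` of the monomial that is maximal on this component in a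
tropical polynomial (with the maximum convention) for `h(Γ)`.  Here `i` and `j` are the
intersection numbers of the curve with the horizontal ray from `x` to the left and with the
vertical ray from `x` downwards. -/
def exponent (x : ℝ × ℝ) : ℤ × ℤ :=
  (∑ e with ∃ y ∈ C.openEdge e, y.2 = x.2 ∧ y.1 < x.1, |(C.edgeDir e).2|,
   ∑ e with ∃ y ∈ C.openEdge e, y.1 = x.1 ∧ y.2 < x.2, |(C.edgeDir e).1|)

/-- The polygon of the Newton subdivision dual to the point `p` of `h(Γ)`: its vertices are dual to
the components of `ℝ² ∖ h(Γ)` which have `p` in their closure.  The outward normal vectors of its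
edges are the directions of the edges of `h(Γ)` at `p`. -/
def dualPolygon (p : ℝ × ℝ) : Set (ℝ × ℝ) :=
  convexHull ℝ {m | ∃ᶠ x in 𝓝 p, C.IsGenericPoint x ∧ toPlane (C.exponent x) = m}

open scoped Classical in
/-- The label of the edge of `h(Γ)` which emanates from `p` in direction `u`, and of its dual edge:
the weights of all edges of `Γ` which are mapped onto it. -/
def imageLabel (p : ℝ × ℝ) (u : Normal) : Multiset ℕ :=
  (Finset.univ.filter fun e : T.Edge =>
    ∀ᶠ s in 𝓝[>] (0 : ℝ), p + s • toPlane u.1 ∈ C.closedEdge e).val.map C.weight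

/-- The dual marked polygons of `C`, indexed by the marked ends. -/
def dualMarkedPolygons (i : Fin n) : LabelledPolygon where
  carrier := C.dualPolygon (C.pos (T.mark i))
  label := C.imageLabel (C.pos (T.mark i))

end Curve

end TropicalDescendant

end

noncomputable section

namespace TropicalDescendant

/-! Everything rests on a count. Since `G` has irrational slope, no edge of `Γ` is parallel to it,
so by balancing every vertex without marked end has an edge leading away from `G`. Such an edge
leads away from only one of its endpoints and touches no marked vertex. The Euler characteristic of
the tree, the valence condition and `3d - 1 = n + ∑ r_k` then leave no slack: the `i`-th marked
vertex has exactly `r_i + 2` non-marked edges, which is (f), every other vertex has exactly one edge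
leading away, and every edge without marked endpoint arises in this way. Hence `h(Γ)` meets `G` only
in the points `P_i` (`card_star_mark`, `away_unique_edge`, `mem_line`).

The second ingredient is balancing in integrated form. Exponents are intersection numbers with rays;
summation by parts against the indicator function of a half strip shows that the exponents of two
points differ by the rotated sum of the edges crossing the segment between them (`rayCount_sub`,
`exponent_sub`). It also gives intersection number `d` with tropical lines (`rayCount_sum`), so `d -
i - j` is a ray count as well and all exponents lie in `Δ_d`.

Near `P_i` the curve is a fan, and turning clockwise past a ray of direction `o` adds `rot o` to the
exponent (`IsLocalFan`, `isLocalFan`). Therefore the face with outward normal `u` is the sum of the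
rotated edges in direction `u`, which gives (a). Moreover `λ (rot o)` is the height of `o` relative
to `G`. So going from the region left of `P_i` to the region right of it, above or below the fan,
raises `λ` at each step; these two regions give the unique `λ`-minimum and `λ`-maximum of `Q_i`. The
region right of `P_i` is the one left of `P_{i+1}`, and the first and last regions on `G` have
exponents `p` and `q`. Concatenation gives (d) and (e), separation by `λ` gives (c).

For (b), an edge of `Q_i` on the boundary of `Δ_d` means that rays in direction `u` starting close
to `P_i` miss the curve. Then every vertex on the ray from `P_i` has only edges parallel to the ray,
and the count would produce two edges between the same two vertices of a tree. So there are no such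
vertices, and the edges in direction `u` are ends, of weight `1`. -/

/-! ### Linear algebra in the plane -/

/-- The determinant of two vectors of the plane. -/
def cross (x y : ℝ × ℝ) : ℝ := x.1 * y.2 - x.2 * y.1

/-- Clockwise rotation of lattice vectors. -/
def rot : (ℤ × ℤ) →+ (ℤ × ℤ) where
  toFun m := (m.2, -m.1)
  map_zero' := by simp
  map_add' a b := by ext <;> simp; ring

/-- `toPlane` as an additive map. -/
def toPlaneHom : (ℤ × ℤ) →+ (ℝ × ℝ) where
  toFun := toPlane
  map_zero' := by simp [toPlane]
  map_add' a b := by ext <;> simp [toPlane]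

lemma toPlane_add (a b : ℤ × ℤ) : toPlane (a + b) = toPlane a + toPlane b :=
  toPlaneHom.map_add a b

lemma toPlane_neg (a : ℤ × ℤ) : toPlane (-a) = -toPlane a := toPlaneHom.map_neg a

lemma toPlane_zero : toPlane 0 = 0 := toPlaneHom.map_zero

lemma toPlane_sum {ι : Type*} (s : Finset ι) (f : ι → ℤ × ℤ) :
    toPlane (∑ i ∈ s, f i) = ∑ i ∈ s, toPlane (f i) := map_sum toPlaneHom f s

lemma toPlane_zsmul (k : ℤ) (a : ℤ × ℤ) : toPlane (k • a) = (k : ℝ) • toPlane a := by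
  ext <;> simp [toPlane]

lemma toPlane_injective : Function.Injective toPlane := by
  intro a b h
  simpa [toPlane, Prod.ext_iff] using h

lemma toPlane_eq_zero {m : ℤ × ℤ} : toPlane m = 0 ↔ m = 0 := by
  rw [← toPlane_zero]; exact toPlane_injective.eq_iff

lemma toPlane_ne_zero {m : ℤ × ℤ} : toPlane m ≠ 0 ↔ m ≠ 0 := toPlane_eq_zero.not

lemma cross_add_right (x y z : ℝ × ℝ) : cross x (y + z) = cross x y + cross x z := by
  simp [cross]; ring

lemma cross_smul_right (c : ℝ) (x y : ℝ × ℝ) : cross x (c • y) = c * cross x y := by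
  simp [cross]; ring

lemma cross_smul_left (c : ℝ) (x y : ℝ × ℝ) : cross (c • x) y = c * cross x y := by
  simp [cross]; ring

lemma cross_swap (x y : ℝ × ℝ) : cross x y = -cross y x := by
  simp [cross]; ring

lemma cross_self (x : ℝ × ℝ) : cross x x = 0 := by
  simp [cross]; ring

/-- The Plücker relation. If `o` lies between `v` and `w`, it determines the side of `u` on which
`o` lies; this replaces comparisons of angles. -/
lemma cross_plucker (u v w o : ℝ × ℝ) :
    cross v w * cross u o = cross o w * cross u v + cross v o * cross u w := by
  simp [cross]; ring

/-- The determinant with a fixed vector on the left as a linear map. -/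
def crossLin (x : ℝ × ℝ) : (ℝ × ℝ) →ₗ[ℝ] ℝ where
  toFun := cross x
  map_add' := cross_add_right x
  map_smul' c y := cross_smul_right c x y

/-- The standard pairing with a fixed vector on the left as a linear map. -/
def dotLin (x : ℝ × ℝ) : (ℝ × ℝ) →ₗ[ℝ] ℝ where
  toFun := dot x
  map_add' y z := by simp [dot]; ring
  map_smul' c y := by simp [dot]; ring

@[simp] lemma dotLin_apply (x y : ℝ × ℝ) : dotLin x y = dot x y := rfl

/-- `lam ε` as a linear map. -/
def lamLin (ε : ℝ) : (ℝ × ℝ) →ₗ[ℝ] ℝ where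
  toFun := lam ε
  map_add' y z := by simp [lam]; ring
  map_smul' c y := by simp [lam]; ring

@[simp] lemma lamLin_apply (ε : ℝ) (y : ℝ × ℝ) : lamLin ε y = lam ε y := rfl

lemma dot_rot (u : ℝ × ℝ) (o : ℤ × ℤ) : dot u (toPlane (rot o)) = cross u (toPlane o) := by
  simp [dot, cross, rot, toPlane]; ring

/-- The link between the geometry of `G` and the order on the polygons: exponents jump by rotated
edge directions, so the side of `G` to which an edge points decides whether `λ` grows. -/
lemma lam_rot (ε : ℝ) (o : ℤ × ℤ) : lam ε (toPlane (rot o)) = dot (ε, 1) (toPlane o) := by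
  simp [dot, lam, rot, toPlane]; ring

/-- No nonzero lattice vector is parallel to `G`. -/
lemma dot_irrational_ne_zero {ε : ℝ} (hε : Irrational ε) {m : ℤ × ℤ} (hm : m ≠ 0) :
    dot (ε, 1) (toPlane m) ≠ 0 := by
  intro h
  simp only [dot, toPlane, one_mul] at h
  by_cases h1 : m.1 = 0
  · simp only [h1, Int.cast_zero, mul_zero, zero_add, Int.cast_eq_zero] at h
    exact hm (Prod.ext h1 h)
  · have := (hε.mul_intCast h1).add_intCast m.2
    rw [h] at this
    exact this ⟨0, by simp⟩

/-- A nonzero vector on the line spanned by `u`, on the same side as `u`, is a positive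
multiple of `u`. -/
lemma eq_smul_of_cross_eq_zero {u o : ℝ × ℝ} (hu : u ≠ 0) (h : cross u o = 0) :
    o = (dot u o / dot u u) • u := by
  have hd : dot u u ≠ 0 := by
    intro h0
    apply hu
    simp only [dot] at h0
    have h1 : u.1 = 0 := by nlinarith [mul_self_nonneg u.1, mul_self_nonneg u.2]
    have h2 : u.2 = 0 := by nlinarith [mul_self_nonneg u.1, mul_self_nonneg u.2]
    exact Prod.ext h1 h2
  simp only [cross] at h
  ext
  · simp only [Prod.smul_fst, smul_eq_mul]
    field_simp
    simp only [dot]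
    linear_combination (-u.2) * h
  · simp only [Prod.smul_snd, smul_eq_mul]
    field_simp
    simp only [dot]
    linear_combination (u.1) * h

lemma dot_self_pos {u : ℝ × ℝ} (hu : u ≠ 0) : 0 < dot u u := by
  simp only [dot]
  by_contra h
  apply hu
  have h1 : u.1 = 0 := by nlinarith [mul_self_nonneg u.1, mul_self_nonneg u.2]
  have h2 : u.2 = 0 := by nlinarith [mul_self_nonneg u.1, mul_self_nonneg u.2]
  exact Prod.ext h1 h2

lemma Normal.ne_zero (u : Normal) : u.1 ≠ 0 := by
  intro h
  have := u.2
  rw [h] at this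
  simp at this

/-- Counterclockwise rotation. -/
def perp (u : ℝ × ℝ) : ℝ × ℝ := (-u.2, u.1)

lemma cross_perp (u : ℝ × ℝ) : cross u (perp u) = dot u u := by
  simp [cross, perp, dot]

/-- A slight rotation of `u` changes the position with respect to `o` only if `o` is a multiple
of `u`. -/
lemma eventually_cross_add_smul (u w o : ℝ × ℝ) (hw : cross u w ≠ 0) (hu : u ≠ 0) (ho : o ≠ 0) :
    ∀ᶠ δ in 𝓝[>] (0 : ℝ), (0 < cross u o → 0 < cross (u + δ • w) o) ∧
      (cross u o < 0 → cross (u + δ • w) o < 0) ∧ cross (u + δ • w) o ≠ 0 := by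
  have hc : Tendsto (fun δ : ℝ => cross (u + δ • w) o) (𝓝[>] 0) (𝓝 (cross u o)) := by
    have : Continuous fun δ : ℝ => cross (u + δ • w) o := by
      unfold cross; fun_prop
    simpa using (this.tendsto 0).mono_left nhdsWithin_le_nhds
  rcases lt_trichotomy (cross u o) 0 with h | h | h
  · filter_upwards [hc.eventually_lt_const h] with δ hδ
    exact ⟨fun h' => absurd h' h.not_gt, fun _ => hδ, hδ.ne⟩
  · filter_upwards [self_mem_nhdsWithin] with δ hδ
    refine ⟨fun h' => absurd h h'.ne', fun h' => absurd h h'.ne, ?_⟩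
    have ho' := eq_smul_of_cross_eq_zero hu h
    set k := dot u o / dot u u
    have hk : k ≠ 0 := by
      rintro hk
      rw [hk, zero_smul] at ho'
      exact ho ho'
    rw [ho', cross_smul_right]
    have : cross (u + δ • w) u = -δ * cross u w := by
      simp [cross]; ring
    rw [this]
    have hδ' : δ ≠ 0 := ne_of_gt hδ
    exact mul_ne_zero hk (mul_ne_zero (neg_ne_zero.2 hδ') hw)
  · filter_upwards [hc.eventually_const_lt h] with δ hδ
    exact ⟨fun _ => hδ, fun h' => absurd h' h.not_gt, hδ.ne'⟩

/-! ### Crossing numbers on an interval -/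

section Interval
open scoped Classical

/-- The indicator of negativity drops where the affine function rises through zero, whence the sign
opposite to the slope. -/
lemma indicator_neg_sub {f0 m b0 b1 : ℝ} (hb : b0 < b1) (h0 : f0 + m * b0 ≠ 0)
    (h1 : f0 + m * b1 ≠ 0) :
    (if f0 + m * b1 < 0 then (1 : ℝ) else 0) - (if f0 + m * b0 < 0 then 1 else 0) =
      -(SignType.sign m : ℝ) * (if ∃ a, b0 < a ∧ a < b1 ∧ f0 + m * a = 0 then 1 else 0) := by
  rcases lt_trichotomy m 0 with hm | hm | hm
  · have hlt : m * b1 < m * b0 := mul_lt_mul_of_neg_left hb hm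
    rw [sign_neg hm]
    by_cases hex : ∃ a, b0 < a ∧ a < b1 ∧ f0 + m * a = 0
    · obtain ⟨a, ha0, ha1, ha⟩ := hex
      have e1 : f0 + m * b1 < 0 := by nlinarith
      have e2 : ¬ f0 + m * b0 < 0 := by nlinarith
      rw [if_pos e1, if_neg e2, if_pos ⟨a, ha0, ha1, ha⟩]; simp
    · rw [if_neg hex]
      by_cases e1 : f0 + m * b1 < 0
      · have e2 : f0 + m * b0 < 0 := by
          by_contra e2
          have e2' : 0 < f0 + m * b0 := lt_of_le_of_ne (not_lt.1 e2) (Ne.symm h0)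
          refine hex ⟨-f0 / m, ?_, ?_, by rw [mul_div_cancel₀ _ hm.ne]; ring⟩
          · rw [lt_div_iff_of_neg hm]; linarith
          · rw [div_lt_iff_of_neg hm]; linarith
        simp [e1, e2]
      · have e2 : ¬ f0 + m * b0 < 0 := by intro e2; exact e1 (by linarith)
        simp [e1, e2]
  · subst hm; simp
  · have hlt : m * b0 < m * b1 := mul_lt_mul_of_pos_left hb hm
    rw [sign_pos hm]
    by_cases hex : ∃ a, b0 < a ∧ a < b1 ∧ f0 + m * a = 0
    · obtain ⟨a, ha0, ha1, ha⟩ := hex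
      have e1 : ¬ f0 + m * b1 < 0 := by nlinarith
      have e2 : f0 + m * b0 < 0 := by nlinarith
      rw [if_neg e1, if_pos e2, if_pos ⟨a, ha0, ha1, ha⟩]; simp
    · rw [if_neg hex]
      by_cases e1 : f0 + m * b1 < 0
      · have e2 : f0 + m * b0 < 0 := by linarith
        simp [e1, e2]
      · have e2 : ¬ f0 + m * b0 < 0 := by
          intro e2
          have e1' : 0 < f0 + m * b1 := lt_of_le_of_ne (not_lt.1 e1) (Ne.symm h1)
          refine hex ⟨-f0 / m, ?_, ?_, by rw [mul_div_cancel₀ _ hm.ne']; ring⟩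
          · rw [lt_div_iff₀ hm]; linarith
          · rw [div_lt_iff₀ hm]; linarith
        simp [e1, e2]

/-- An edge seen as a graph over the transversal coordinate `a` of a strip. The boundary of the
region `0 < a < h`, `f < 0` consists of two sides and a base, and the three terms on the right count
crossings of these. -/
lemma indicator_strip_sub {f0 m a0 a1 h : ℝ} (ha : a0 < a1) (hh : 0 < h)
    (n00 : a0 ≠ 0) (n0h : a0 ≠ h) (n10 : a1 ≠ 0) (n1h : a1 ≠ h)
    (z0 : a0 < 0 → 0 < a1 → f0 + m * 0 ≠ 0) (zh : a0 < h → h < a1 → f0 + m * h ≠ 0)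
    (e0 : 0 < a0 → a0 < h → f0 + m * a0 ≠ 0) (e1 : 0 < a1 → a1 < h → f0 + m * a1 ≠ 0) :
    (if 0 < a1 ∧ a1 < h ∧ f0 + m * a1 < 0 then (1 : ℝ) else 0) -
      (if 0 < a0 ∧ a0 < h ∧ f0 + m * a0 < 0 then 1 else 0) =
    (if (a0 < 0 ∧ 0 < a1) ∧ f0 + m * 0 < 0 then 1 else 0) -
      (if (a0 < h ∧ h < a1) ∧ f0 + m * h < 0 then 1 else 0) -
      (SignType.sign m : ℝ) *
        (if ∃ a, a0 < a ∧ a < a1 ∧ f0 + m * a = 0 ∧ 0 < a ∧ a < h then 1 else 0) := by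
  -- `b0` and `b1` are the endpoints after clipping the interval to the strip; the case distinction
  -- below runs over the possible clippings.
  have key : ∀ b0 b1, b0 < b1 → f0 + m * b0 ≠ 0 → f0 + m * b1 ≠ 0 →
      (∀ a, (b0 < a ∧ a < b1) ↔ (a0 < a ∧ a < a1 ∧ 0 < a ∧ a < h)) →
      (if f0 + m * b1 < 0 then (1 : ℝ) else 0) - (if f0 + m * b0 < 0 then 1 else 0) =
      -(SignType.sign m : ℝ) *
        (if ∃ a, a0 < a ∧ a < a1 ∧ f0 + m * a = 0 ∧ 0 < a ∧ a < h then 1 else 0) := by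
    intro b0 b1 hb h0 h1 hiff
    rw [indicator_neg_sub hb h0 h1]
    congr 2
    apply propext
    constructor
    · rintro ⟨a, p, q, r⟩
      obtain ⟨p1, p2, p3, p4⟩ := (hiff a).1 ⟨p, q⟩
      exact ⟨a, p1, p2, r, p3, p4⟩
    · rintro ⟨a, p, q, r, s, t⟩
      obtain ⟨p1, p2⟩ := (hiff a).2 ⟨p, q, s, t⟩
      exact ⟨a, p1, p2, r⟩
  have none : (∀ a, ¬ (a0 < a ∧ a < a1 ∧ 0 < a ∧ a < h)) →
      ¬ ∃ a, a0 < a ∧ a < a1 ∧ f0 + m * a = 0 ∧ 0 < a ∧ a < h := by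
    rintro hn ⟨a, p, q, r, s, t⟩
    exact hn a ⟨p, q, s, t⟩
  rcases lt_or_gt_of_ne n00 with c0 | c0
  · rcases lt_or_gt_of_ne n10 with c1 | c1
    · rw [if_neg (none fun a ⟨p, q, s, t⟩ => by linarith)]
      simp [c0.not_gt, c1.not_gt, show ¬ h < a1 by linarith]
    · rcases lt_or_gt_of_ne n1h with c2 | c2
      · have := key 0 a1 c1 (z0 c0 c1) (e1 c1 c2)
          (fun a => ⟨fun ⟨p, q⟩ => ⟨by linarith, q, p, by linarith⟩, fun ⟨p, q, s, t⟩ => ⟨s, q⟩⟩)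
        simp only [c0, c1, c2, c0.not_gt, c2.not_gt, true_and, false_and, and_false, if_false,
          sub_zero, and_true]
        linarith
      · have := key 0 h hh (z0 c0 c1) (zh (by linarith) c2)
          (fun a => ⟨fun ⟨p, q⟩ => ⟨by linarith, by linarith, p, q⟩, fun ⟨p, q, s, t⟩ => ⟨s, t⟩⟩)
        simp only [c0, c1, c2, c0.not_gt, c2.not_gt, true_and, false_and, and_false, if_false,
          sub_zero, and_true, c0.trans hh]
        linarith
  · have c1 : 0 < a1 := by linarith
    rcases lt_or_gt_of_ne n0h with d0 | d0
    · rcases lt_or_gt_of_ne n1h with c2 | c2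
      · have := key a0 a1 ha (e0 c0 d0) (e1 c1 c2)
          (fun a => ⟨fun ⟨p, q⟩ => ⟨p, q, by linarith, by linarith⟩,
            fun ⟨p, q, s, t⟩ => ⟨p, q⟩⟩)
        simp only [c0, c1, c2, c0.not_gt, c2.not_gt, true_and, false_and, and_false, if_false,
          sub_zero, and_true, d0]
        linarith
      · have := key a0 h d0 (e0 c0 d0) (zh d0 c2)
          (fun a => ⟨fun ⟨p, q⟩ => ⟨p, by linarith, by linarith, q⟩,
            fun ⟨p, q, s, t⟩ => ⟨p, t⟩⟩)
        simp only [c0, c1, c2, c0.not_gt, c2.not_gt, true_and, false_and, and_false, if_false,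
          and_true, d0]
        linarith
    · rw [if_neg (none fun a ⟨p, q, s, t⟩ => by linarith)]
      simp [c0.not_gt, d0.not_gt, show ¬ a1 < h by linarith]

/-- Along an interval, on which `α` and `γ` are affine with slopes `q` and `g`, the changes of the
indicator function of the region `0 < α < h`, `γ < 0` are accounted for by the crossings of the
boundary of this region. -/
lemma crossing_identity {α₀ q γ₀ g L h : ℝ} (hL : 0 < L) (hh : 0 < h)
    (n00 : α₀ ≠ 0) (n0h : α₀ ≠ h) (n10 : α₀ + L * q ≠ 0) (n1h : α₀ + L * q ≠ h)
    (z0 : ∀ s, 0 < s → s < L → α₀ + s * q = 0 → γ₀ + s * g ≠ 0)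
    (zh : ∀ s, 0 < s → s < L → α₀ + s * q = h → γ₀ + s * g ≠ 0)
    (e0 : 0 < α₀ → α₀ < h → γ₀ ≠ 0)
    (e1 : 0 < α₀ + L * q → α₀ + L * q < h → γ₀ + L * g ≠ 0) :
    q * ((if 0 < α₀ + L * q ∧ α₀ + L * q < h ∧ γ₀ + L * g < 0 then (1 : ℝ) else 0) -
      (if 0 < α₀ ∧ α₀ < h ∧ γ₀ < 0 then 1 else 0)) =
    |q| * (if ∃ s, (0 < s ∧ s < L) ∧ α₀ + s * q = 0 ∧ γ₀ + s * g < 0 then 1 else 0) -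
      |q| * (if ∃ s, (0 < s ∧ s < L) ∧ α₀ + s * q = h ∧ γ₀ + s * g < 0 then 1 else 0) -
      (SignType.sign g : ℝ) * q *
        (if ∃ s, (0 < s ∧ s < L) ∧ γ₀ + s * g = 0 ∧ 0 < α₀ + s * q ∧ α₀ + s * q < h
          then 1 else 0) := by
  -- Reversing the orientation of the interval changes the signs of `q` and `g` and exchanges the
  -- endpoints, and both sides of the identity are invariant under this.
  wlog hq : 0 < q generalizing α₀ q γ₀ g
  · rcases eq_or_lt_of_le (not_lt.1 hq) with hq0 | hq0
    · simp [hq0]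
    have flip : ∀ p : ℝ → Prop, (∃ s, (0 < s ∧ s < L) ∧ p (L - s)) ↔
        ∃ s, (0 < s ∧ s < L) ∧ p s := fun p =>
      ⟨fun ⟨s, hs, hp⟩ => ⟨L - s, ⟨by linarith, by linarith⟩, hp⟩,
        fun ⟨s, hs, hp⟩ => ⟨L - s, ⟨by linarith, by linarith⟩, by simpa using hp⟩⟩
    have ra : ∀ s, α₀ + L * q + s * (-q) = α₀ + (L - s) * q := fun s => by ring
    have rc : ∀ s, γ₀ + L * g + s * (-g) = γ₀ + (L - s) * g := fun s => by ring
    have := this (α₀ := α₀ + L * q) (q := -q) (γ₀ := γ₀ + L * g) (g := -g) n10 n1h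
      (by rw [ra]; simpa using n00) (by rw [ra]; simpa using n0h)
      (fun s h1 h2 h3 => by
        rw [rc]; rw [ra] at h3; exact z0 _ (by linarith) (by linarith) h3)
      (fun s h1 h2 h3 => by
        rw [rc]; rw [ra] at h3; exact zh _ (by linarith) (by linarith) h3)
      e1 (by rw [ra, rc]; simpa using e0) (by linarith)
    simp only [ra, rc] at this
    rw [flip (fun s => α₀ + s * q = 0 ∧ γ₀ + s * g < 0),
      flip (fun s => α₀ + s * q = h ∧ γ₀ + s * g < 0),
      flip (fun s => γ₀ + s * g = 0 ∧ 0 < α₀ + s * q ∧ α₀ + s * q < h)] at this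
    simp only [sub_self, zero_mul, add_zero, abs_neg] at this
    have hs : (SignType.sign (-g) : ℝ) = -(SignType.sign g : ℝ) := by
      rw [Left.sign_neg]; simp
    rw [hs] at this
    linarith
  have hLq : 0 < L * q := mul_pos hL hq
  -- Since `q > 0`, `α` itself can serve as parameter, and `γ` is affine in `α` with slope `g / q`.
  have hp : ∀ s, γ₀ + s * g = (γ₀ - α₀ * (g / q)) + g / q * (α₀ + s * q) := by
    intro s; field_simp; ring
  have hp0 : γ₀ = (γ₀ - α₀ * (g / q)) + g / q * α₀ := by field_simp; ring
  have hex : ∀ p : ℝ → Prop, (∃ s, (0 < s ∧ s < L) ∧ p (α₀ + s * q)) ↔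
      ∃ a, (α₀ < a ∧ a < α₀ + L * q) ∧ p a := by
    intro p
    constructor
    · rintro ⟨s, ⟨h1, h2⟩, h3⟩
      exact ⟨_, ⟨by nlinarith, by nlinarith⟩, h3⟩
    · rintro ⟨a, ⟨h1, h2⟩, h3⟩
      refine ⟨(a - α₀) / q, ⟨div_pos (by linarith) hq, ?_⟩, ?_⟩
      · rw [div_lt_iff₀ hq]; linarith
      · rw [div_mul_cancel₀ _ hq.ne']; simpa using h3
  have hsg : SignType.sign (g / q) = SignType.sign g := by
    rcases lt_trichotomy g 0 with hg | hg | hg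
    · rw [sign_neg hg, sign_neg (div_neg_of_neg_of_pos hg hq)]
    · simp [hg]
    · rw [sign_pos hg, sign_pos (div_pos hg hq)]
  have main := indicator_strip_sub (f0 := γ₀ - α₀ * (g / q)) (m := g / q) (a0 := α₀)
    (a1 := α₀ + L * q) (h := h) (by linarith) hh n00 n0h n10 n1h ?_ ?_ ?_ ?_
  · rw [abs_of_pos hq]
    have x1 : (∃ s, (0 < s ∧ s < L) ∧ α₀ + s * q = 0 ∧ γ₀ + s * g < 0) ↔
        (α₀ < 0 ∧ 0 < α₀ + L * q) ∧ γ₀ - α₀ * (g / q) + g / q * 0 < 0 := by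
      simp only [hp]
      rw [hex fun a => a = 0 ∧ γ₀ - α₀ * (g / q) + g / q * a < 0]
      constructor
      · rintro ⟨a, h1, rfl, h2⟩; exact ⟨h1, h2⟩
      · rintro ⟨h1, h2⟩; exact ⟨0, h1, rfl, h2⟩
    have x2 : (∃ s, (0 < s ∧ s < L) ∧ α₀ + s * q = h ∧ γ₀ + s * g < 0) ↔
        (α₀ < h ∧ h < α₀ + L * q) ∧ γ₀ - α₀ * (g / q) + g / q * h < 0 := by
      simp only [hp]
      rw [hex fun a => a = h ∧ γ₀ - α₀ * (g / q) + g / q * a < 0]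
      constructor
      · rintro ⟨a, h1, rfl, h2⟩; exact ⟨h1, h2⟩
      · rintro ⟨h1, h2⟩; exact ⟨h, h1, rfl, h2⟩
    have x3 : (∃ s, (0 < s ∧ s < L) ∧ γ₀ + s * g = 0 ∧ 0 < α₀ + s * q ∧ α₀ + s * q < h) ↔
        ∃ a, α₀ < a ∧ a < α₀ + L * q ∧ γ₀ - α₀ * (g / q) + g / q * a = 0 ∧ 0 < a ∧ a < h := by
      simp only [hp]
      rw [hex fun a => γ₀ - α₀ * (g / q) + g / q * a = 0 ∧ 0 < a ∧ a < h]
      simp only [and_assoc]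
    rw [hsg, ← hp, ← hp0] at main
    rw [if_congr x1 rfl rfl, if_congr x2 rfl rfl, if_congr x3 rfl rfl, main]
    ring
  · intro h1 h2
    obtain ⟨s, hs, hs'⟩ := (hex (fun a => a = 0)).2 ⟨0, ⟨h1, h2⟩, rfl⟩
    have := z0 s hs.1 hs.2 hs'
    rwa [hp, hs'] at this
  · intro h1 h2
    obtain ⟨s, hs, hs'⟩ := (hex (fun a => a = h)).2 ⟨h, ⟨h1, h2⟩, rfl⟩
    have := zh s hs.1 hs.2 hs'
    rwa [hp, hs'] at this
  · rw [← hp0]; exact e0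
  · rw [← hp]; exact e1

/-- The version of `crossing_identity` for a half line. -/
lemma crossing_identity_ray {α₀ q γ₀ g h : ℝ} (hh : 0 < h)
    (n00 : α₀ ≠ 0) (n0h : α₀ ≠ h)
    (z0 : ∀ s, 0 < s → α₀ + s * q = 0 → γ₀ + s * g ≠ 0)
    (zh : ∀ s, 0 < s → α₀ + s * q = h → γ₀ + s * g ≠ 0)
    (e0 : 0 < α₀ → α₀ < h → γ₀ ≠ 0) :
    q * (0 - (if 0 < α₀ ∧ α₀ < h ∧ γ₀ < 0 then 1 else 0)) =
    |q| * (if ∃ s, 0 < s ∧ α₀ + s * q = 0 ∧ γ₀ + s * g < 0 then 1 else 0) -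
      |q| * (if ∃ s, 0 < s ∧ α₀ + s * q = h ∧ γ₀ + s * g < 0 then 1 else 0) -
      (SignType.sign g : ℝ) * q *
        (if ∃ s, 0 < s ∧ γ₀ + s * g = 0 ∧ 0 < α₀ + s * q ∧ α₀ + s * q < h
          then 1 else 0) := by
  by_cases hq : q = 0
  · simp [hq]
  -- The half line is cut at a parameter `L` from which on `α` stays outside `[0, h]`; nothing is
  -- lost, and the far endpoint contributes zero.
  obtain ⟨L, hL, hout⟩ : ∃ L : ℝ, 0 < L ∧ ∀ s, L ≤ s → ¬ (0 ≤ α₀ + s * q ∧ α₀ + s * q ≤ h) := by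
    rcases lt_or_gt_of_ne hq with hq | hq
    · refine ⟨max 1 ((-1 - α₀) / q), by positivity, fun s hs ⟨h1, _⟩ => ?_⟩
      have := (le_max_right _ _).trans hs
      rw [div_le_iff_of_neg hq] at this
      linarith
    · refine ⟨max 1 ((h + 1 - α₀) / q), by positivity, fun s hs ⟨_, h1⟩ => ?_⟩
      have := (le_max_right _ _).trans hs
      rw [div_le_iff₀ hq] at this
      linarith
  have hLo := hout L le_rfl
  have main := crossing_identity (α₀ := α₀) (q := q) (γ₀ := γ₀) (g := g) hL hh n00 n0h
    (fun h' => hLo (by rw [h']; exact ⟨le_rfl, hh.le⟩))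
    (fun h' => hLo (by rw [h']; exact ⟨hh.le, le_rfl⟩))
    (fun s h1 _ => z0 s h1) (fun s h1 _ => zh s h1) e0
    (fun h1 h2 => absurd ⟨h1.le, h2.le⟩ hLo)
  rw [if_neg (fun h' => hLo ⟨h'.1.le, h'.2.1.le⟩)] at main
  rw [main]
  have x1 : (∃ s, (0 < s ∧ s < L) ∧ α₀ + s * q = 0 ∧ γ₀ + s * g < 0) ↔
      ∃ s, 0 < s ∧ α₀ + s * q = 0 ∧ γ₀ + s * g < 0 := by
    refine exists_congr fun s => ⟨fun ⟨h1, h2⟩ => ⟨h1.1, h2⟩, fun ⟨h1, h2⟩ => ⟨⟨h1, ?_⟩, h2⟩⟩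
    by_contra h3
    exact hout s (not_lt.1 h3) ⟨by linarith [h2.1], by linarith [h2.1]⟩
  have x2 : (∃ s, (0 < s ∧ s < L) ∧ α₀ + s * q = h ∧ γ₀ + s * g < 0) ↔
      ∃ s, 0 < s ∧ α₀ + s * q = h ∧ γ₀ + s * g < 0 := by
    refine exists_congr fun s => ⟨fun ⟨h1, h2⟩ => ⟨h1.1, h2⟩, fun ⟨h1, h2⟩ => ⟨⟨h1, ?_⟩, h2⟩⟩
    by_contra h3
    exact hout s (not_lt.1 h3) ⟨by linarith [h2.1], by linarith [h2.1]⟩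
  have x3 : (∃ s, (0 < s ∧ s < L) ∧ γ₀ + s * g = 0 ∧ 0 < α₀ + s * q ∧ α₀ + s * q < h) ↔
      ∃ s, 0 < s ∧ γ₀ + s * g = 0 ∧ 0 < α₀ + s * q ∧ α₀ + s * q < h := by
    refine exists_congr fun s => ⟨fun ⟨h1, h2⟩ => ⟨h1.1, h2⟩, fun ⟨h1, h2⟩ => ⟨⟨h1, ?_⟩, h2⟩⟩
    by_contra h3
    exact hout s (not_lt.1 h3) ⟨by linarith [h2.2.1], by linarith [h2.2.2]⟩
  rw [if_congr x1 rfl rfl, if_congr x2 rfl rfl, if_congr x3 rfl rfl]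

end Interval

/-! ### Edges at a vertex -/

namespace CombType

variable {d n : ℕ} (T : CombType d n)

open scoped Classical in
/-- The non-marked edges at a vertex. -/
def star (v : T.Vert) : Finset T.Edge := Finset.univ.filter (T.Incident v)

variable {T}

@[simp] lemma mem_star {v : T.Vert} {e : T.Edge} : e ∈ T.star v ↔ T.Incident v e := by
  classical
  simp [star]

-- A bounded edge is stored once, with `e.1 < e.2`, so a neighbour `w` of `v` corresponds to `(v,
-- w)` or to `(w, v)`. Through this bijection both valence and balancing become sums over `star`.
open scoped Classical in
lemma sum_star {M : Type*} [AddCommMonoid M] (f : T.Vert → T.Vert → M) (g : Fin 3 × Fin d → M)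
    (v : T.Vert) :
    ∑ w with T.graph.Adj v w, f v w + ∑ a with T.endAt a = v, g a =
      ∑ e ∈ T.star v, Sum.elim
        (fun p : {e : T.Vert × T.Vert // e.1 < e.2 ∧ T.graph.Adj e.1 e.2} =>
          if p.1.1 = v then f p.1.1 p.1.2 else f p.1.2 p.1.1) g e := by
  rw [star, Finset.sum_filter (p := T.Incident v), Fintype.sum_sum_type,
    Finset.sum_filter (p := fun a => T.endAt a = v)]
  congr 1
  swap
  · exact Finset.sum_congr rfl fun a _ => if_congr Iff.rfl rfl rfl
  rw [← Finset.sum_filter]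
  refine Finset.sum_bij'
    (fun w hw => if h : v < w then ⟨(v, w), h, (Finset.mem_filter.1 hw).2⟩
      else ⟨(w, v), lt_of_le_of_ne (not_lt.1 h) (Finset.mem_filter.1 hw).2.ne',
        (Finset.mem_filter.1 hw).2.symm⟩)
    (fun p _ => if p.1.1 = v then p.1.2 else p.1.1) ?_ ?_ ?_ ?_ ?_
  · intro w hw
    refine Finset.mem_filter.2 ⟨Finset.mem_univ _, ?_⟩
    split_ifs
    · exact Or.inl rfl
    · exact Or.inr rfl
  · rintro ⟨⟨a, b⟩, h1, h2⟩ hp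
    replace hp : a = v ∨ b = v := (Finset.mem_filter.1 hp).2
    refine Finset.mem_filter.2 ⟨Finset.mem_univ _, ?_⟩
    simp only
    split_ifs with h
    · exact h ▸ h2
    · exact (hp.resolve_left h) ▸ h2.symm
  · intro w hw
    have hne := (Finset.mem_filter.1 hw).2.ne'
    by_cases h : v < w <;> simp [h, hne]
  · rintro ⟨⟨a, b⟩, h1, h2⟩ hp
    replace hp : a = v ∨ b = v := (Finset.mem_filter.1 hp).2
    simp only
    by_cases h : a = v
    · subst h; simp [h1]
    · have hb := hp.resolve_left h
      subst hb
      simp [h, h1.not_gt]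
  · intro w hw
    have hne := (Finset.mem_filter.1 hw).2.ne'
    by_cases h : v < w <;> simp [h, hne]

lemma val_eq (v : T.Vert) : T.val v = (T.star v).card + {i | T.mark i = v}.ncard := by
  classical
  have h := sum_star (T := T) (fun _ _ => 1) (fun _ => 1) v
  have h1 : {w | T.graph.Adj v w}.ncard = ∑ w with T.graph.Adj v w, 1 := by
    rw [← Finset.card_eq_sum_ones, ← Set.ncard_coe_finset]; simp
  have h2 : {a | T.endAt a = v}.ncard = ∑ a with T.endAt a = v, 1 := by
    rw [← Finset.card_eq_sum_ones, ← Set.ncard_coe_finset]; simp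
  have h3 : (T.star v).card = ∑ e ∈ T.star v, Sum.elim
        (fun p : {e : T.Vert × T.Vert // e.1 < e.2 ∧ T.graph.Adj e.1 e.2} =>
          if p.1.1 = v then 1 else 1) (fun _ => 1) e := by
    rw [Finset.card_eq_sum_ones]
    refine Finset.sum_congr rfl fun e _ => ?_
    cases e <;> simp
  rw [val, h1, h2, h3, ← h]
  ring

/-- Euler characteristic of the tree, with the `3d` unmarked ends added. -/
lemma card_edge : Fintype.card T.Edge + 1 = T.numVert + 3 * d := by
  classical
  have htree := T.isTree.card_edgeFinset
  rw [Fintype.card_sum, Fintype.card_prod, Fintype.card_fin, Fintype.card_fin]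
  have : Fintype.card {e : T.Vert × T.Vert // e.1 < e.2 ∧ T.graph.Adj e.1 e.2} =
      T.graph.edgeFinset.card := by
    rw [← Finset.card_univ]
    refine Finset.card_bij (fun p _ => s(p.1.1, p.1.2)) ?_ ?_ ?_
    · rintro ⟨⟨a, b⟩, h1, h2⟩ _
      simpa using h2
    · rintro ⟨⟨a, b⟩, h1, h2⟩ _ ⟨⟨a', b'⟩, h1', h2'⟩ _ h
      simp only [Sym2.eq_iff] at h
      rcases h with ⟨rfl, rfl⟩ | ⟨rfl, rfl⟩
      · rfl
      · exact absurd h1 h1'.not_gt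
    · intro e he
      induction e with
      | h a b =>
        have hab : T.graph.Adj a b := by simpa using he
        rcases lt_or_gt_of_ne hab.ne with h | h
        · exact ⟨⟨(a, b), h, hab⟩, Finset.mem_univ _, rfl⟩
        · exact ⟨⟨(b, a), h, hab.symm⟩, Finset.mem_univ _, Sym2.eq_swap⟩
  rw [this]
  simp only [Fintype.card_fin] at htree
  omega

end CombType

lemma endDir_ne_zero (j : Fin 3) : endDir j ≠ 0 := by
  fin_cases j <;> simp [endDir]

namespace Curve

variable {d n : ℕ} {T : CombType d n} (C : Curve T)

/-- Antisymmetry is no axiom of `Curve`; it follows because going along an edge and back returns to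
the same point and lengths are positive. -/
lemma dir_swap {v w : T.Vert} (h : T.graph.Adj v w) : C.dir w v = -C.dir v w := by
  have h1 := C.pos_eq v w h
  have h2 := C.pos_eq w v h.symm
  rw [Sym2.eq_swap (a := w)] at h2
  have hl := C.len_pos v w h
  apply toPlane_injective
  rw [toPlane_neg]
  have h3 : C.len s(v, w) • (toPlane (C.dir v w) + toPlane (C.dir w v)) = 0 := by
    rw [smul_add]
    have : C.pos v = C.pos v + (C.len s(v, w) • toPlane (C.dir v w) +
        C.len s(v, w) • toPlane (C.dir w v)) := by
      rw [← add_assoc, ← h1, ← h2]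
    simpa using this
  rw [smul_eq_zero] at h3
  rcases h3 with h3 | h3
  · exact absurd h3 hl.ne'
  · exact eq_neg_of_add_eq_zero_right h3

open scoped Classical in
/-- The direction vector of an edge oriented away from its endpoint `v`. -/
def outDir (v : T.Vert) : T.Edge → ℤ × ℤ :=
  Sum.elim (fun p => if p.1.1 = v then C.dir p.1.1 p.1.2 else C.dir p.1.2 p.1.1)
    (fun a => endDir a.1)

lemma sum_outDir (v : T.Vert) : ∑ e ∈ T.star v, C.outDir v e = 0 := by
  classical
  rw [← C.balanced v, CombType.sum_star (fun v w => C.dir v w) (fun a => endDir a.1)]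
  rfl

lemma outDir_eq_or_neg {v : T.Vert} {e : T.Edge} (h : T.Incident v e) :
    C.outDir v e = C.edgeDir e ∨ C.outDir v e = -C.edgeDir e := by
  rcases e with ⟨⟨a, b⟩, h1, h2⟩ | a
  · by_cases hv : a = v
    · left; simp [outDir, edgeDir, hv]
    · right
      simp only [outDir, edgeDir, Sum.elim_inl, hv, if_false]
      exact C.dir_swap h2
  · left; rfl

lemma opposite {v w : T.Vert} {e : T.Edge} (hv : T.Incident v e) (hw : T.Incident w e)
    (hne : v ≠ w) : C.outDir w e = -C.outDir v e ∧
      ∃ L : ℝ, 0 < L ∧ C.pos w = C.pos v + L • toPlane (C.outDir v e) := by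
  rcases e with ⟨⟨a, b⟩, h1, h2⟩ | a
  · simp only [CombType.Incident] at hv hw
    simp only [outDir, Sum.elim_inl]
    have hba : ¬ b = a := h1.ne'
    rcases hv with rfl | rfl
    · have : b = w := hw.resolve_left hne
      subst this
      simp only [if_true, hne, if_false]
      exact ⟨C.dir_swap h2, _, C.len_pos _ _ h2, C.pos_eq _ _ h2⟩
    · have : a = w := hw.resolve_right hne
      subst this
      simp only [if_true, h1.ne, if_false]
      exact ⟨by rw [C.dir_swap h2, neg_neg], _, C.len_pos _ _ h2.symm, C.pos_eq _ _ h2.symm⟩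
  · exact absurd (hv.symm.trans hw) hne

/-- The tip of a bounded edge, seen from its endpoint `v`, or a half line. -/
lemma closedEdge_eq {v : T.Vert} {e : T.Edge} (h : T.Incident v e) :
    C.closedEdge e = (fun s : ℝ => C.pos v + s • toPlane (C.outDir v e)) '' C.closedParam e := by
  rcases e with ⟨⟨a, b⟩, h1, h2⟩ | a
  · by_cases hv : a = v
    · subst hv; simp [outDir, closedEdge, base, edgeDir]
    · have hb : b = v := h.resolve_left hv
      subst hb
      simp only [outDir, Sum.elim_inl, hv, if_false, closedEdge, base, edgeDir, closedParam]
      have hp := C.pos_eq _ _ h2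
      rw [C.dir_swap h2, toPlane_neg, hp]
      ext y
      constructor
      · rintro ⟨s, hs, rfl⟩
        exact ⟨C.len s(a, b) - s, ⟨by linarith [hs.2], by linarith [hs.1]⟩, by module⟩
      · rintro ⟨s, hs, rfl⟩
        exact ⟨C.len s(a, b) - s, ⟨by linarith [hs.2], by linarith [hs.1]⟩, by module⟩
  · have : T.endAt a = v := h
    subst this
    rfl

lemma openEdge_eq {v : T.Vert} {e : T.Edge} (h : T.Incident v e) :
    C.openEdge e = (fun s : ℝ => C.pos v + s • toPlane (C.outDir v e)) '' C.openParam e := by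
  rcases e with ⟨⟨a, b⟩, h1, h2⟩ | a
  · by_cases hv : a = v
    · subst hv; simp [outDir, openEdge, base, edgeDir]
    · have hb : b = v := h.resolve_left hv
      subst hb
      simp only [outDir, Sum.elim_inl, hv, if_false, openEdge, base, edgeDir, openParam]
      have hp := C.pos_eq _ _ h2
      rw [C.dir_swap h2, toPlane_neg, hp]
      ext y
      constructor
      · rintro ⟨s, hs, rfl⟩
        exact ⟨C.len s(a, b) - s, ⟨by linarith [hs.2], by linarith [hs.1]⟩, by module⟩
      · rintro ⟨s, hs, rfl⟩
        exact ⟨C.len s(a, b) - s, ⟨by linarith [hs.2], by linarith [hs.1]⟩, by module⟩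
  · have : T.endAt a = v := h
    subst this
    rfl

lemma openParam_subset (e : T.Edge) : C.openParam e ⊆ C.closedParam e := by
  rcases e with e | a
  · exact Ioo_subset_Icc_self
  · exact Ioi_subset_Ici_self

lemma openEdge_subset (e : T.Edge) : C.openEdge e ⊆ C.closedEdge e :=
  image_mono (C.openParam_subset e)

lemma openEdge_subset_image (e : T.Edge) : C.openEdge e ⊆ C.image :=
  (C.openEdge_subset e).trans (subset_iUnion _ e)

lemma exists_incident (e : T.Edge) : ∃ v, T.Incident v e := by
  rcases e with e | a
  · exact ⟨e.1.1, Or.inl rfl⟩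
  · exact ⟨T.endAt a, rfl⟩

lemma exists_openParam (e : T.Edge) : ∃ L : ℝ, 0 < L ∧ Ioo 0 L ⊆ C.openParam e ∧
    Icc 0 L ⊆ C.closedParam e := by
  rcases e with ⟨⟨a, b⟩, h1, h2⟩ | a
  · exact ⟨_, C.len_pos _ _ h2, subset_rfl, subset_rfl⟩
  · exact ⟨1, one_pos, fun x hx => hx.1, fun x hx => hx.1⟩

lemma closedParam_nonneg {e : T.Edge} {s : ℝ} (hs : s ∈ C.closedParam e) : 0 ≤ s := by
  rcases e with e | a
  · exact hs.1
  · exact hs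

lemma openParam_pos {e : T.Edge} {s : ℝ} (hs : s ∈ C.openParam e) : 0 < s := by
  rcases e with e | a
  · exact hs.1
  · exact hs

lemma pos_mem_closedEdge {v : T.Vert} {e : T.Edge} (h : T.Incident v e) :
    C.pos v ∈ C.closedEdge e := by
  rw [C.closedEdge_eq h]
  obtain ⟨L, hL, -, hL'⟩ := C.exists_openParam e
  exact ⟨0, hL' ⟨le_rfl, hL.le⟩, by simp⟩

/-- Summation by parts along the curve. -/
lemma sum_by_parts (q : (ℤ × ℤ) →+ ℝ) (l : T.Vert → ℝ) :
    ∑ e : T.Edge, Sum.elim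
      (fun p : {e : T.Vert × T.Vert // e.1 < e.2 ∧ T.graph.Adj e.1 e.2} =>
        q (C.dir p.1.1 p.1.2) * (l p.1.2 - l p.1.1))
      (fun a : Fin 3 × Fin d => q (endDir a.1) * -l (T.endAt a)) e = 0 := by
  classical
  -- Each vertex contributes zero by balancing. After exchanging the summations a bounded edge
  -- collects `l` at its two endpoints with opposite signs, an end collects it once.
  have h : ∑ v : T.Vert, ∑ e ∈ T.star v, l v * q (C.outDir v e) = 0 := by
    refine Finset.sum_eq_zero fun v _ => ?_
    rw [← Finset.mul_sum, ← map_sum, C.sum_outDir, map_zero, mul_zero]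
  simp only [CombType.star, Finset.sum_filter] at h
  rw [Finset.sum_comm] at h
  rw [← neg_zero, ← h, ← Finset.sum_neg_distrib]
  refine Finset.sum_congr rfl fun e _ => ?_
  rw [← Finset.sum_filter]
  rcases e with ⟨⟨a, b⟩, h1, h2⟩ | a
  · have : (Finset.univ.filter fun v => T.Incident v (Sum.inl ⟨(a, b), h1, h2⟩)) = {a, b} := by
      ext v
      rw [Finset.mem_filter, Finset.mem_insert, Finset.mem_singleton, eq_comm (b := a),
        eq_comm (b := b)]
      exact and_iff_right (Finset.mem_univ _)
    rw [this, Finset.sum_pair h1.ne]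
    simp only [outDir, Sum.elim_inl, if_true, h1.ne, if_false, C.dir_swap h2, map_neg]
    ring
  · have : (Finset.univ.filter fun v => T.Incident v (Sum.inr a)) = {T.endAt a} := by
      ext v
      rw [Finset.mem_filter, Finset.mem_singleton, eq_comm]
      exact and_iff_right (Finset.mem_univ _)
    rw [this, Finset.sum_singleton]
    simp [outDir, mul_comm]

end Curve

/-! ### Curves through points on an irrational line -/

/-- The position relative to lines of direction `(1, -ε)`. -/
abbrev height (ε : ℝ) (y : ℝ × ℝ) : ℝ := dot (ε, 1) y

lemma height_add_smul (ε : ℝ) (x y : ℝ × ℝ) (s : ℝ) :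
    height ε (x + s • y) = height ε x + s * height ε y := by
  simp [height, dot]; ring

lemma height_neg (ε : ℝ) (m : ℤ × ℤ) :
    height ε (toPlane (-m)) = -height ε (toPlane m) := by
  simp [height, dot, toPlane]; ring

/-- The curve passes through distinct points of the line `height ε = c` of irrational slope. -/
structure OnLine {d n : ℕ} (r : Fin n → ℕ) (ε c : ℝ) {T : CombType d n} (C : Curve T) : Prop where
  irr : Irrational ε
  inj : Function.Injective C.pos
  psi : T.InPsiProduct r
  dim : 3 * d = n + ∑ i, r i + 1
  mark_inj : Function.Injective T.mark
  height_mark : ∀ i, height ε (C.pos (T.mark i)) = c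

namespace OnLine

variable {d n : ℕ} {r : Fin n → ℕ} {ε c : ℝ} {T : CombType d n} {C : Curve T}
  (H : OnLine r ε c C)
include H

lemma outDir_ne_zero {v : T.Vert} {e : T.Edge} (h : T.Incident v e) : C.outDir v e ≠ 0 := by
  rcases e with ⟨⟨a, b⟩, h1, h2⟩ | a
  · obtain ⟨w, hw, hne⟩ : ∃ w, T.Incident w (Sum.inl ⟨(a, b), h1, h2⟩) ∧ v ≠ w := by
      by_cases hv : v = a
      · exact ⟨b, Or.inr rfl, hv ▸ h1.ne⟩
      · exact ⟨a, Or.inl rfl, hv⟩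
    obtain ⟨-, L, -, hL⟩ := C.opposite h hw hne
    intro h0
    rw [h0, toPlane_zero, smul_zero, add_zero] at hL
    exact hne (H.inj hL.symm)
  · exact endDir_ne_zero _

lemma edgeDir_ne_zero (e : T.Edge) : C.edgeDir e ≠ 0 := by
  obtain ⟨v, hv⟩ := Curve.exists_incident e
  intro h0
  rcases C.outDir_eq_or_neg hv with h | h <;>
  · rw [h0] at h
    exact H.outDir_ne_zero hv (by simpa using h)

lemma height_outDir_ne_zero {v : T.Vert} {e : T.Edge} (h : T.Incident v e) :
    height ε (toPlane (C.outDir v e)) ≠ 0 :=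
  dot_irrational_ne_zero H.irr (H.outDir_ne_zero h)

lemma ncard_mark (i : Fin n) : {j | T.mark j = T.mark i}.ncard = 1 := by
  rw [Set.ncard_eq_one]
  exact ⟨i, by ext j; simp [H.mark_inj.eq_iff]⟩

/-- The valence is at least `3 + r i`, and one unit of it is the marked end itself. -/
lemma le_card_star_mark (i : Fin n) : r i + 2 ≤ (T.star (T.mark i)).card := by
  classical
  have h := H.psi (T.mark i)
  rw [CombType.val_eq, H.ncard_mark] at h
  have : ∑ j with T.mark j = T.mark i, r j = r i := by
    rw [Finset.sum_filter]
    simp [H.mark_inj.eq_iff]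
  rw [this] at h
  omega

omit H in
lemma three_le_card_star {v : T.Vert} (hv : v ∉ range T.mark) : 3 ≤ (T.star v).card := by
  have h := T.three_le_val v
  have h' := T.val_eq v
  have : {i | T.mark i = v} = ∅ := by
    ext i; simpa using fun h => hv ⟨i, h⟩
  rw [this, Set.ncard_empty] at h'
  unfold CombType.val at h'
  rw [this, Set.ncard_empty] at h
  rw [this, Set.ncard_empty] at h'
  omega

/-- The heights of the outgoing directions sum to zero by balancing, and none of them vanishes
because of the irrational slope. -/
lemma exists_up {v : T.Vert} (hv : v ∉ range T.mark) :
    ∃ e, T.Incident v e ∧ 0 < height ε (toPlane (C.outDir v e)) := by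
  have hs : ∑ e ∈ T.star v, height ε (toPlane (C.outDir v e)) = 0 := by
    have := congrArg (dotLin (ε, 1)) (congrArg toPlane (C.sum_outDir v))
    rw [toPlane_sum, map_sum, toPlane_zero, map_zero] at this
    exact this
  have hne : (T.star v).Nonempty := by
    rw [← Finset.card_pos]; have := three_le_card_star hv; omega
  obtain ⟨e₀, he₀⟩ := hne
  obtain ⟨e, he, hpos⟩ := Finset.exists_pos_of_sum_zero_of_exists_nonzero _ hs
    ⟨e₀, he₀, H.height_outDir_ne_zero (CombType.mem_star.1 he₀)⟩
  exact ⟨e, CombType.mem_star.1 he, hpos⟩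

lemma exists_down {v : T.Vert} (hv : v ∉ range T.mark) :
    ∃ e, T.Incident v e ∧ height ε (toPlane (C.outDir v e)) < 0 := by
  have hs : ∑ e ∈ T.star v, -height ε (toPlane (C.outDir v e)) = 0 := by
    have := congrArg (dotLin (ε, 1)) (congrArg toPlane (C.sum_outDir v))
    rw [toPlane_sum, map_sum, toPlane_zero, map_zero] at this
    rw [Finset.sum_neg_distrib, neg_eq_zero]
    exact this
  have hne : (T.star v).Nonempty := by
    rw [← Finset.card_pos]; have := three_le_card_star hv; omega
  obtain ⟨e₀, he₀⟩ := hne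
  obtain ⟨e, he, hpos⟩ := Finset.exists_pos_of_sum_zero_of_exists_nonzero _ hs
    ⟨e₀, he₀, neg_ne_zero.2 (H.height_outDir_ne_zero (CombType.mem_star.1 he₀))⟩
  exact ⟨e, CombType.mem_star.1 he, by linarith⟩

end OnLine

/-! ### Counting the edges that lead away from the line -/

/-- The edge `e` leads from the unmarked vertex `v` away from the line. -/
def Curve.Away {d n : ℕ} {T : CombType d n} (C : Curve T) (ε c : ℝ) (v : T.Vert) (e : T.Edge) :
    Prop :=
  v ∉ range T.mark ∧ T.Incident v e ∧
    (c ≤ height ε (C.pos v) → 0 < height ε (toPlane (C.outDir v e))) ∧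
    (height ε (C.pos v) < c → height ε (toPlane (C.outDir v e)) < 0)

namespace OnLine

variable {d n : ℕ} {r : Fin n → ℕ} {ε c : ℝ} {T : CombType d n} {C : Curve T}
  (H : OnLine r ε c C)
include H

lemma exists_away {v : T.Vert} (hv : v ∉ range T.mark) : ∃ e, C.Away ε c v e := by
  by_cases h : c ≤ height ε (C.pos v)
  · obtain ⟨e, he, hp⟩ := H.exists_up hv
    exact ⟨e, hv, he, fun _ => hp, fun h' => absurd h h'.not_ge⟩
  · obtain ⟨e, he, hp⟩ := H.exists_down hv
    exact ⟨e, hv, he, fun h' => absurd h' h, fun _ => hp⟩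

omit H in
-- The other endpoint lies still farther from the line on the same side, and seen from there the
-- edge leads back.
lemma away_unique_vertex {v w : T.Vert} {e : T.Edge} (h1 : C.Away ε c v e)
    (h2 : C.Away ε c w e) : v = w := by
  by_contra hne
  obtain ⟨hout, L, hL, hpos⟩ := C.opposite h1.2.1 h2.2.1 hne
  have hh : height ε (C.pos w) = height ε (C.pos v) +
      L * height ε (toPlane (C.outDir v e)) := by rw [hpos, height_add_smul]
  have h3 := h2.2.2
  rw [hout, height_neg] at h3
  by_cases h : c ≤ height ε (C.pos v)
  · have := h1.2.2.1 h
    have h4 : 0 < L * height ε (toPlane (C.outDir v e)) := mul_pos hL this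
    have := h3.1 (by linarith)
    linarith
  · have := h1.2.2.2 (not_le.1 h)
    have h4 : L * height ε (toPlane (C.outDir v e)) < 0 := mul_neg_of_pos_of_neg hL this
    have := h3.2 (by linarith)
    linarith

lemma away_not_mark {v w : T.Vert} {e : T.Edge} (h1 : C.Away ε c v e)
    (h2 : T.Incident w e) : w ∉ range T.mark := by
  by_cases hne : v = w
  · exact hne ▸ h1.1
  obtain ⟨hout, L, hL, hpos⟩ := C.opposite h1.2.1 h2 hne
  have hh : height ε (C.pos w) = height ε (C.pos v) +
      L * height ε (toPlane (C.outDir v e)) := by rw [hpos, height_add_smul]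
  rintro ⟨i, rfl⟩
  rw [H.height_mark] at hh
  by_cases h : c ≤ height ε (C.pos v)
  · have h4 := mul_pos hL (h1.2.2.1 h)
    linarith
  · have h4 := mul_neg_of_pos_of_neg hL (h1.2.2.2 (not_le.1 h))
    linarith

/-- An edge joining two marked vertices would be parallel to the line. -/
lemma mark_eq_of_incident {i j : Fin n} {e : T.Edge} (hi : T.Incident (T.mark i) e)
    (hj : T.Incident (T.mark j) e) : i = j := by
  by_contra hne
  obtain ⟨-, L, hL, hpos⟩ := C.opposite hi hj (fun h => hne (H.mark_inj h))
  have h1 := congrArg (height ε) hpos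
  rw [height_add_smul, H.height_mark, H.height_mark] at h1
  have := H.height_outDir_ne_zero hi
  have : L * height ε (toPlane (C.outDir (T.mark i) e)) ≠ 0 := mul_ne_zero hL.ne' this
  apply this
  linarith

-- The Euler characteristic, sorted by whether an edge has a marked endpoint; an edge has at most
-- one, so those edges are counted by the stars of the marked vertices.
open scoped Classical in
lemma card_count : (Finset.univ.filter fun e : T.Edge =>
      ∀ v, T.Incident v e → v ∉ range T.mark).card + ∑ i, (T.star (T.mark i)).card + 1 =
    (Finset.univ.filter fun v : T.Vert => v ∉ range T.mark).card + n + 3 * d := by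
  have h1 := T.card_edge
  have h2 := Finset.card_filter_add_card_filter_not (s := (Finset.univ : Finset T.Edge))
    (fun e : T.Edge => ∀ v, T.Incident v e → v ∉ range T.mark)
  have h3 := Finset.card_filter_add_card_filter_not (s := (Finset.univ : Finset T.Vert))
    (fun v => v ∉ range T.mark)
  have h4 : (Finset.univ.filter fun e : T.Edge =>
      ¬ ∀ v, T.Incident v e → v ∉ range T.mark).card = ∑ i, (T.star (T.mark i)).card := by
    rw [← Finset.card_biUnion]
    · congr 1
      ext e
      simp [CombType.mem_star]
    · intro i _ j _ hij
      rw [Function.onFun, Finset.disjoint_left]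
      intro e he he'
      exact hij (H.mark_eq_of_incident (CombType.mem_star.1 he) (CombType.mem_star.1 he'))
  have h5 : (Finset.univ.filter fun v : T.Vert => ¬ v ∉ range T.mark).card = n := by
    have : (Finset.univ.filter fun v : T.Vert => ¬ v ∉ range T.mark) =
        Finset.univ.image T.mark := by ext v; simp
    rw [this, Finset.card_image_of_injective _ H.mark_inj, Finset.card_fin]
  rw [Finset.card_univ] at h2 h3
  rw [Fintype.card_fin] at h3
  omega

-- Choosing an edge that leads away embeds the unmarked vertices into the edges without marked
-- endpoint.
open scoped Classical in
lemma card_unmarked_le (φ : T.Vert → T.Edge) (hφ : ∀ v, v ∉ range T.mark → C.Away ε c v (φ v)) :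
    (Finset.univ.filter fun v : T.Vert => v ∉ range T.mark).image φ ⊆
      (Finset.univ.filter fun e : T.Edge => ∀ v, T.Incident v e → v ∉ range T.mark) ∧
    ((Finset.univ.filter fun v : T.Vert => v ∉ range T.mark).image φ).card =
      (Finset.univ.filter fun v : T.Vert => v ∉ range T.mark).card := by
  constructor
  · intro e he
    obtain ⟨v, hv, rfl⟩ := Finset.mem_image.1 he
    simp only [Finset.mem_filter, Finset.mem_univ, true_and] at hv ⊢
    exact fun w hw => H.away_not_mark (hφ v hv) hw
  · refine Finset.card_image_of_injOn fun v hv w hw hvw => ?_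
    simp only [Finset.coe_filter, Finset.mem_univ, true_and, mem_ofPred_eq] at hv hw
    have h2 := hφ w hw
    rw [← hvw] at h2
    exact away_unique_vertex (hφ v hv) h2

lemma exists_choice : ∃ φ : T.Vert → T.Edge, ∀ v, v ∉ range T.mark → C.Away ε c v (φ v) := by
  classical
  have h : ∀ v, ∃ e : T.Edge, v ∉ range T.mark → C.Away ε c v e := by
    intro v
    -- The value at marked vertices is arbitrary; some edge only has to exist.
    by_cases hv : v ∈ range T.mark
    · have h3 := T.three_le_val v
      obtain ⟨i, hi⟩ := hv
      have h3 := H.le_card_star_mark i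
      obtain ⟨e, -⟩ := Finset.card_pos.1 (show 0 < (T.star (T.mark i)).card by omega)
      exact ⟨e, fun h => absurd ⟨i, hi⟩ h⟩
    · obtain ⟨e, he⟩ := H.exists_away hv
      exact ⟨e, fun _ => he⟩
  choose φ hφ using h
  exact ⟨φ, hφ⟩

/-- With `dim` inserted, `card_count` says that two excesses sum to zero: that of edges without
marked endpoint over unmarked vertices, and the total excess of the star sizes over `r i + 2`. Both
are nonnegative, so both vanish. -/
lemma card_star_mark (i : Fin n) : (T.star (T.mark i)).card = r i + 2 := by
  classical
  obtain ⟨φ, hφ⟩ := H.exists_choice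
  obtain ⟨h1, h2⟩ := H.card_unmarked_le φ hφ
  have h3 := Finset.card_le_card h1
  rw [h2] at h3
  have h4 := H.card_count
  have h5 : ∑ i, (r i + 2) ≤ ∑ i, (T.star (T.mark i)).card :=
    Finset.sum_le_sum fun i _ => H.le_card_star_mark i
  have h6 : ∑ i, (r i + 2) = ∑ i, r i + 2 * n := by
    rw [Finset.sum_add_distrib]; simp [mul_comm]
  have h7 := H.dim
  have h8 : ∑ i, (r i + 2) = ∑ i, (T.star (T.mark i)).card := by omega
  exact ((Finset.sum_eq_sum_iff_of_le fun i _ => H.le_card_star_mark i).1 h8 i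
    (Finset.mem_univ i)).symm

/-- As the two finite sets have equal size, the injection given by any choice is onto. -/
lemma exists_away_of_choice (φ : T.Vert → T.Edge)
    (hφ : ∀ v, v ∉ range T.mark → C.Away ε c v (φ v)) {e : T.Edge}
    (he : ∀ v, T.Incident v e → v ∉ range T.mark) : ∃ v, v ∉ range T.mark ∧ φ v = e := by
  classical
  obtain ⟨h1, h2⟩ := H.card_unmarked_le φ hφ
  have h4 := H.card_count
  have h6 : ∑ i, (T.star (T.mark i)).card = ∑ i, r i + 2 * n := by
    simp only [H.card_star_mark, Finset.sum_add_distrib]; simp [mul_comm]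
  have h7 := H.dim
  have heq := Finset.eq_of_subset_of_card_le h1 (by omega)
  have : e ∈ (Finset.univ.filter fun v : T.Vert => v ∉ range T.mark).image φ := by
    rw [heq]; simpa using he
  obtain ⟨v, hv, hve⟩ := Finset.mem_image.1 this
  exact ⟨v, by simpa using hv, hve⟩

/-- Every edge without marked endpoints leads away from the line. -/
lemma exists_away_edge {e : T.Edge} (he : ∀ v, T.Incident v e → v ∉ range T.mark) :
    ∃ v, C.Away ε c v e := by
  obtain ⟨φ, hφ⟩ := H.exists_choice
  obtain ⟨v, hv, rfl⟩ := H.exists_away_of_choice φ hφ he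
  exact ⟨v, hφ v hv⟩

/-- Every unmarked vertex has only one edge leading away from the line. -/
lemma away_unique_edge {v : T.Vert} {e e' : T.Edge} (h : C.Away ε c v e)
    (h' : C.Away ε c v e') : e = e' := by
  classical
  obtain ⟨φ, hφ⟩ := H.exists_choice
  -- Change the choice at `v` to `e`. The new choice is onto as well, so it takes the value `e'`;
  -- this can only happen at `v`.
  have hφ' : ∀ w, w ∉ range T.mark → C.Away ε c w (Function.update φ v e w) := by
    intro w hw
    by_cases hwv : w = v
    · subst hwv; simpa using h
    · simpa [hwv] using hφ w hw
  obtain ⟨w, hw, hwe⟩ := H.exists_away_of_choice _ hφ' (fun u hu => H.away_not_mark h' hu)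
  have h2 := hφ' w hw
  rw [hwe] at h2
  have := away_unique_vertex h' h2
  subst this
  simpa using hwe

/-- No unmarked vertex is mapped to the line. -/
lemma height_ne {v : T.Vert} (hv : v ∉ range T.mark) : height ε (C.pos v) ≠ c := by
  intro h0
  -- In `Away` a vertex on the line counts as lying above it. Its downward edge therefore leads away
  -- from neither endpoint and has no marked endpoint, against `exists_away_edge`.
  obtain ⟨e, he, hneg⟩ := H.exists_down hv
  have hopp : ∀ w, T.Incident w e → w ≠ v → height ε (C.pos w) < c ∧
      0 < height ε (toPlane (C.outDir w e)) := by
    intro w hw hwv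
    obtain ⟨h1, L, hL, h2⟩ := C.opposite he hw (Ne.symm hwv)
    rw [h1, height_neg, h2, height_add_smul]
    have := mul_neg_of_pos_of_neg hL hneg
    constructor <;> linarith
  obtain ⟨w, hw⟩ := H.exists_away_edge (e := e) (by
    rintro w hw ⟨i, rfl⟩
    by_cases hwv : T.mark i = v
    · exact hv ⟨i, hwv⟩
    · have := (hopp _ hw hwv).1
      rw [H.height_mark] at this
      exact lt_irrefl _ this)
  by_cases hwv : w = v
  · subst hwv
    have := hw.2.2.1 h0.ge
    linarith
  · have h1 := hopp w hw.2.1 hwv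
    have := hw.2.2.2 h1.1
    linarith

/-- Edges without marked endpoints do not meet the line. -/
lemma not_mem_of_unmarked {e : T.Edge} (he : ∀ v, T.Incident v e → v ∉ range T.mark)
    {y : ℝ × ℝ} (hy : y ∈ C.closedEdge e) : height ε y ≠ c := by
  obtain ⟨v, hv⟩ := H.exists_away_edge he
  have hne := H.height_ne hv.1
  rw [C.closedEdge_eq hv.2.1] at hy
  obtain ⟨s, hs, rfl⟩ := hy
  have hs0 := C.closedParam_nonneg hs
  simp only [height_add_smul]
  rcases lt_or_gt_of_ne hne with h | h
  · have := mul_nonpos_of_nonneg_of_nonpos hs0 (hv.2.2.2 h).le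
    linarith
  · have := mul_nonneg hs0 (hv.2.2.1 h.le).le
    linarith

/-- The curve meets the line in the marked points only: an edge without marked endpoint stays
strictly on one side, and an edge at a marked point is transversal to the line. -/
lemma mem_line {e : T.Edge} {y : ℝ × ℝ} (hy : y ∈ C.closedEdge e) (h : height ε y = c) :
    ∃ i, T.Incident (T.mark i) e ∧ y = C.pos (T.mark i) := by
  by_cases he : ∀ v, T.Incident v e → v ∉ range T.mark
  · exact absurd h (H.not_mem_of_unmarked he hy)
  push Not at he
  obtain ⟨v, hv, i, rfl⟩ := he
  refine ⟨i, hv, ?_⟩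
  rw [C.closedEdge_eq hv] at hy
  obtain ⟨s, hs, rfl⟩ := hy
  simp only [height_add_smul, H.height_mark] at h
  have : s * height ε (toPlane (C.outDir (T.mark i) e)) = 0 := by linarith
  rcases mul_eq_zero.1 this with h1 | h1
  · simp [h1]
  · exact absurd h1 (H.height_outDir_ne_zero hv)

end OnLine

/-! ### Intersection numbers with rays -/

/-- The determinant of two lattice vectors. -/
def latticeCross (a : ℤ × ℤ) : (ℤ × ℤ) →+ ℤ where
  toFun b := a.1 * b.2 - a.2 * b.1
  map_zero' := by simp
  map_add' b b' := by simp; ring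

lemma latticeCross_apply (a b : ℤ × ℤ) : latticeCross a b = a.1 * b.2 - a.2 * b.1 := rfl

lemma cast_latticeCross (a b : ℤ × ℤ) :
    (latticeCross a b : ℝ) = cross (toPlane a) (toPlane b) := by
  simp [latticeCross_apply, cross, toPlane]

lemma exists_smul_of_cross_eq_zero {u o : ℝ × ℝ} (hu : u ≠ 0) (h : cross u o = 0) :
    ∃ k : ℝ, o = k • u := ⟨_, eq_smul_of_cross_eq_zero hu h⟩

lemma cross_sub_right (x y z : ℝ × ℝ) : cross x (y - z) = cross x y - cross x z := by
  simp [cross]; ring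

lemma cross_add_left (x y z : ℝ × ℝ) : cross (x + y) z = cross x z + cross y z := by
  simp [cross]; ring

section Strip
variable {ρ x x' y : ℝ × ℝ}

/-- Coordinates for the half strip bounded by the segment from `x` to `x'` and the two rays in
direction `ρ`: `cross ρ (y - x)` runs from `0` on one ray to `cross ρ (x' - x)` on the other, and
`cross (x' - x) (y - x)` is negative on the side of the rays. -/
lemma mem_ray_iff (hh : 0 < cross ρ (x' - x)) :
    (∃ τ : ℝ, 0 < τ ∧ y = x + τ • ρ) ↔ cross ρ (y - x) = 0 ∧ cross (x' - x) (y - x) < 0 := by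
  have hρ : ρ ≠ 0 := by rintro rfl; simp [cross] at hh
  constructor
  · rintro ⟨τ, hτ, rfl⟩
    rw [add_sub_cancel_left, cross_smul_right, cross_smul_right, cross_self,
      cross_swap (x' - x) ρ]
    exact ⟨by ring, by nlinarith⟩
  · rintro ⟨h1, h2⟩
    obtain ⟨k, hk⟩ := exists_smul_of_cross_eq_zero hρ h1
    rw [hk, cross_smul_right, cross_swap] at h2
    exact ⟨k, by nlinarith, by rw [← hk]; abel⟩

lemma mem_ray_iff' (hh : 0 < cross ρ (x' - x)) :
    (∃ τ : ℝ, 0 < τ ∧ y = x' + τ • ρ) ↔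
      cross ρ (y - x) = cross ρ (x' - x) ∧ cross (x' - x) (y - x) < 0 := by
  have hρ : ρ ≠ 0 := by rintro rfl; simp [cross] at hh
  have e1 : cross ρ (y - x) = cross ρ (y - x') + cross ρ (x' - x) := by
    rw [← cross_add_right]; congr 1; abel
  have e2 : cross (x' - x) (y - x) = cross (x' - x) (y - x') := by
    have : y - x = (y - x') + (x' - x) := by abel
    rw [this, cross_add_right, cross_self, add_zero]
  rw [e1, e2]
  constructor
  · rintro ⟨τ, hτ, rfl⟩
    rw [add_sub_cancel_left, cross_smul_right, cross_smul_right, cross_self,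
      cross_swap (x' - x) ρ]
    exact ⟨by ring, by nlinarith⟩
  · rintro ⟨h1, h2⟩
    obtain ⟨k, hk⟩ := exists_smul_of_cross_eq_zero hρ (show cross ρ (y - x') = 0 by linarith)
    rw [hk, cross_smul_right, cross_swap] at h2
    exact ⟨k, by nlinarith, by rw [← hk]; abel⟩

lemma mem_segment_iff_strip (hh : 0 < cross ρ (x' - x)) :
    (y ∈ segment ℝ x x' ∧ y ≠ x ∧ y ≠ x') ↔ cross (x' - x) (y - x) = 0 ∧
      0 < cross ρ (y - x) ∧ cross ρ (y - x) < cross ρ (x' - x) := by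
  have hx : x' - x ≠ 0 := by intro h; simp [h, cross] at hh
  rw [segment_eq_image']
  constructor
  · rintro ⟨⟨s, hs, rfl⟩, h1, h2⟩
    have hs0 : s ≠ 0 := by rintro rfl; simp at h1
    have hs1 : s ≠ 1 := by rintro rfl; simp at h2
    simp only [add_sub_cancel_left, cross_smul_right, cross_self, mul_zero, true_and]
    have a1 := lt_of_le_of_ne hs.1 hs0.symm
    have a2 := lt_of_le_of_ne hs.2 hs1
    constructor <;> nlinarith
  · rintro ⟨h1, h2, h3⟩
    obtain ⟨k, hk⟩ := exists_smul_of_cross_eq_zero hx h1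
    rw [hk, cross_smul_right] at h2 h3
    have k0 : 0 < k := by
      by_contra h; nlinarith
    have k1 : k < 1 := by
      by_contra h; nlinarith
    have hy : y = x + k • (x' - x) := by rw [← hk]; abel
    refine ⟨⟨k, ⟨k0.le, k1.le⟩, hy.symm⟩, ?_, ?_⟩
    · rintro rfl
      rw [sub_self] at hk
      exact smul_ne_zero k0.ne' hx hk.symm
    · rintro rfl
      have : (1 - k) • (y - x) = 0 := by rw [sub_smul, one_smul, ← hk, sub_self]
      exact smul_ne_zero (by linarith) hx this

lemma eq_of_strip (hh : 0 < cross ρ (x' - x)) (h1 : cross ρ (y - x) = 0)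
    (h2 : cross (x' - x) (y - x) = 0) : y = x := by
  have hx : x' - x ≠ 0 := by intro h; simp [h, cross] at hh
  obtain ⟨k, hk⟩ := exists_smul_of_cross_eq_zero hx h2
  rw [hk, cross_smul_right] at h1
  have : k = 0 := by
    rcases mul_eq_zero.1 h1 with h | h
    · exact h
    · exact absurd h hh.ne'
  rw [this, zero_smul] at hk
  exact sub_eq_zero.1 hk

lemma eq_of_strip' (hh : 0 < cross ρ (x' - x)) (h1 : cross ρ (y - x) = cross ρ (x' - x))
    (h2 : cross (x' - x) (y - x) = 0) : y = x' := by
  have hx : x' - x ≠ 0 := by intro h; simp [h, cross] at hh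
  obtain ⟨k, hk⟩ := exists_smul_of_cross_eq_zero hx h2
  rw [hk, cross_smul_right] at h1
  have : k = 1 := by
    have : (k - 1) * cross ρ (x' - x) = 0 := by linarith
    rcases mul_eq_zero.1 this with h | h
    · linarith
    · exact absurd h hh.ne'
  rw [this, one_smul] at hk
  exact sub_left_injective hk

end Strip

namespace Curve

variable {d n : ℕ} {T : CombType d n} (C : Curve T)

/-- The edge meets the ray from `x` in direction `ρ`. -/
def MeetsRay (ρ : ℤ × ℤ) (x : ℝ × ℝ) (e : T.Edge) : Prop :=
  ∃ y ∈ C.openEdge e, ∃ τ : ℝ, 0 < τ ∧ y = x + τ • toPlane ρ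

/-- The interior of the edge meets the segment from `x` to `x'`. -/
def MeetsSegment (x x' : ℝ × ℝ) (e : T.Edge) : Prop := ∃ y ∈ C.openEdge e, y ∈ segment ℝ x x'

open scoped Classical in
/-- The intersection number of the curve with the ray from `x` in direction `ρ`. -/
def rayCount (ρ : ℤ × ℤ) (x : ℝ × ℝ) : ℤ :=
  ∑ e with C.MeetsRay ρ x e, |latticeCross ρ (C.edgeDir e)|

/-- The line through `x` of direction `ρ` avoids the vertices. -/
def AvoidsVertices (ρ : ℤ × ℤ) (x : ℝ × ℝ) : Prop := ∀ v, cross (toPlane ρ) (C.pos v - x) ≠ 0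

-- Here `l` is the indicator function of the open half strip on the vertices. The contribution of
-- one edge to the summation by parts is its crossing of the ray from `x`, minus that of the ray
-- from `x'`, minus that of the segment.
open scoped Classical in
lemma crossing_edge {ρ : ℤ × ℤ} {x x' : ℝ × ℝ} (hh : 0 < cross (toPlane ρ) (x' - x))
    (hx : x ∉ C.image) (hx' : x' ∉ C.image) (gx : C.AvoidsVertices ρ x)
    (gx' : C.AvoidsVertices ρ x') (hv : ∀ v, C.pos v ∉ segment ℝ x x') (l : T.Vert → ℝ)
    (hl : ∀ v, l v = if 0 < cross (toPlane ρ) (C.pos v - x) ∧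
      cross (toPlane ρ) (C.pos v - x) < cross (toPlane ρ) (x' - x) ∧
      cross (x' - x) (C.pos v - x) < 0 then 1 else 0) (e : T.Edge) :
    Sum.elim
      (fun p : {e : T.Vert × T.Vert // e.1 < e.2 ∧ T.graph.Adj e.1 e.2} =>
        (latticeCross ρ (C.dir p.1.1 p.1.2) : ℝ) * (l p.1.2 - l p.1.1))
      (fun a : Fin 3 × Fin d => (latticeCross ρ (endDir a.1) : ℝ) * -l (T.endAt a)) e =
    |(latticeCross ρ (C.edgeDir e) : ℝ)| * (if C.MeetsRay ρ x e then 1 else 0) -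
    |(latticeCross ρ (C.edgeDir e) : ℝ)| * (if C.MeetsRay ρ x' e then 1 else 0) -
    (SignType.sign (cross (x' - x) (toPlane (C.edgeDir e))) : ℝ) *
      (latticeCross ρ (C.edgeDir e) : ℝ) * (if C.MeetsSegment x x' e then 1 else 0) := by
  have av : ∀ v, cross (toPlane ρ) (C.pos v - x) ≠ cross (toPlane ρ) (x' - x) := by
    intro v h
    apply gx' v
    rw [show C.pos v - x' = (C.pos v - x) - (x' - x) by abel, cross_sub_right, h, sub_self]
  have cv : ∀ v, 0 < cross (toPlane ρ) (C.pos v - x) →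
      cross (toPlane ρ) (C.pos v - x) < cross (toPlane ρ) (x' - x) →
      cross (x' - x) (C.pos v - x) ≠ 0 := by
    intro v h1 h2 h3
    exact hv v ((mem_segment_iff_strip hh).2 ⟨h3, h1, h2⟩).1
  have lin : ∀ (w A m : ℝ × ℝ) (s : ℝ), cross w (A + s • m - x) =
      cross w (A - x) + s * cross w m := by
    intro w A m s
    rw [show A + s • m - x = (A - x) + s • m by abel, cross_add_right, cross_smul_right]
  have ne_open : ∀ e, ∀ y ∈ C.openEdge e, y ≠ x ∧ y ≠ x' := by
    intro e y hy
    have := C.openEdge_subset_image e hy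
    exact ⟨fun h => hx (h ▸ this), fun h => hx' (h ▸ this)⟩
  have r1 : ∀ e, C.MeetsRay ρ x e ↔ ∃ s, s ∈ C.openParam e ∧
      cross (toPlane ρ) (C.base e - x) + s * cross (toPlane ρ) (toPlane (C.edgeDir e)) = 0 ∧
      cross (x' - x) (C.base e - x) + s * cross (x' - x) (toPlane (C.edgeDir e)) < 0 := by
    intro e
    simp only [MeetsRay, mem_ray_iff hh, openEdge, mem_image, exists_exists_and_eq_and, lin]
  have r2 : ∀ e, C.MeetsRay ρ x' e ↔ ∃ s, s ∈ C.openParam e ∧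
      cross (toPlane ρ) (C.base e - x) + s * cross (toPlane ρ) (toPlane (C.edgeDir e)) =
        cross (toPlane ρ) (x' - x) ∧
      cross (x' - x) (C.base e - x) + s * cross (x' - x) (toPlane (C.edgeDir e)) < 0 := by
    intro e
    simp only [MeetsRay, mem_ray_iff' hh, openEdge, mem_image, exists_exists_and_eq_and, lin]
  have r3 : ∀ e, C.MeetsSegment x x' e ↔ ∃ s, s ∈ C.openParam e ∧
      cross (x' - x) (C.base e - x) + s * cross (x' - x) (toPlane (C.edgeDir e)) = 0 ∧
      0 < cross (toPlane ρ) (C.base e - x) + s * cross (toPlane ρ) (toPlane (C.edgeDir e)) ∧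
      cross (toPlane ρ) (C.base e - x) + s * cross (toPlane ρ) (toPlane (C.edgeDir e)) <
        cross (toPlane ρ) (x' - x) := by
    intro e
    have : C.MeetsSegment x x' e ↔ ∃ y ∈ C.openEdge e, y ∈ segment ℝ x x' ∧ y ≠ x ∧ y ≠ x' := by
      refine exists_congr fun y => and_congr_right fun hy => ?_
      have := ne_open e y hy
      tauto
    rw [this]
    simp only [mem_segment_iff_strip hh, openEdge, mem_image, exists_exists_and_eq_and, lin]
  have z0 : ∀ e, ∀ s ∈ C.openParam e,
      cross (toPlane ρ) (C.base e - x) + s * cross (toPlane ρ) (toPlane (C.edgeDir e)) = 0 →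
      cross (x' - x) (C.base e - x) + s * cross (x' - x) (toPlane (C.edgeDir e)) ≠ 0 := by
    intro e s hs h1 h2
    rw [← lin] at h1 h2
    exact (ne_open e _ ⟨s, hs, rfl⟩).1 (eq_of_strip hh h1 h2)
  have zh : ∀ e, ∀ s ∈ C.openParam e,
      cross (toPlane ρ) (C.base e - x) + s * cross (toPlane ρ) (toPlane (C.edgeDir e)) =
        cross (toPlane ρ) (x' - x) →
      cross (x' - x) (C.base e - x) + s * cross (x' - x) (toPlane (C.edgeDir e)) ≠ 0 := by
    intro e s hs h1 h2
    rw [← lin] at h1 h2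
    exact (ne_open e _ ⟨s, hs, rfl⟩).2 (eq_of_strip' hh h1 h2)
  rw [if_congr (r1 e) rfl rfl, if_congr (r2 e) rfl rfl, if_congr (r3 e) rfl rfl,
    cast_latticeCross]
  rcases e with ⟨⟨a, b⟩, h1, h2⟩ | a
  · have hL := C.len_pos a b h2
    have hb : C.pos b = C.pos a + C.len s(a, b) • toPlane (C.dir a b) := C.pos_eq a b h2
    have hlb := hl b
    rw [hb, lin, lin] at hlb
    simp only [Sum.elim_inl]
    rw [hlb, hl a]
    have n1 := gx b
    have n2 := av b
    have n3 := cv b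
    rw [hb, lin] at n1 n2 n3
    rw [lin] at n3
    have := crossing_identity hL hh (gx a) (av a) n1 n2
      (fun s s1 s2 => z0 (Sum.inl ⟨(a, b), h1, h2⟩) s ⟨s1, s2⟩)
      (fun s s1 s2 => zh (Sum.inl ⟨(a, b), h1, h2⟩) s ⟨s1, s2⟩) (cv a) n3
    rw [cast_latticeCross]
    exact this
  · simp only [Sum.elim_inr]
    rw [hl, cast_latticeCross]
    have := crossing_identity_ray (q := cross (toPlane ρ) (toPlane (endDir a.1)))
      (g := cross (x' - x) (toPlane (endDir a.1))) hh (gx (T.endAt a)) (av (T.endAt a))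
      (fun s s1 => z0 (Sum.inr a) s s1)
      (fun s s1 => zh (Sum.inr a) s s1) (cv (T.endAt a))
    rw [zero_sub] at this
    exact this

open scoped Classical in
/-- The signed count of the edges crossing the segment from `x` to `x'`. -/
def segmentCount (x x' : ℝ × ℝ) : ℤ × ℤ :=
  ∑ e with C.MeetsSegment x x' e,
    (SignType.sign (cross (x' - x) (toPlane (C.edgeDir e))) : ℤ) • C.edgeDir e

lemma segmentCount_swap (x x' : ℝ × ℝ) : C.segmentCount x' x = -C.segmentCount x x' := by
  classical
  rw [segmentCount, segmentCount, ← Finset.sum_neg_distrib]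
  refine Finset.sum_congr ?_ fun e _ => ?_
  · ext e; simp [MeetsSegment, segment_symm ℝ x x']
  · rw [← neg_smul]
    congr 1
    rw [show x - x' = (-1 : ℝ) • (x' - x) by module, cross_smul_left, neg_one_mul,
      Left.sign_neg]
    simp

lemma segmentCount_eq_zero {x x' : ℝ × ℝ} (h : ∀ e, ¬ C.MeetsSegment x x' e) :
    C.segmentCount x x' = 0 := by
  classical
  rw [segmentCount, Finset.sum_eq_zero]
  intro e he
  exact absurd (Finset.mem_filter.1 he).2 (h e)

/-- A discrete Stokes theorem: by balancing the flux of the curve through the boundary of the half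
strip vanishes. -/
lemma rayCount_sub_of_pos {ρ : ℤ × ℤ} {x x' : ℝ × ℝ} (hh : 0 < cross (toPlane ρ) (x' - x))
    (hx : x ∉ C.image) (hx' : x' ∉ C.image) (gx : C.AvoidsVertices ρ x)
    (gx' : C.AvoidsVertices ρ x') (hv : ∀ v, C.pos v ∉ segment ℝ x x') :
    C.rayCount ρ x' - C.rayCount ρ x = -latticeCross ρ (C.segmentCount x x') := by
  classical
  have h := C.sum_by_parts ((Int.castAddHom ℝ).comp (latticeCross ρ))
    (fun v => if 0 < cross (toPlane ρ) (C.pos v - x) ∧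
      cross (toPlane ρ) (C.pos v - x) < cross (toPlane ρ) (x' - x) ∧
      cross (x' - x) (C.pos v - x) < 0 then 1 else 0)
  simp only [AddMonoidHom.comp_apply, Int.coe_castAddHom] at h
  rw [Finset.sum_congr rfl fun e _ => C.crossing_edge hh hx hx' gx gx' hv _ (fun v => rfl) e] at h
  rw [Finset.sum_sub_distrib, Finset.sum_sub_distrib] at h
  have key : ((C.rayCount ρ x' - C.rayCount ρ x : ℤ) : ℝ) =
      ((-latticeCross ρ (C.segmentCount x x') : ℤ) : ℝ) := by
    simp only [mul_ite, mul_one, mul_zero, ← Finset.sum_filter] at h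
    rw [rayCount, rayCount, segmentCount, map_sum]
    push_cast
    have e3 : ∀ e : T.Edge, ((latticeCross ρ
        ((SignType.sign (cross (x' - x) (toPlane (C.edgeDir e))) : ℤ) • C.edgeDir e) : ℤ) : ℝ) =
        (SignType.sign (cross (x' - x) (toPlane (C.edgeDir e))) : ℝ) *
        (latticeCross ρ (C.edgeDir e) : ℝ) := by
      intro e
      rw [map_zsmul, smul_eq_mul, Int.cast_mul]
      congr 1
      cases SignType.sign (cross (x' - x) (toPlane (C.edgeDir e))) <;> simp
    simp only [e3]
    linarith
  exact_mod_cast key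

/-- The degenerate half strip. The ray from `x` consists of the segment and the shorter ray, and an
edge transversal to it meets just one of these two if it meets the ray at all. -/
lemma rayCount_sub_of_parallel {ρ : ℤ × ℤ} {x : ℝ × ℝ} {τ : ℝ} (hτ : 0 < τ)
    (hx : x ∉ C.image) (hx' : x + τ • toPlane ρ ∉ C.image) :
    C.rayCount ρ (x + τ • toPlane ρ) - C.rayCount ρ x =
      -latticeCross ρ (C.segmentCount x (x + τ • toPlane ρ)) := by
  classical
  rw [rayCount, rayCount, segmentCount, map_sum, Finset.sum_filter, Finset.sum_filter,
    Finset.sum_filter, ← Finset.sum_sub_distrib, ← Finset.sum_neg_distrib]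
  refine Finset.sum_congr rfl fun e _ => ?_
  have hs : (SignType.sign (cross (x + τ • toPlane ρ - x) (toPlane (C.edgeDir e))) : ℤ) *
      latticeCross ρ (C.edgeDir e) = |latticeCross ρ (C.edgeDir e)| := by
    rw [add_sub_cancel_left, cross_smul_left, ← cast_latticeCross, sign_mul, sign_pos hτ, one_mul]
    rcases lt_trichotomy (latticeCross ρ (C.edgeDir e)) 0 with h | h | h
    · rw [sign_neg (by exact_mod_cast h), abs_of_neg h]; simp
    · simp [h]
    · rw [sign_pos (by exact_mod_cast h), abs_of_pos h]; simp
  rw [map_zsmul, smul_eq_mul, hs]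
  by_cases hq : latticeCross ρ (C.edgeDir e) = 0
  · simp [hq]
  have hq' : cross (toPlane ρ) (toPlane (C.edgeDir e)) ≠ 0 := by
    rw [← cast_latticeCross]; exact_mod_cast hq
  have huniq : ∀ y ∈ C.openEdge e, ∀ y' ∈ C.openEdge e, ∀ t t' : ℝ, y = x + t • toPlane ρ →
      y' = x + t' • toPlane ρ → y = y' := by
    rintro _ ⟨s, hs, rfl⟩ _ ⟨s', hs', rfl⟩ t t' ht ht'
    have h1 := congrArg (cross (toPlane ρ)) ht
    have h2 := congrArg (cross (toPlane ρ)) ht'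
    simp only [cross_add_right, cross_smul_right, cross_self, mul_zero, add_zero] at h1 h2
    have : (s - s') * cross (toPlane ρ) (toPlane (C.edgeDir e)) = 0 := by linarith
    rcases mul_eq_zero.1 this with h | h
    · rw [sub_eq_zero.1 h]
    · exact absurd h hq'
  have hρ : toPlane ρ ≠ 0 := by
    intro h; rw [h] at hq'; simp [cross] at hq'
  have hseg : ∀ y ∈ C.openEdge e, y ∈ segment ℝ x (x + τ • toPlane ρ) →
      ∃ t, 0 ≤ t ∧ t < τ ∧ y = x + t • toPlane ρ := by
    intro y hy h
    rw [segment_eq_image'] at h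
    obtain ⟨s, hs, rfl⟩ := h
    refine ⟨s * τ, mul_nonneg hs.1 hτ.le, ?_, by simp only [add_sub_cancel_left, smul_smul]⟩
    have : s ≠ 1 := by
      rintro rfl
      apply hx'
      simpa using C.openEdge_subset_image e hy
    have := lt_of_le_of_ne hs.2 this
    nlinarith
  by_cases h1 : C.MeetsRay ρ (x + τ • toPlane ρ) e
  · have h2 : C.MeetsRay ρ x e := by
      obtain ⟨y, hy, t, ht, rfl⟩ := h1
      exact ⟨_, hy, τ + t, by linarith, by module⟩
    have h3 : ¬ C.MeetsSegment x (x + τ • toPlane ρ) e := by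
      rintro ⟨y', hy', hs'⟩
      obtain ⟨t', h0, h4, rfl⟩ := hseg y' hy' hs'
      obtain ⟨y, hy, t, ht, rfl⟩ := h1
      have := huniq _ hy _ hy' (τ + t) t' (by module) rfl
      have h5 : (τ + t - t') • toPlane ρ = 0 := by
        have : x + (τ + t - t') • toPlane ρ = x := by
          rw [← sub_eq_zero] at this ⊢
          rw [← this]; module
        simpa using this
      exact smul_ne_zero (by linarith) hρ h5
    simp [h1, h2, h3]
  · by_cases h3 : C.MeetsSegment x (x + τ • toPlane ρ) e
    · have h2 : C.MeetsRay ρ x e := by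
        obtain ⟨y', hy', hs'⟩ := h3
        obtain ⟨t', h0, h4, rfl⟩ := hseg y' hy' hs'
        rcases eq_or_lt_of_le h0 with h0 | h0
        · subst h0
          rw [zero_smul, add_zero] at hy'
          exact absurd (C.openEdge_subset_image e hy') hx
        · exact ⟨_, hy', t', h0, rfl⟩
      simp [h1, h2, h3]
    · have h2 : ¬ C.MeetsRay ρ x e := by
        rintro ⟨y, hy, t, ht, rfl⟩
        rcases lt_trichotomy t τ with h | h | h
        · apply h3
          refine ⟨_, hy, ?_⟩
          rw [segment_eq_image']
          refine ⟨t / τ, ⟨by positivity, (div_le_one hτ).2 h.le⟩, ?_⟩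
          simp only [add_sub_cancel_left, smul_smul, div_mul_cancel₀ _ hτ.ne']
        · subst h
          exact hx' (C.openEdge_subset_image e hy)
        · exact h1 ⟨_, hy, t - τ, by linarith, by module⟩
      simp [h1, h2, h3]

lemma rayCount_sub {ρ : ℤ × ℤ} (hρ : ρ ≠ 0) {x x' : ℝ × ℝ}
    (hx : x ∉ C.image) (hx' : x' ∉ C.image) (gx : C.AvoidsVertices ρ x)
    (gx' : C.AvoidsVertices ρ x') (hv : ∀ v, C.pos v ∉ segment ℝ x x') :
    C.rayCount ρ x' - C.rayCount ρ x = -latticeCross ρ (C.segmentCount x x') := by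
  have swap : ∀ {a b : ℝ × ℝ}, C.rayCount ρ a - C.rayCount ρ b =
      -latticeCross ρ (C.segmentCount b a) → C.rayCount ρ b - C.rayCount ρ a =
      -latticeCross ρ (C.segmentCount a b) := by
    intro a b h
    rw [C.segmentCount_swap b a, map_neg]
    linarith
  rcases lt_trichotomy (cross (toPlane ρ) (x' - x)) 0 with h | h | h
  · refine swap (C.rayCount_sub_of_pos ?_ hx' hx gx' gx ?_)
    · rw [← neg_sub, show -(x' - x) = (-1 : ℝ) • (x' - x) by module, cross_smul_right]
      linarith
    · intro v; rw [segment_symm]; exact hv v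
  · obtain ⟨k, hk⟩ := exists_smul_of_cross_eq_zero (toPlane_ne_zero.2 hρ) h
    have hxk : x' = x + k • toPlane ρ := by rw [← hk]; abel
    rcases lt_trichotomy k 0 with h0 | h0 | h0
    · have hxk' : x = x' + (-k) • toPlane ρ := by rw [hxk]; module
      refine swap ?_
      have := C.rayCount_sub_of_parallel (ρ := ρ) (x := x') (τ := -k) (by linarith) hx'
        (by rw [← hxk']; exact hx)
      rwa [← hxk'] at this
    · rw [h0, zero_smul, add_zero] at hxk
      subst hxk
      have : C.segmentCount x' x' = 0 := C.segmentCount_eq_zero (by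
        rintro e ⟨y, hy, hs⟩
        rw [segment_same] at hs
        exact hx (hs ▸ C.openEdge_subset_image e hy))
      simp [this]
    · have := C.rayCount_sub_of_parallel (ρ := ρ) (x := x) h0 hx (by rw [← hxk]; exact hx')
      rwa [← hxk] at this
  · exact C.rayCount_sub_of_pos h hx hx' gx gx' hv

end Curve

namespace Curve

variable {d n : ℕ} {T : CombType d n} (C : Curve T)

/-! ### Exponents -/

lemma exponent_eq (x : ℝ × ℝ) :
    C.exponent x = (C.rayCount (-1, 0) x, C.rayCount (0, -1) x) := by
  classical
  ext
  · simp only [exponent, rayCount, latticeCross_apply]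
    refine Finset.sum_congr ?_ fun e _ => by simp
    ext e
    rw [Finset.mem_filter, Finset.mem_filter]
    refine and_congr_right fun _ => ?_
    refine exists_congr fun y => and_congr_right fun _ => ?_
    constructor
    · rintro ⟨h1, h2⟩
      exact ⟨x.1 - y.1, by linarith, by ext <;> simp [toPlane, h1]⟩
    · rintro ⟨τ, hτ, rfl⟩
      simpa [toPlane] using hτ
  · simp only [exponent, rayCount, latticeCross_apply]
    refine Finset.sum_congr ?_ fun e _ => by simp
    ext e
    rw [Finset.mem_filter, Finset.mem_filter]
    refine and_congr_right fun _ => ?_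
    refine exists_congr fun y => and_congr_right fun _ => ?_
    constructor
    · rintro ⟨h1, h2⟩
      exact ⟨x.2 - y.2, by linarith, by ext <;> simp [toPlane, h1]⟩
    · rintro ⟨τ, hτ, rfl⟩
      simpa [toPlane] using hτ

variable {C}

lemma IsGenericPoint.avoids_fst {x : ℝ × ℝ} (h : C.IsGenericPoint x) :
    C.AvoidsVertices (-1, 0) x := by
  intro v hv
  have := (h.2 v).2
  simp only [cross, toPlane, Prod.snd_sub, Int.cast_zero, zero_mul, Int.cast_neg, Int.cast_one]
    at hv
  apply this; linarith

lemma IsGenericPoint.avoids_snd {x : ℝ × ℝ} (h : C.IsGenericPoint x) :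
    C.AvoidsVertices (0, -1) x := by
  intro v hv
  have := (h.2 v).1
  simp only [cross, toPlane, Prod.fst_sub, Int.cast_zero, zero_mul, Int.cast_neg, Int.cast_one]
    at hv
  apply this; linarith

/-- `latticeCross` with `(-1, 0)` and with `(0, -1)` yields, up to the common sign, the two
coordinates of the clockwise rotation. -/
lemma exponent_sub {x x' : ℝ × ℝ} (hx : C.IsGenericPoint x) (hx' : C.IsGenericPoint x')
    (hv : ∀ v, C.pos v ∉ segment ℝ x x') :
    C.exponent x' - C.exponent x = rot (C.segmentCount x x') := by
  have h1 := C.rayCount_sub (ρ := (-1, 0)) (by simp) hx.1 hx'.1 hx.avoids_fst hx'.avoids_fst hv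
  have h2 := C.rayCount_sub (ρ := (0, -1)) (by simp) hx.1 hx'.1 hx.avoids_snd hx'.avoids_snd hv
  rw [exponent_eq, exponent_eq]
  ext
  · simpa [latticeCross_apply, rot] using h1
  · simpa [latticeCross_apply, rot] using h2

lemma exponent_eq_of_disjoint {x x' : ℝ × ℝ} (hx : C.IsGenericPoint x)
    (hx' : C.IsGenericPoint x') (h : ∀ y ∈ segment ℝ x x', y ∉ C.image)
    (hvert : ∀ v, C.pos v ∈ C.image) : C.exponent x' = C.exponent x := by
  have h1 := exponent_sub hx hx' (fun v hv => h _ hv (hvert v))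
  rw [C.segmentCount_eq_zero, map_zero] at h1
  · exact sub_eq_zero.1 h1
  · rintro e ⟨y, hy, hys⟩
    exact h y hys (C.openEdge_subset_image e hy)

lemma linear_lt_of_mem_closedEdge {x : ℝ} (f : (ℝ × ℝ) →ₗ[ℝ] ℝ) (hf : ∀ v, x < f (C.pos v))
    {p : {e : T.Vert × T.Vert // e.1 < e.2 ∧ T.graph.Adj e.1 e.2}} {y : ℝ × ℝ}
    (hy : y ∈ C.closedEdge (Sum.inl p)) : x < f y := by
  obtain ⟨⟨a, b⟩, h1, h2⟩ := p
  obtain ⟨s, hs, rfl⟩ := hy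
  have hL := C.len_pos a b h2
  have hb := hf b
  have ha := hf a
  rw [C.pos_eq a b h2] at hb
  simp only [map_add, map_smul, smul_eq_mul, base, edgeDir] at hb ⊢
  have h3 : 0 ≤ s := hs.1
  have h4 : s ≤ C.len s(a, b) := hs.2
  rcases le_or_gt 0 (f (toPlane (C.dir a b))) with h | h
  · nlinarith [mul_nonneg h3 h]
  · nlinarith

/-- The point lies to the left of and above all vertices. -/
def FarLeft (C : Curve T) (x : ℝ × ℝ) : Prop := ∀ v, x.1 < (C.pos v).1 ∧ (C.pos v).2 < x.2

/-- The point lies to the right of and below all vertices. -/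
def FarRight (C : Curve T) (x : ℝ × ℝ) : Prop := ∀ v, (C.pos v).1 < x.1 ∧ x.2 < (C.pos v).2

lemma FarLeft.bounded {x : ℝ × ℝ} (h : C.FarLeft x)
    {p : {e : T.Vert × T.Vert // e.1 < e.2 ∧ T.graph.Adj e.1 e.2}} {y : ℝ × ℝ}
    (hy : y ∈ C.closedEdge (Sum.inl p)) : x.1 < y.1 ∧ y.2 < x.2 := by
  constructor
  · exact linear_lt_of_mem_closedEdge (LinearMap.fst ℝ ℝ ℝ) (fun v => (h v).1) hy
  · have := linear_lt_of_mem_closedEdge (x := -x.2) (-LinearMap.snd ℝ ℝ ℝ)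
      (fun v => by simpa using (h v).2) hy
    simpa using this

lemma FarRight.bounded {x : ℝ × ℝ} (h : C.FarRight x)
    {p : {e : T.Vert × T.Vert // e.1 < e.2 ∧ T.graph.Adj e.1 e.2}} {y : ℝ × ℝ}
    (hy : y ∈ C.closedEdge (Sum.inl p)) : y.1 < x.1 ∧ x.2 < y.2 := by
  constructor
  · have := linear_lt_of_mem_closedEdge (x := -x.1) (-LinearMap.fst ℝ ℝ ℝ)
      (fun v => by simpa using (h v).1) hy
    simpa using this
  · exact linear_lt_of_mem_closedEdge (LinearMap.snd ℝ ℝ ℝ) (fun v => (h v).2) hy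

lemma mem_closedEdge_end {j : Fin 3} {a : Fin d} {y : ℝ × ℝ} :
    y ∈ C.closedEdge (Sum.inr (j, a)) ↔
      ∃ s : ℝ, 0 ≤ s ∧ C.pos (T.endAt (j, a)) + s • toPlane (endDir j) = y := Iff.rfl

lemma mem_openEdge_end {j : Fin 3} {a : Fin d} {y : ℝ × ℝ} :
    y ∈ C.openEdge (Sum.inr (j, a)) ↔
      ∃ s : ℝ, 0 < s ∧ C.pos (T.endAt (j, a)) + s • toPlane (endDir j) = y := Iff.rfl

/-- The alternatives are arranged to exclude the leftward and the diagonal ray from `x` for all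
edges, and the downward ray for all edges except the `d` ends of direction `(-1, 0)`. -/
lemma FarLeft.edge {x : ℝ × ℝ} (h : C.FarLeft x) {e : T.Edge} {y : ℝ × ℝ}
    (hy : y ∈ C.closedEdge e) :
    (x.1 < y.1 ∧ y.2 < x.2) ∨ (x.1 < y.1 ∧ y.2 - y.1 < x.2 - x.1) ∨
      ((∃ a, e = Sum.inr (1, a)) ∧ y.2 < x.2) := by
  rcases e with p | ⟨j, a⟩
  · exact Or.inl (h.bounded hy)
  · rw [mem_closedEdge_end] at hy
    obtain ⟨s, hs, rfl⟩ := hy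
    have := h (T.endAt (j, a))
    fin_cases j
    · right; left
      simp [endDir, toPlane] at this ⊢
      constructor <;> linarith
    · right; right
      simp [endDir, toPlane] at this ⊢
      linarith
    · left
      simp [endDir, toPlane] at this ⊢
      constructor <;> linarith

lemma FarRight.edge {x : ℝ × ℝ} (h : C.FarRight x) {e : T.Edge} {y : ℝ × ℝ}
    (hy : y ∈ C.closedEdge e) :
    x.2 < y.2 ∨ ((∃ a, e = Sum.inr (2, a)) ∧ y.1 < x.1) := by
  rcases e with p | ⟨j, a⟩
  · exact Or.inl (h.bounded hy).2
  · rw [mem_closedEdge_end] at hy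
    obtain ⟨s, hs, rfl⟩ := hy
    have := h (T.endAt (j, a))
    fin_cases j
    · left
      simp [endDir, toPlane] at this ⊢
      linarith
    · left
      simp [endDir, toPlane] at this ⊢
      linarith
    · right
      simp [endDir, toPlane] at this ⊢
      linarith

lemma FarLeft.generic {x : ℝ × ℝ} (h : C.FarLeft x) : C.IsGenericPoint x := by
  refine ⟨fun hx => ?_, fun v => ⟨(h v).1.ne', (h v).2.ne⟩⟩
  obtain ⟨e, he⟩ := mem_iUnion.1 hx
  rcases h.edge he with h | h | h
  · exact lt_irrefl _ h.1
  · exact lt_irrefl _ h.1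
  · exact lt_irrefl _ h.2

lemma FarRight.generic {x : ℝ × ℝ} (h : C.FarRight x) : C.IsGenericPoint x := by
  refine ⟨fun hx => ?_, fun v => ⟨(h v).1.ne, (h v).2.ne'⟩⟩
  obtain ⟨e, he⟩ := mem_iUnion.1 hx
  rcases h.edge he with h | h
  · exact lt_irrefl _ h
  · exact lt_irrefl _ h.2

lemma FarLeft.rayCount_fst {x : ℝ × ℝ} (h : C.FarLeft x) : C.rayCount (-1, 0) x = 0 := by
  classical
  refine Finset.sum_eq_zero fun e he => ?_
  obtain ⟨y, hy, τ, hτ, rfl⟩ := (Finset.mem_filter.1 he).2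
  have := h.edge (C.openEdge_subset e hy)
  simp only [toPlane, Prod.fst_add, Prod.snd_add, Prod.smul_fst, Prod.smul_snd, smul_eq_mul,
    Int.cast_neg, Int.cast_one, Int.cast_zero, mul_zero, add_zero] at this
  rcases this with h | h | h <;> linarith [h.1, h.2]

lemma FarLeft.rayCount_diag {x : ℝ × ℝ} (h : C.FarLeft x) : C.rayCount (1, 1) x = 0 := by
  classical
  refine Finset.sum_eq_zero fun e he => ?_
  obtain ⟨y, hy, τ, hτ, rfl⟩ := (Finset.mem_filter.1 he).2
  have := h.edge (C.openEdge_subset e hy)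
  simp only [toPlane, Prod.fst_add, Prod.snd_add, Prod.smul_fst, Prod.smul_snd, smul_eq_mul,
    Int.cast_one, mul_one] at this
  rcases this with h | h | h <;> linarith [h.2]

lemma sum_ends (f : T.Edge → ℤ) (j : Fin 3) (h0 : ∀ e, (¬ ∃ a, e = Sum.inr (j, a)) → f e = 0)
    (h1 : ∀ a, f (Sum.inr (j, a)) = 1) : ∑ e, f e = d := by
  classical
  rw [Fintype.sum_sum_type, Finset.sum_eq_zero (fun p _ => h0 _ (by simp)), zero_add,
    Fintype.sum_prod_type, Finset.sum_eq_single j]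
  · simp [h1]
  · intro k _ hk
    exact Finset.sum_eq_zero fun a _ => h0 _ (by simpa using hk)
  · simp

lemma FarLeft.rayCount_snd {x : ℝ × ℝ} (h : C.FarLeft x) : C.rayCount (0, -1) x = d := by
  classical
  rw [rayCount, Finset.sum_filter]
  refine sum_ends _ 1 (fun e he => ?_) (fun a => ?_)
  · rw [if_neg]
    rintro ⟨y, hy, τ, hτ, rfl⟩
    have := h.edge (C.openEdge_subset e hy)
    simp only [toPlane, Prod.fst_add, Prod.snd_add, Prod.smul_fst, Prod.smul_snd, smul_eq_mul,
      Int.cast_neg, Int.cast_one, Int.cast_zero, mul_zero, add_zero] at this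
    rcases this with h | h | h
    · linarith [h.1]
    · linarith [h.1]
    · exact he h.1
  · rw [if_pos]
    · simp [edgeDir, endDir, latticeCross_apply]
    · have := h (T.endAt (1, a))
      refine ⟨(x.1, (C.pos (T.endAt (1, a))).2), ?_, x.2 - (C.pos (T.endAt (1, a))).2,
        by linarith, by ext <;> simp [toPlane]⟩
      rw [mem_openEdge_end]
      exact ⟨(C.pos (T.endAt (1, a))).1 - x.1, by linarith, by ext <;> simp [toPlane, endDir]⟩

lemma FarLeft.exponent {x : ℝ × ℝ} (h : C.FarLeft x) : C.exponent x = (0, (d : ℤ)) := by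
  rw [exponent_eq, h.rayCount_fst, h.rayCount_snd]

lemma FarRight.exponent {x : ℝ × ℝ} (h : C.FarRight x) : C.exponent x = ((d : ℤ), 0) := by
  classical
  rw [exponent_eq]
  ext
  · simp only
    rw [rayCount, Finset.sum_filter]
    refine sum_ends _ 2 (fun e he => ?_) (fun a => ?_)
    · rw [if_neg]
      rintro ⟨y, hy, τ, hτ, rfl⟩
      have := h.edge (C.openEdge_subset e hy)
      simp only [toPlane, Prod.fst_add, Prod.snd_add, Prod.smul_fst, Prod.smul_snd, smul_eq_mul,
        Int.cast_neg, Int.cast_one, Int.cast_zero, mul_zero, add_zero] at this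
      rcases this with h | h
      · linarith
      · exact he h.1
    · rw [if_pos]
      · simp [edgeDir, endDir, latticeCross_apply]
      · have := h (T.endAt (2, a))
        refine ⟨((C.pos (T.endAt (2, a))).1, x.2), ?_, x.1 - (C.pos (T.endAt (2, a))).1,
          by linarith, by ext <;> simp [toPlane]⟩
        rw [mem_openEdge_end]
        exact ⟨(C.pos (T.endAt (2, a))).2 - x.2, by linarith, by ext <;> simp [toPlane, endDir]⟩
  · refine Finset.sum_eq_zero fun e he => ?_
    obtain ⟨y, hy, τ, hτ, rfl⟩ := (Finset.mem_filter.1 he).2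
    have := h.edge (C.openEdge_subset e hy)
    simp only [toPlane, Prod.fst_add, Prod.snd_add, Prod.smul_fst, Prod.smul_snd, smul_eq_mul,
      Int.cast_neg, Int.cast_one, Int.cast_zero, mul_zero, add_zero] at this
    rcases this with h | h
    · linarith
    · linarith [h.2]

/-- The curve has intersection number `d` with tropical lines. -/
lemma rayCount_sum {x : ℝ × ℝ} (hx : C.IsGenericPoint x) (hx' : C.AvoidsVertices (1, 1) x) :
    C.rayCount (-1, 0) x + C.rayCount (0, -1) x + C.rayCount (1, 1) x = d := by
  -- The segment from `x` to a far point must avoid the vertices; only finitely many slopes are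
  -- forbidden. Positivity of `m` makes the segment lead to the left and upwards.
  obtain ⟨m, hm0, hm⟩ : ∃ m : ℝ, 0 < m ∧ ∀ v, cross (-1, m) (C.pos v - x) ≠ 0 := by
    have hfin : (range fun v => -((C.pos v).2 - x.2) / ((C.pos v).1 - x.1)).Finite :=
      finite_range _
    obtain ⟨m, hm, hm'⟩ := (Ioi_infinite (0 : ℝ)).exists_notMem_finite hfin
    refine ⟨m, hm, fun v h0 => hm' ⟨v, ?_⟩⟩
    have h1 : (C.pos v).1 - x.1 ≠ 0 := sub_ne_zero.2 (hx.2 v).1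
    simp only [cross, Prod.fst_sub, Prod.snd_sub] at h0
    rw [div_eq_iff h1]
    linarith
  obtain ⟨t, ht⟩ : ∃ t : ℝ, C.FarLeft (x + t • ((-1, m) : ℝ × ℝ)) := by
    have h1 : ∀ v, ∀ᶠ t : ℝ in atTop, x.1 - t < (C.pos v).1 ∧ (C.pos v).2 < x.2 + t * m := by
      intro v
      have a1 : Tendsto (fun t : ℝ => x.1 - t) atTop atBot :=
        tendsto_atBot_add_const_left _ _ tendsto_neg_atTop_atBot
      have a2 : Tendsto (fun t : ℝ => x.2 + t * m) atTop atTop :=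
        tendsto_atTop_add_const_left _ _ (tendsto_id.atTop_mul_const hm0)
      exact (a1.eventually_lt_atBot _).and (a2.eventually_gt_atTop _)
    obtain ⟨t, ht⟩ := (eventually_all.2 h1).exists
    exact ⟨t, fun v => by simpa [sub_eq_add_neg] using ht v⟩
  have hseg : ∀ v, C.pos v ∉ segment ℝ x (x + t • ((-1, m) : ℝ × ℝ)) := by
    intro v hv
    rw [segment_eq_image'] at hv
    obtain ⟨s, -, hs⟩ := hv
    apply hm v
    rw [← hs]
    simp only [add_sub_cancel_left, cross_smul_right, cross_self, mul_zero]
  have g := ht.generic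
  have gd : C.AvoidsVertices (1, 1) (x + t • ((-1, m) : ℝ × ℝ)) := by
    intro v
    have := ht v
    simp only [cross, toPlane, Prod.fst_sub, Prod.snd_sub, Int.cast_one, one_mul]
    intro h0
    linarith
  have h1 := C.rayCount_sub (ρ := (-1, 0)) (by simp) hx.1 g.1 hx.avoids_fst g.avoids_fst hseg
  have h2 := C.rayCount_sub (ρ := (0, -1)) (by simp) hx.1 g.1 hx.avoids_snd g.avoids_snd hseg
  have h3 := C.rayCount_sub (ρ := (1, 1)) (by simp) hx.1 g.1 hx' gd hseg
  rw [ht.rayCount_fst] at h1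
  rw [ht.rayCount_snd] at h2
  rw [ht.rayCount_diag] at h3
  -- The directions `(-1, 0)`, `(0, -1)`, `(1, 1)` sum to zero, so the three changes cancel, and far
  -- left the three counts are `0`, `d`, `0`.
  simp only [latticeCross_apply] at h1 h2 h3
  linarith

lemma rayCount_nonneg (ρ : ℤ × ℤ) (x : ℝ × ℝ) : 0 ≤ C.rayCount ρ x :=
  Finset.sum_nonneg fun _ _ => abs_nonneg _

end Curve

/-! ### Faces of convex hulls -/

/-- The segment lies on the level set `f = M`, hence its union with the open half plane below is
convex. With `a = b` this also shows that a vertex is the unique maximum. -/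
lemma convexHull_lt_or_mem_segment {S : Set (ℝ × ℝ)} (f : (ℝ × ℝ) →ₗ[ℝ] ℝ) {a b : ℝ × ℝ} {M : ℝ}
    (ha : f a = M) (hb : f b = M) (hS : ∀ s ∈ S, f s < M ∨ s ∈ segment ℝ a b) {y : ℝ × ℝ}
    (hy : y ∈ convexHull ℝ S) : f y < M ∨ y ∈ segment ℝ a b := by
  have hseg : ∀ z ∈ segment ℝ a b, f z = M := by
    rintro z ⟨p, q, hp, hq, hpq, rfl⟩
    rw [map_add, map_smul, map_smul, ha, hb, smul_eq_mul, smul_eq_mul, ← add_mul, hpq, one_mul]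
  have hconv : Convex ℝ {z | f z < M ∨ z ∈ segment ℝ a b} := by
    rw [convex_iff_forall_pos]
    intro x hx z hz p q hp hq hpq
    have hx' : f x ≤ M := hx.elim le_of_lt fun h => (hseg x h).le
    have hz' : f z ≤ M := hz.elim le_of_lt fun h => (hseg z h).le
    by_cases hxs : f x < M
    · left
      rw [map_add, map_smul, map_smul, smul_eq_mul, smul_eq_mul]
      have : M = p * M + q * M := by rw [← add_mul, hpq, one_mul]
      nlinarith
    · by_cases hzs : f z < M
      · left
        rw [map_add, map_smul, map_smul, smul_eq_mul, smul_eq_mul]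
        have : M = p * M + q * M := by rw [← add_mul, hpq, one_mul]
        nlinarith
      · right
        exact convex_segment a b (hx.resolve_left hxs) (hz.resolve_left hzs) hp.le hq.le hpq
  exact convexHull_min (fun s hs => hS s hs) hconv hy

lemma face_convexHull {S : Set (ℝ × ℝ)} {u : Normal} {a b : ℝ × ℝ} (ha : a ∈ S) (hb : b ∈ S)
    (hab : dot (toPlane u.1) a = dot (toPlane u.1) b)
    (hS : ∀ s ∈ S, dot (toPlane u.1) s < dot (toPlane u.1) a ∨ s ∈ segment ℝ a b) :
    face (convexHull ℝ S) u = segment ℝ a b := by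
  have key := fun y (hy : y ∈ convexHull ℝ S) =>
    convexHull_lt_or_mem_segment (dotLin (toPlane u.1)) rfl hab.symm hS hy
  have hseg : ∀ z ∈ segment ℝ a b, dotLin (toPlane u.1) z = dotLin (toPlane u.1) a := by
    rintro z ⟨p, q, hp, hq, hpq, rfl⟩
    rw [map_add, map_smul, map_smul, dotLin_apply, dotLin_apply, ← hab, smul_eq_mul, smul_eq_mul,
      ← add_mul, hpq, one_mul]
  ext y
  constructor
  · rintro ⟨hy, hmax⟩
    exact (key y hy).resolve_left (not_lt.2 (hmax a (subset_convexHull ℝ S ha)))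
  · intro hy
    refine ⟨(convex_convexHull ℝ S).segment_subset (subset_convexHull ℝ S ha)
      (subset_convexHull ℝ S hb) hy, fun m hm => ?_⟩
    have h1 := hseg y hy
    rw [dotLin_apply, dotLin_apply] at h1
    rw [h1]
    rcases key m hm with h | h
    · exact h.le
    · have h2 := hseg m h
      rw [dotLin_apply, dotLin_apply] at h2
      exact h2.le

/-! ### Local fans -/

/-- `E` is locally constant on the set `X` of small vectors off a fan with directions `o e` and
jumps by the rotated directions across the rays of the fan. -/
structure IsLocalFan {ι : Type*} (s : Finset ι) (o : ι → ℤ × ℤ) (X : Set (ℝ × ℝ))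
    (E : ℝ × ℝ → ℤ × ℤ) : Prop where
  ne_zero : ∀ e ∈ s, o e ≠ 0
  jump : ∀ v ∈ X, ∀ w ∈ X, 0 < cross v w → E v = E w + ∑ e ∈ s with
    0 < cross v (toPlane (o e)) ∧ 0 < cross (toPlane (o e)) w, rot (o e)
  perturb : ∀ v ∈ X, ∀ F : Finset (ℝ × ℝ), (∀ f ∈ F, f ≠ 0) →
    ∃ w ∈ X, E w = E v ∧ ∀ f ∈ F, cross f w ≠ 0
  exists_smul_mem : ∀ w : ℝ × ℝ, w.1 ≠ 0 → w.2 ≠ 0 →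
    (∀ e ∈ s, ∀ t : ℝ, 0 ≤ t → w ≠ t • toPlane (o e)) → ∃ t : ℝ, 0 < t ∧ t • w ∈ X
  cone : ∀ v ∈ X, ∀ t : ℝ, 0 < t → t ≤ 1 → t • v ∈ X ∧ E (t • v) = E v

namespace IsLocalFan

variable {ι : Type*} {s : Finset ι} {o : ι → ℤ × ℤ} {X : Set (ℝ × ℝ)} {E : ℝ × ℝ → ℤ × ℤ}
  (h : IsLocalFan s o X E)
include h

/-- A small rotation of `u` towards `w` keeps all strict positions and leaves every ray parallel to
`u`; a suitable multiple then lies in `X`. The set `F` allows further positions to be preserved. -/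
lemma exists_near {u w : ℝ × ℝ} (hu : u ≠ 0) (hw : cross u w ≠ 0) (F : Finset (ℝ × ℝ))
    (hF : ∀ f ∈ F, f ≠ 0) : ∃ t δ : ℝ, 0 < t ∧ 0 < δ ∧ t • (u + δ • w) ∈ X ∧
      (∀ e ∈ s, (0 < cross u (toPlane (o e)) → 0 < cross (t • (u + δ • w)) (toPlane (o e))) ∧
        (cross u (toPlane (o e)) < 0 → cross (t • (u + δ • w)) (toPlane (o e)) < 0)) ∧
      (∀ e ∈ s, cross (t • (u + δ • w)) (toPlane (o e)) ≠ 0) ∧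
      ∀ f ∈ F, (0 < cross u f → 0 < cross (t • (u + δ • w)) f) ∧
        (cross u f < 0 → cross (t • (u + δ • w)) f < 0) := by
  classical
  have ev := fun f hf => eventually_cross_add_smul u w f hw hu hf
  have e1 : ∀ᶠ δ in 𝓝[>] (0 : ℝ), ∀ e ∈ s, _ := (Finset.eventually_all s).2 fun e he =>
    ev (toPlane (o e)) (toPlane_ne_zero.2 (h.ne_zero e he))
  have e2 : ∀ᶠ δ in 𝓝[>] (0 : ℝ), ∀ f ∈ F, _ := (Finset.eventually_all F).2 fun f hf =>
    ev f (hF f hf)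
  obtain ⟨δ, h1, h2, h3, h4, hδ⟩ := (e1.and (e2.and ((ev (1, 0) (by simp)).and
    ((ev (0, 1) (by simp)).and self_mem_nhdsWithin)))).exists
  obtain ⟨t, ht, hX⟩ := h.exists_smul_mem (u + δ • w)
    (fun h0 => h4.2.2 (by rw [cross, h0]; ring)) (fun h0 => h3.2.2 (by rw [cross, h0]; ring))
    (by
      intro e he t ht heq
      have := (h1 e he).2.2
      rw [heq, cross_smul_left, cross_self, mul_zero] at this
      exact this rfl)
  refine ⟨t, δ, ht, hδ, hX, fun e he => ?_, fun e he => ?_, fun f hf => ?_⟩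
  · rw [cross_smul_left]
    exact ⟨fun hp => mul_pos ht ((h1 e he).1 hp),
      fun hp => mul_neg_of_pos_of_neg ht ((h1 e he).2.1 hp)⟩
  · rw [cross_smul_left]
    exact mul_ne_zero ht.ne' (h1 e he).2.2
  · rw [cross_smul_left]
    exact ⟨fun hp => mul_pos ht ((h2 f hf).1 hp),
      fun hp => mul_neg_of_pos_of_neg ht ((h2 f hf).2.1 hp)⟩

end IsLocalFan

/-- `v` is a slight rotation of `u` relative to the fan with directions `o e`. -/
def NearTo {ι : Type*} (s : Finset ι) (o : ι → ℤ × ℤ) (u v : ℝ × ℝ) : Prop :=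
  ∀ e ∈ s, (0 < cross u (toPlane (o e)) → 0 < cross v (toPlane (o e))) ∧
    (cross u (toPlane (o e)) < 0 → cross v (toPlane (o e)) < 0)

lemma cross_eq_zero_trichotomy {u o v : ℝ × ℝ} (hu : u ≠ 0) (h0 : cross u o = 0) :
    cross v o = dot u o / dot u u * cross v u := by
  conv_lhs => rw [eq_smul_of_cross_eq_zero hu h0, cross_smul_right]

namespace IsLocalFan

variable {ι : Type*} {s : Finset ι} {o : ι → ℤ × ℤ} {X : Set (ℝ × ℝ)} {E : ℝ × ℝ → ℤ × ℤ}
  (h : IsLocalFan s o X E) {u : ℝ × ℝ}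
include h

/-- Turning further from `u` counterclockwise subtracts vectors `rot o` from the exponent, where
`dot u (rot o) = cross u o > 0` for the rays passed. So the exponent just beside `u` is maximal for
`u` on this side. -/
lemma dot_left {vp : ℝ × ℝ} (hp : vp ∈ X) (hup : 0 < cross u vp)
    (np : NearTo s o u vp) {v : ℝ × ℝ} (hv : v ∈ X) (huv : 0 < cross u v)
    (hne : cross vp v ≠ 0) :
    E v = E vp ∨ dot u (toPlane (E v)) < dot u (toPlane (E vp)) := by
  classical
  have hu : u ≠ 0 := by rintro rfl; simp [cross] at hup
  rcases lt_or_gt_of_ne hne with hc | hc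
  · left
    rw [cross_swap] at hc
    rw [h.jump v hv vp hp (by linarith), Finset.sum_eq_zero, add_zero]
    intro e he
    obtain ⟨hes, h1, h2⟩ := by simpa using he
    exfalso
    have pl := cross_plucker u v vp (toPlane (o e))
    -- Here `v` lies between `u` and `vp`, and a ray between `v` and `vp` would contradict that `vp`
    -- is near to `u`.
    have h3 : 0 < cross u (toPlane (o e)) := by
      have : 0 < cross v vp * cross u (toPlane (o e)) := by rw [pl]; positivity
      exact pos_of_mul_pos_right this (by linarith)
    have h4 := (np e hes).1 h3
    rw [cross_swap] at h2
    linarith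
  · have hj := h.jump vp hp v hv hc
    have hpos : ∀ e ∈ s.filter (fun e => 0 < cross vp (toPlane (o e)) ∧
        0 < cross (toPlane (o e)) v), 0 < dot u (toPlane (rot (o e))) := by
      intro e he
      obtain ⟨hes, h1, h2⟩ := by simpa using he
      rw [dot_rot]
      rcases lt_trichotomy (cross u (toPlane (o e))) 0 with h3 | h3 | h3
      · have := (np e hes).2 h3; linarith
      · exfalso
        have e1 := cross_eq_zero_trichotomy (v := vp) hu h3
        have e2 := cross_eq_zero_trichotomy (v := v) hu h3
        rw [cross_swap v, cross_swap v u] at e2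
        rw [e1, cross_swap vp u] at h1
        have h5 : cross (toPlane (o e)) v =
          dot u (toPlane (o e)) / dot u u * cross u v := by linarith
        rw [h5] at h2
        have h6 := pos_of_mul_pos_left h2 huv.le
        nlinarith
      · exact h3
    rcases Finset.eq_empty_or_nonempty (s.filter (fun e => 0 < cross vp (toPlane (o e)) ∧
        0 < cross (toPlane (o e)) v)) with hem | hem
    · left; rw [hj, hem]; simp
    · right
      rw [hj, toPlane_add, toPlane_sum, ← dotLin_apply, ← dotLin_apply, map_add, map_sum]
      have := Finset.sum_pos hpos hem
      simp only [dotLin_apply]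
      linarith

lemma dot_right {vm : ℝ × ℝ} (hm : vm ∈ X) (hum : cross u vm < 0)
    (nm : NearTo s o u vm) {v : ℝ × ℝ} (hv : v ∈ X) (huv : cross u v < 0)
    (hne : cross vm v ≠ 0) :
    E v = E vm ∨ dot u (toPlane (E v)) < dot u (toPlane (E vm)) := by
  classical
  have hu : u ≠ 0 := by rintro rfl; simp [cross] at hum
  rcases lt_or_gt_of_ne hne with hc | hc
  · rw [cross_swap, neg_lt_zero] at hc
    have hj := h.jump v hv vm hm hc
    have hpos : ∀ e ∈ s.filter (fun e => 0 < cross v (toPlane (o e)) ∧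
        0 < cross (toPlane (o e)) vm), dot u (toPlane (rot (o e))) < 0 := by
      intro e he
      obtain ⟨hes, h1, h2⟩ := by simpa using he
      rw [dot_rot]
      rw [cross_swap] at h2
      rcases lt_trichotomy (cross u (toPlane (o e))) 0 with h3 | h3 | h3
      · exact h3
      · exfalso
        rw [cross_eq_zero_trichotomy (v := vm) hu h3, cross_swap vm u] at h2
        rw [cross_eq_zero_trichotomy (v := v) hu h3, cross_swap v u] at h1
        have h6 := pos_of_mul_pos_left h1 (by linarith)
        nlinarith
      · have := (nm e hes).1 h3; linarith
    rcases Finset.eq_empty_or_nonempty (s.filter (fun e => 0 < cross v (toPlane (o e)) ∧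
        0 < cross (toPlane (o e)) vm)) with hem | hem
    · left; rw [hj, hem]; simp
    · right
      rw [hj, toPlane_add, toPlane_sum, ← dotLin_apply, ← dotLin_apply, map_add, map_sum]
      have := Finset.sum_neg hpos hem
      simp only [dotLin_apply]
      linarith
  · left
    rw [h.jump vm hm v hv hc, Finset.sum_eq_zero, add_zero]
    intro e he
    obtain ⟨hes, h1, h2⟩ := by simpa using he
    exfalso
    have pl := cross_plucker u vm v (toPlane (o e))
    have h3 : cross u (toPlane (o e)) < 0 := by
      have : cross vm v * cross u (toPlane (o e)) < 0 := by rw [pl]; nlinarith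
      by_contra hcon
      nlinarith
    have h4 := (nm e hes).2 h3
    linarith

/-- The rays between the two slight rotations of `u` are exactly those in direction `u`. -/
lemma right_eq_left {vp vm : ℝ × ℝ} (hp : vp ∈ X) (hm : vm ∈ X) (hup : 0 < cross u vp)
    (hum : cross u vm < 0) (np : NearTo s o u vp) (nm : NearTo s o u vm)
    (hpm : 0 < cross vm vp) : E vm = E vp + ∑ e ∈ s with
      cross u (toPlane (o e)) = 0 ∧ 0 < dot u (toPlane (o e)), rot (o e) := by
  classical
  have hu : u ≠ 0 := by rintro rfl; simp [cross] at hup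
  have hd := dot_self_pos hu
  rw [h.jump vm hm vp hp hpm]
  congr 1
  refine Finset.sum_congr (Finset.filter_congr fun e he => ?_) fun _ _ => rfl
  rw [cross_swap _ vp]
  rcases lt_trichotomy (cross u (toPlane (o e))) 0 with h3 | h3 | h3
  · have := (nm e he).2 h3
    constructor
    · rintro ⟨a, b⟩; linarith
    · rintro ⟨a, b⟩; linarith
  · rw [cross_eq_zero_trichotomy (v := vm) hu h3, cross_eq_zero_trichotomy (v := vp) hu h3,
      cross_swap vm u, cross_swap vp u]
    constructor
    · rintro ⟨a, b⟩
      refine ⟨h3, ?_⟩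
      have h6 := pos_of_mul_pos_left a (by linarith)
      exact (div_pos_iff_of_pos_right hd).1 h6
    · rintro ⟨a, b⟩
      have := div_pos b hd
      constructor <;> nlinarith
  · have := (np e he).1 h3
    constructor
    · rintro ⟨a, b⟩; linarith
    · rintro ⟨a, b⟩; linarith

omit h in
lemma dot_sum_parallel (u : ℝ × ℝ) : dot u (toPlane (∑ e ∈ s with
      cross u (toPlane (o e)) = 0 ∧ 0 < dot u (toPlane (o e)), rot (o e))) = 0 := by
  classical
  rw [toPlane_sum, ← dotLin_apply, map_sum]
  refine Finset.sum_eq_zero fun e he => ?_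
  rw [dotLin_apply, dot_rot]
  exact (Finset.mem_filter.1 he).2.1

/-- The faces of the polygon dual to a fan. -/
lemma face_eq {u : Normal} {vp vm : ℝ × ℝ} (hp : vp ∈ X) (hm : vm ∈ X)
    (hup : 0 < cross (toPlane u.1) vp) (hum : cross (toPlane u.1) vm < 0)
    (np : NearTo s o (toPlane u.1) vp) (nm : NearTo s o (toPlane u.1) vm)
    (hpm : 0 < cross vm vp) :
    face (convexHull ℝ (toPlane '' (E '' X))) u =
      segment ℝ (toPlane (E vp)) (toPlane (E vm)) := by
  classical
  have hab : dot (toPlane u.1) (toPlane (E vp)) = dot (toPlane u.1) (toPlane (E vm)) := by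
    rw [h.right_eq_left hp hm hup hum np nm hpm, toPlane_add, ← dotLin_apply, ← dotLin_apply,
      map_add, dotLin_apply, dotLin_apply, dot_sum_parallel, add_zero]
  refine face_convexHull ⟨_, ⟨vp, hp, rfl⟩, rfl⟩ ⟨_, ⟨vm, hm, rfl⟩, rfl⟩ hab ?_
  rintro _ ⟨_, ⟨v, hv, rfl⟩, rfl⟩
  -- `v` may lie on the line of `u`, `vp` or `vm`; moving it slightly does not change the exponent.
  obtain ⟨w, hw, hwv, hF⟩ := h.perturb v hv {toPlane u.1, vp, vm} (by
    intro f hf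
    simp only [Finset.mem_insert, Finset.mem_singleton] at hf
    rcases hf with rfl | rfl | rfl
    · exact toPlane_ne_zero.2 u.ne_zero
    · rintro rfl; simp [cross] at hup
    · rintro rfl; simp [cross] at hum)
  rw [← hwv]
  have f1 := hF (toPlane u.1) (by simp)
  have f2 := hF vp (by simp)
  have f3 := hF vm (by simp)
  rcases lt_or_gt_of_ne f1 with h1 | h1
  · rcases h.dot_right hm hum nm hw h1 f3 with h2 | h2
    · right; rw [h2]; exact right_mem_segment ℝ _ _
    · left; rw [hab]; exact h2
  · rcases h.dot_left hp hup np hw h1 f2 with h2 | h2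
    · right; rw [h2]; exact left_mem_segment ℝ _ _
    · left; exact h2

/-! ### The position relative to a line of irrational slope -/

variable {ε : ℝ}

omit h in
lemma cross_leftDir (v : ℝ × ℝ) : cross v (-1, ε) = height ε v := by
  simp [cross, height, dot]; ring

omit h in
lemma leftDir_cross (v : ℝ × ℝ) : cross (-1, ε) v = -height ε v := by
  simp [cross, height, dot]; ring

omit h in
lemma cross_rightDir (v : ℝ × ℝ) : cross v (1, -ε) = -height ε v := by
  simp [cross, height, dot]; ring

omit h in
lemma rightDir_cross (v : ℝ × ℝ) : cross (1, -ε) v = height ε v := by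
  simp [cross, height, dot]; ring

lemma exists_leftDir (hirr : Irrational ε) : ∃ t : ℝ, 0 < t ∧ t • ((-1, ε) : ℝ × ℝ) ∈ X := by
  refine h.exists_smul_mem _ (by simp) hirr.ne_zero fun e he t ht heq => ?_
  have h1 := congrArg (height ε) heq
  have h2 := dot_irrational_ne_zero hirr (h.ne_zero e he)
  have h3 : t * height ε (toPlane (o e)) = 0 := by
    have := height_add_smul ε 0 (toPlane (o e)) t
    rw [zero_add] at this
    rw [← zero_add (t * _)]
    rw [← heq] at this
    simp [height, dot] at this
    simpa [height, dot] using this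
  rcases mul_eq_zero.1 h3 with h4 | h4
  · rw [h4, zero_smul] at heq
    simp at heq
  · exact h2 h4

lemma exists_rightDir (hirr : Irrational ε) : ∃ t : ℝ, 0 < t ∧ t • ((1, -ε) : ℝ × ℝ) ∈ X := by
  refine h.exists_smul_mem _ (by simp) (neg_ne_zero.2 hirr.ne_zero) fun e he t ht heq => ?_
  have h2 := dot_irrational_ne_zero hirr (h.ne_zero e he)
  have h3 : t * height ε (toPlane (o e)) = 0 := by
    have := height_add_smul ε 0 (toPlane (o e)) t
    rw [zero_add] at this
    rw [← zero_add (t * _)]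
    rw [← heq] at this
    simp [height, dot] at this
    simpa [height, dot] using this
  rcases mul_eq_zero.1 h3 with h4 | h4
  · rw [h4, zero_smul] at heq
    simp at heq
  · exact h2 h4

variable {tl tr : ℝ}

lemma above_left (htl : 0 < tl) (hL : tl • ((-1, ε) : ℝ × ℝ) ∈ X) {v : ℝ × ℝ} (hv : v ∈ X)
    (hup : 0 < height ε v) : E v = E (tl • (-1, ε)) + ∑ e ∈ s with
      0 < cross v (toPlane (o e)) ∧ 0 < height ε (toPlane (o e)), rot (o e) := by
  classical
  rw [h.jump v hv _ hL (by rw [cross_smul_right, cross_leftDir]; positivity)]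
  simp only [cross_smul_right, cross_leftDir, mul_pos_iff_of_pos_left htl]

lemma below_left (htl : 0 < tl) (hL : tl • ((-1, ε) : ℝ × ℝ) ∈ X) {v : ℝ × ℝ} (hv : v ∈ X)
    (hdown : height ε v < 0) : E (tl • (-1, ε)) = E v + ∑ e ∈ s with
      height ε (toPlane (o e)) < 0 ∧ 0 < cross (toPlane (o e)) v, rot (o e) := by
  classical
  rw [h.jump _ hL v hv (by rw [cross_smul_left, leftDir_cross]; nlinarith)]
  simp only [cross_smul_left, leftDir_cross, mul_pos_iff_of_pos_left htl, neg_pos]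

lemma above_right (htr : 0 < tr) (hR : tr • ((1, -ε) : ℝ × ℝ) ∈ X) {v : ℝ × ℝ} (hv : v ∈ X)
    (hup : 0 < height ε v) : E (tr • (1, -ε)) = E v + ∑ e ∈ s with
      0 < height ε (toPlane (o e)) ∧ 0 < cross (toPlane (o e)) v, rot (o e) := by
  classical
  rw [h.jump _ hR v hv (by rw [cross_smul_left, rightDir_cross]; positivity)]
  simp only [cross_smul_left, rightDir_cross, mul_pos_iff_of_pos_left htr]

lemma below_right (htr : 0 < tr) (hR : tr • ((1, -ε) : ℝ × ℝ) ∈ X) {v : ℝ × ℝ} (hv : v ∈ X)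
    (hdown : height ε v < 0) : E v = E (tr • (1, -ε)) + ∑ e ∈ s with
      0 < cross v (toPlane (o e)) ∧ height ε (toPlane (o e)) < 0, rot (o e) := by
  classical
  rw [h.jump v hv _ hR (by rw [cross_smul_right, cross_rightDir]; nlinarith)]
  simp only [cross_smul_right, cross_rightDir, mul_pos_iff_of_pos_left htr, neg_pos]

omit h in
lemma lam_sum (t : Finset ι) : lam ε (toPlane (∑ e ∈ t, rot (o e))) =
    ∑ e ∈ t, height ε (toPlane (o e)) := by
  rw [toPlane_sum, ← lamLin_apply, map_sum]
  exact Finset.sum_congr rfl fun e _ => lam_rot ε (o e)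

omit h in
lemma lam_add_eq (a b : ℤ × ℤ) :
    lam ε (toPlane (a + b)) = lam ε (toPlane a) + lam ε (toPlane b) := by
  rw [toPlane_add, ← lamLin_apply, map_add]; rfl

omit h in
lemma eq_or_lam_lt {a b : ℤ × ℤ} {t : Finset ι} (hab : b = a + ∑ e ∈ t, rot (o e))
    (ht : ∀ e ∈ t, 0 < height ε (toPlane (o e))) :
    a = b ∨ lam ε (toPlane a) < lam ε (toPlane b) := by
  rcases t.eq_empty_or_nonempty with h0 | h0
  · left; rw [hab, h0]; simp
  · right
    rw [hab, lam_add_eq, lam_sum]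
    have := Finset.sum_pos ht h0
    linarith

omit h in
lemma eq_or_lam_lt_of_neg {a b : ℤ × ℤ} {t : Finset ι} (hab : b = a + ∑ e ∈ t, rot (o e))
    (ht : ∀ e ∈ t, height ε (toPlane (o e)) < 0) :
    a = b ∨ lam ε (toPlane b) < lam ε (toPlane a) := by
  rcases t.eq_empty_or_nonempty with h0 | h0
  · left; rw [hab, h0]; simp
  · right
    rw [hab, lam_add_eq, lam_sum]
    have := Finset.sum_neg ht h0
    linarith

/-- Starting from the left direction, turning clockwise above the line adds rotated directions of
positive height, and turning counterclockwise below it subtracts those of negative height. Either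
way `λ` grows by `lam_rot`. -/
lemma left_le (htl : 0 < tl) (hL : tl • ((-1, ε) : ℝ × ℝ) ∈ X) {v : ℝ × ℝ} (hv : v ∈ X) :
    E v = E (tl • (-1, ε)) ∨
      lam ε (toPlane (E (tl • (-1, ε)))) < lam ε (toPlane (E v)) := by
  classical
  obtain ⟨w, hw, hwv, hF⟩ := h.perturb v hv {((-1, ε) : ℝ × ℝ)} (by simp)
  have f1 := hF (-1, ε) (by simp)
  rw [leftDir_cross, neg_ne_zero] at f1
  rw [← hwv]
  rcases lt_or_gt_of_ne f1 with h1 | h1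
  · exact eq_or_lam_lt_of_neg (h.below_left htl hL hw h1)
      (fun e he => (Finset.mem_filter.1 he).2.1)
  · exact (eq_or_lam_lt (h.above_left htl hL hw h1)
      (fun e he => (Finset.mem_filter.1 he).2.2)).imp Eq.symm id

lemma le_right (htr : 0 < tr) (hR : tr • ((1, -ε) : ℝ × ℝ) ∈ X) {v : ℝ × ℝ} (hv : v ∈ X) :
    E v = E (tr • (1, -ε)) ∨
      lam ε (toPlane (E v)) < lam ε (toPlane (E (tr • (1, -ε)))) := by
  classical
  obtain ⟨w, hw, hwv, hF⟩ := h.perturb v hv {((-1, ε) : ℝ × ℝ)} (by simp)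
  have f1 := hF (-1, ε) (by simp)
  rw [leftDir_cross, neg_ne_zero] at f1
  rw [← hwv]
  rcases lt_or_gt_of_ne f1 with h1 | h1
  · exact (eq_or_lam_lt_of_neg (h.below_right htr hR hw h1)
      (fun e he => (Finset.mem_filter.1 he).2.2)).imp Eq.symm id
  · exact eq_or_lam_lt (h.above_right htr hR hw h1)
      (fun e he => (Finset.mem_filter.1 he).2.1)

/-- Passing the fan above. -/
lemma right_eq_left_add (htl : 0 < tl) (hL : tl • ((-1, ε) : ℝ × ℝ) ∈ X)
    (htr : 0 < tr) (hR : tr • ((1, -ε) : ℝ × ℝ) ∈ X) :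
    E (tr • (1, -ε)) = E (tl • (-1, ε)) +
      ∑ e ∈ s with 0 < height ε (toPlane (o e)), rot (o e) := by
  classical
  -- The two directions along the line are opposite, so `jump` does not compare them directly; the
  -- turn is divided at a generic vector close to `(0, 1)`.
  obtain ⟨t, δ, -, -, hX, -, hne, hF⟩ := h.exists_near (u := ((0, 1) : ℝ × ℝ)) (w := (1, 0))
    (by simp) (by simp [cross]) {((-1, ε) : ℝ × ℝ)} (by simp)
  have hup := (hF (-1, ε) (by simp)).1 (by simp [cross])
  rw [cross_leftDir] at hup
  clear hF
  generalize t • (((0, 1) : ℝ × ℝ) + δ • (1, 0)) = v at hX hne hup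
  rw [h.above_right htr hR hX hup, h.above_left htl hL hX hup, add_assoc]
  congr 1
  simp only [Finset.sum_filter, ← Finset.sum_add_distrib]
  refine Finset.sum_congr rfl fun e he => ?_
  have h1 := hne e he
  rw [cross_swap (toPlane (o e))]
  rcases lt_or_gt_of_ne h1 with h2 | h2 <;> by_cases h3 : 0 < height ε (toPlane (o e)) <;>
    simp [h2, h2.not_gt, h3]

/-- Passing the fan below. -/
lemma left_eq_right_add (htl : 0 < tl) (hL : tl • ((-1, ε) : ℝ × ℝ) ∈ X)
    (htr : 0 < tr) (hR : tr • ((1, -ε) : ℝ × ℝ) ∈ X) :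
    E (tl • (-1, ε)) = E (tr • (1, -ε)) +
      ∑ e ∈ s with height ε (toPlane (o e)) < 0, rot (o e) := by
  classical
  obtain ⟨t, δ, -, -, hX, -, hne, hF⟩ := h.exists_near (u := ((0, -1) : ℝ × ℝ)) (w := (1, 0))
    (by simp) (by simp [cross]) {((-1, ε) : ℝ × ℝ)} (by simp)
  have hdown := (hF (-1, ε) (by simp)).2 (by simp [cross])
  rw [cross_leftDir] at hdown
  clear hF
  generalize t • (((0, -1) : ℝ × ℝ) + δ • (1, 0)) = v at hX hne hdown
  rw [h.below_left htl hL hX hdown, h.below_right htr hR hX hdown, add_assoc]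
  congr 1
  simp only [Finset.sum_filter, ← Finset.sum_add_distrib]
  refine Finset.sum_congr rfl fun e he => ?_
  have h1 := hne e he
  rw [cross_swap (toPlane (o e))]
  rcases lt_or_gt_of_ne h1 with h2 | h2 <;> by_cases h3 : height ε (toPlane (o e)) < 0 <;>
    simp [h2, h2.not_gt, h3]

/-- Slight rotations of `u` to both sides. -/
lemma exists_sides {u : ℝ × ℝ} (hu : u ≠ 0) (F : Finset (ℝ × ℝ)) (hF : ∀ f ∈ F, f ≠ 0) :
    ∃ vp ∈ X, ∃ vm ∈ X, 0 < cross u vp ∧ cross u vm < 0 ∧ NearTo s o u vp ∧ NearTo s o u vm ∧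
      0 < cross vm vp ∧ (∀ f ∈ F, (0 < cross u f → 0 < cross vp f) ∧
        (cross u f < 0 → cross vp f < 0)) ∧ ∀ f ∈ F, (0 < cross u f → 0 < cross vm f) ∧
        (cross u f < 0 → cross vm f < 0) := by
  have hd := dot_self_pos hu
  have hp0 : cross u (perp u) ≠ 0 := by rw [cross_perp]; exact hd.ne'
  have hm0 : cross u (-perp u) ≠ 0 := by
    rw [show -perp u = (-1 : ℝ) • perp u by module, cross_smul_right]
    simpa using hp0
  obtain ⟨t, δ, ht, hδ, hX, n1, -, f1⟩ := h.exists_near hu hp0 F hF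
  obtain ⟨t', δ', ht', hδ', hX', n2, -, f2⟩ := h.exists_near hu hm0 F hF
  refine ⟨_, hX, _, hX', ?_, ?_, n1, n2, ?_, f1, f2⟩
  · rw [cross_smul_right, cross_add_right, cross_self, cross_smul_right, cross_perp]
    positivity
  · rw [cross_smul_right, cross_add_right, cross_self, cross_smul_right,
      show -perp u = (-1 : ℝ) • perp u by module, cross_smul_right, cross_perp]
    have : 0 < t' * (δ' * dot u u) := by positivity
    linarith
  · rw [cross_smul_right, cross_smul_left]
    have : cross (u + δ' • -perp u) (u + δ • perp u) = (δ + δ') * dot u u := by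
      simp [cross, perp, dot]; ring
    rw [this]
    positivity

end IsLocalFan

/-! ### The curve near a marked point -/

lemma isOpen_dense_cross_ne (F : Finset ((ℝ × ℝ) × ℝ)) (hF : ∀ f ∈ F, f.1 ≠ 0) :
    IsOpen {w : ℝ × ℝ | ∀ f ∈ F, cross f.1 w ≠ f.2} ∧
      Dense {w : ℝ × ℝ | ∀ f ∈ F, cross f.1 w ≠ f.2} := by
  classical
  induction F using Finset.induction_on with
  | empty => simp
  | insert f F hf ih =>
    obtain ⟨h1, h2⟩ := ih fun g hg => hF g (Finset.mem_insert_of_mem hg)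
    have hset : {w : ℝ × ℝ | ∀ g ∈ insert f F, cross g.1 w ≠ g.2} =
        {w | cross f.1 w ≠ f.2} ∩ {w | ∀ g ∈ F, cross g.1 w ≠ g.2} := by
      ext w; simp
    have ho : IsOpen {w : ℝ × ℝ | cross f.1 w ≠ f.2} := by
      refine isOpen_ne_fun ?_ continuous_const
      unfold cross; fun_prop
    have hf0 := hF f (Finset.mem_insert_self _ _)
    have hd : Dense {w : ℝ × ℝ | cross f.1 w ≠ f.2} := by
      intro w
      by_cases hw : cross f.1 w = f.2
      · have ht : Tendsto (fun δ : ℝ => w + δ • perp f.1) (𝓝[>] 0) (𝓝 w) := by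
          have : Continuous fun δ : ℝ => w + δ • perp f.1 := by fun_prop
          simpa using (this.tendsto 0).mono_left nhdsWithin_le_nhds
        refine mem_closure_of_tendsto ht ?_
        filter_upwards [self_mem_nhdsWithin] with δ hδ
        have : 0 < δ * dot f.1 f.1 := mul_pos hδ (dot_self_pos hf0)
        change cross f.1 (w + δ • perp f.1) ≠ f.2
        rw [cross_add_right, cross_smul_right, cross_perp, hw]
        linarith
      · exact subset_closure hw
    rw [hset]
    exact ⟨ho.inter h1, hd.inter_of_isOpen_left h2 ho⟩

lemma one_le_norm_toPlane {m : ℤ × ℤ} (hm : m ≠ 0) : 1 ≤ ‖toPlane m‖ := by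
  rw [Prod.norm_def, le_max_iff]
  by_cases h : m.1 = 0
  · right
    have h2 : m.2 ≠ 0 := fun h2 => hm (Prod.ext h h2)
    have := Int.one_le_abs h2
    simp only [toPlane, Real.norm_eq_abs]
    exact_mod_cast this
  · left
    have := Int.one_le_abs h
    simp only [toPlane, Real.norm_eq_abs]
    exact_mod_cast this

namespace Curve
variable {d n : ℕ} {T : CombType d n} (C : Curve T)

lemma isClosed_closedEdge {e : T.Edge} (he : C.edgeDir e ≠ 0) : IsClosed (C.closedEdge e) := by
  rcases e with p | a
  · have : IsCompact (C.closedEdge (Sum.inl p)) := by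
      refine IsCompact.image isCompact_Icc ?_
      fun_prop
    exact this.isClosed
  · have h0 : toPlane (endDir a.1) ≠ 0 := toPlane_ne_zero.2 he
    have : C.closedEdge (Sum.inr a) = {y | cross (toPlane (endDir a.1)) (y - C.pos (T.endAt a)) = 0 ∧
        0 ≤ dot (toPlane (endDir a.1)) (y - C.pos (T.endAt a))} := by
      ext y
      constructor
      · rintro ⟨s, hs, rfl⟩
        simp only [base, edgeDir, mem_ofPred_eq, add_sub_cancel_left, cross_smul_right, cross_self,
          mul_zero, true_and]
        rw [← dotLin_apply, map_smul, dotLin_apply]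
        exact mul_nonneg hs (dot_self_pos h0).le
      · rintro ⟨h1, h2⟩
        refine ⟨_, div_nonneg h2 (dot_self_pos h0).le, ?_⟩
        simp only [base, edgeDir]
        rw [← eq_smul_of_cross_eq_zero h0 h1]
        abel
    rw [this]
    have h1 : IsClosed {y | cross (toPlane (endDir a.1)) (y - C.pos (T.endAt a)) = 0} :=
      isClosed_eq (by unfold cross; fun_prop) continuous_const
    have h2 : IsClosed {y | 0 ≤ dot (toPlane (endDir a.1)) (y - C.pos (T.endAt a))} :=
      isClosed_le continuous_const (by unfold dot; fun_prop)
    exact h1.inter h2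

lemma weight_eq {v : T.Vert} {e : T.Edge} (h : T.Incident v e) :
    C.weight e = Int.gcd (C.outDir v e).1 (C.outDir v e).2 := by
  rcases C.outDir_eq_or_neg h with h1 | h1 <;> simp [weight, h1]

/-- Within distance `δ` of the point `pos v` the curve looks like the fan of the edges at `v`. -/
structure IsRadius (v : T.Vert) (δ : ℝ) : Prop where
  pos : 0 < δ
  vertex : ∀ w, w ≠ v → δ ≤ ‖C.pos w - C.pos v‖
  fst : ∀ w, (C.pos w).1 ≠ (C.pos v).1 → δ ≤ |(C.pos w).1 - (C.pos v).1|
  snd : ∀ w, (C.pos w).2 ≠ (C.pos v).2 → δ ≤ |(C.pos w).2 - (C.pos v).2|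
  far : ∀ e, ¬ T.Incident v e → ∀ y ∈ C.closedEdge e, δ ≤ ‖y - C.pos v‖
  param : ∀ e, ∀ s, 0 < s → s < δ → s ∈ C.openParam e

/-- The small vectors at `v` off the fan of the edges at `v`. -/
def offFan (v : T.Vert) (δ : ℝ) : Set (ℝ × ℝ) :=
  {w | ‖w‖ < δ ∧ w.1 ≠ 0 ∧ w.2 ≠ 0 ∧
    ∀ e ∈ T.star v, ∀ t : ℝ, 0 ≤ t → w ≠ t • toPlane (C.outDir v e)}

end Curve

namespace OnLine

variable {d n : ℕ} {r : Fin n → ℕ} {ε c : ℝ} {T : CombType d n} {C : Curve T}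
  (H : OnLine r ε c C)
include H

lemma star_nonempty (v : T.Vert) : (T.star v).Nonempty := by
  rw [← Finset.card_pos]
  by_cases hv : v ∈ range T.mark
  · obtain ⟨i, rfl⟩ := hv
    rw [H.card_star_mark]; omega
  · have := three_le_card_star hv
    omega

lemma pos_mem_image (v : T.Vert) : C.pos v ∈ C.image := by
  obtain ⟨e, he⟩ := H.star_nonempty v
  exact mem_iUnion.2 ⟨e, C.pos_mem_closedEdge (CombType.mem_star.1 he)⟩

lemma isClosed_image : IsClosed C.image :=
  isClosed_iUnion_of_finite fun e => C.isClosed_closedEdge (H.edgeDir_ne_zero e)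

/-- No foreign edge passes through a marked point; hence the local fan and the labels see the edges
of the marked vertex only. -/
lemma incident_of_mem {i : Fin n} {e : T.Edge} (h : C.pos (T.mark i) ∈ C.closedEdge e) :
    T.Incident (T.mark i) e := by
  obtain ⟨j, hj, hij⟩ := H.mem_line h (H.height_mark i)
  rwa [H.inj hij]

lemma exists_isRadius (i : Fin n) : ∃ δ, C.IsRadius (T.mark i) δ := by
  have aux : ∀ a : ℝ, 0 < a → ∀ᶠ δ in 𝓝[>] (0 : ℝ), δ ≤ a := fun a ha =>
    mem_nhdsWithin_of_mem_nhds (Iic_mem_nhds ha)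
  have h1 : ∀ w, ∀ᶠ δ in 𝓝[>] (0 : ℝ), w ≠ T.mark i → δ ≤ ‖C.pos w - C.pos (T.mark i)‖ := by
    intro w
    by_cases hw : w = T.mark i
    · exact Eventually.of_forall fun δ h => absurd hw h
    · filter_upwards [aux _ (norm_pos_iff.2 (sub_ne_zero.2 fun h => hw (H.inj h)))] with δ hδ _
        using hδ
  have h2 : ∀ a b : ℝ, ∀ᶠ δ in 𝓝[>] (0 : ℝ), a ≠ b → δ ≤ |a - b| := by
    intro a b
    by_cases hw : a = b
    · exact Eventually.of_forall fun δ h => absurd hw h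
    · filter_upwards [aux _ (abs_pos.2 (sub_ne_zero.2 hw))] with δ hδ _ using hδ
  have h3 : ∀ e : T.Edge, ∀ᶠ δ in 𝓝[>] (0 : ℝ), ¬ T.Incident (T.mark i) e →
      ∀ y ∈ C.closedEdge e, δ ≤ ‖y - C.pos (T.mark i)‖ := by
    intro e
    by_cases he : T.Incident (T.mark i) e
    · exact Eventually.of_forall fun δ h => absurd he h
    · have hcl := C.isClosed_closedEdge (H.edgeDir_ne_zero e)
      have hnot : C.pos (T.mark i) ∈ (C.closedEdge e)ᶜ := fun h => he (H.incident_of_mem h)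
      obtain ⟨η, hη, hball⟩ := Metric.isOpen_iff.1 hcl.isOpen_compl _ hnot
      filter_upwards [aux η hη] with δ hδ _ y hy
      by_contra hlt
      refine hball (a := y) ?_ hy
      rw [Metric.mem_ball, dist_eq_norm]
      linarith
  have h4 : ∀ e : T.Edge, ∀ᶠ δ in 𝓝[>] (0 : ℝ), ∀ s, 0 < s → s < δ → s ∈ C.openParam e := by
    intro e
    obtain ⟨L, hL, hsub, -⟩ := C.exists_openParam e
    filter_upwards [aux L hL] with δ hδ s hs hs'
    exact hsub ⟨hs, hs'.trans_le hδ⟩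
  obtain ⟨δ, a1, a2, a3, a4, a5, a6⟩ := ((eventually_all.2 h1).and
    ((eventually_all.2 fun w => h2 (C.pos w).1 (C.pos (T.mark i)).1).and
    ((eventually_all.2 fun w => h2 (C.pos w).2 (C.pos (T.mark i)).2).and
    ((eventually_all.2 h3).and ((eventually_all.2 h4).and self_mem_nhdsWithin))))).exists
  exact ⟨δ, a6, a1, a2, a3, a4, a5⟩

variable {i : Fin n} {δ : ℝ} (R : C.IsRadius (T.mark i) δ)
include R

lemma mem_openEdge_iff {e : T.Edge} {w : ℝ × ℝ} (hw : ‖w‖ < δ) :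
    C.pos (T.mark i) + w ∈ C.openEdge e ↔ T.Incident (T.mark i) e ∧
      ∃ s : ℝ, 0 < s ∧ w = s • toPlane (C.outDir (T.mark i) e) := by
  constructor
  · intro h
    have he : T.Incident (T.mark i) e := by
      by_contra he
      have := R.far e he _ (C.openEdge_subset e h)
      rw [add_sub_cancel_left] at this
      linarith
    refine ⟨he, ?_⟩
    rw [C.openEdge_eq he] at h
    obtain ⟨s, hs, hsw⟩ := h
    exact ⟨s, Curve.openParam_pos C hs, (add_left_cancel hsw).symm⟩
  · rintro ⟨he, s, hs, rfl⟩
    rw [C.openEdge_eq he]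
    refine ⟨s, R.param e s hs ?_, rfl⟩
    rw [norm_smul, Real.norm_of_nonneg hs.le] at hw
    -- A nonzero integral direction has norm at least `1`, so the parameter `s` is bounded by the
    -- norm of `w` and thus by `δ`.
    have := one_le_norm_toPlane (H.outDir_ne_zero he)
    nlinarith

lemma mem_closedEdge_iff {e : T.Edge} {w : ℝ × ℝ} (hw : ‖w‖ < δ) :
    C.pos (T.mark i) + w ∈ C.closedEdge e ↔ T.Incident (T.mark i) e ∧
      ∃ s : ℝ, 0 ≤ s ∧ w = s • toPlane (C.outDir (T.mark i) e) := by
  constructor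
  · intro h
    have he : T.Incident (T.mark i) e := by
      by_contra he
      have := R.far e he _ h
      rw [add_sub_cancel_left] at this
      linarith
    refine ⟨he, ?_⟩
    rw [C.closedEdge_eq he] at h
    obtain ⟨s, hs, hsw⟩ := h
    exact ⟨s, Curve.closedParam_nonneg C hs, (add_left_cancel hsw).symm⟩
  · rintro ⟨he, s, hs, hws⟩
    rcases eq_or_lt_of_le hs with h0 | h0
    · rw [← h0, zero_smul] at hws
      rw [hws, add_zero]
      exact C.pos_mem_closedEdge he
    · exact C.openEdge_subset e ((H.mem_openEdge_iff R hw).2 ⟨he, s, h0, hws⟩)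

lemma not_mem_image {w : ℝ × ℝ} (hw : w ∈ C.offFan (T.mark i) δ) :
    C.pos (T.mark i) + w ∉ C.image := by
  intro h
  obtain ⟨e, he⟩ := mem_iUnion.1 h
  obtain ⟨he, s, hs, hws⟩ := (H.mem_closedEdge_iff R hw.1).1 he
  exact hw.2.2.2 e (CombType.mem_star.2 he) s hs hws

lemma generic_of_mem {w : ℝ × ℝ} (hw : w ∈ C.offFan (T.mark i) δ) :
    C.IsGenericPoint (C.pos (T.mark i) + w) := by
  have hn := hw.1
  rw [Prod.norm_def, max_lt_iff, Real.norm_eq_abs, Real.norm_eq_abs] at hn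
  refine ⟨H.not_mem_image R hw, fun v => ⟨fun h => ?_, fun h => ?_⟩⟩
  · by_cases hv : (C.pos v).1 = (C.pos (T.mark i)).1
    · rw [hv] at h
      exact hw.2.1 (by simpa using h)
    · have := R.fst v hv
      rw [h] at this
      simp only [Prod.fst_add, add_sub_cancel_left] at this
      linarith
  · by_cases hv : (C.pos v).2 = (C.pos (T.mark i)).2
    · rw [hv] at h
      exact hw.2.2.1 (by simpa using h)
    · have := R.snd v hv
      rw [h] at this
      simp only [Prod.snd_add, add_sub_cancel_left] at this
      linarith

lemma mem_of_generic {w : ℝ × ℝ} (hw : ‖w‖ < δ) (hg : C.IsGenericPoint (C.pos (T.mark i) + w)) :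
    w ∈ C.offFan (T.mark i) δ := by
  refine ⟨hw, fun h => (hg.2 (T.mark i)).1 (by simp [h]), fun h => (hg.2 (T.mark i)).2 (by simp [h]),
    fun e he t ht hwt => hg.1 (mem_iUnion.2 ⟨e, ?_⟩)⟩
  exact (H.mem_closedEdge_iff R hw).2 ⟨CombType.mem_star.1 he, t, ht, hwt⟩

omit H R in
lemma norm_lt_of_mem_segment {v w z : ℝ × ℝ} (hv : ‖v‖ < δ) (hw : ‖w‖ < δ)
    (hz : z ∈ segment ℝ v w) : ‖z‖ < δ := by
  have h := (convex_ball (0 : ℝ × ℝ) δ).segment_subset (by simpa using hv) (by simpa using hw) hz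
  simpa using h

lemma segmentCount_eq {v w : ℝ × ℝ} (hv : v ∈ C.offFan (T.mark i) δ)
    (hw : w ∈ C.offFan (T.mark i) δ) (hc : 0 < cross v w) :
    C.segmentCount (C.pos (T.mark i) + w) (C.pos (T.mark i) + v) = ∑ e ∈ T.star (T.mark i) with
      0 < cross v (toPlane (C.outDir (T.mark i) e)) ∧
      0 < cross (toPlane (C.outDir (T.mark i) e)) w, C.outDir (T.mark i) e := by
  classical
  have hmeets : ∀ e, C.MeetsSegment (C.pos (T.mark i) + w) (C.pos (T.mark i) + v) e ↔
      T.Incident (T.mark i) e ∧ 0 < cross v (toPlane (C.outDir (T.mark i) e)) ∧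
        0 < cross (toPlane (C.outDir (T.mark i) e)) w := by
    intro e
    constructor
    · rintro ⟨y, hy, a, b, ha, hb, hab, rfl⟩
      have hz : a • w + b • v ∈ segment ℝ w v := ⟨a, b, ha, hb, hab, rfl⟩
      have hn := norm_lt_of_mem_segment hw.1 hv.1 hz
      have heq : a • (C.pos (T.mark i) + w) + b • (C.pos (T.mark i) + v) =
          C.pos (T.mark i) + (a • w + b • v) := by
        have : a • (C.pos (T.mark i) + w) + b • (C.pos (T.mark i) + v) =
          (a + b) • C.pos (T.mark i) + (a • w + b • v) := by module
        rw [this, hab, one_smul]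
      rw [heq, H.mem_openEdge_iff R hn] at hy
      obtain ⟨he, s, hs, hso⟩ := hy
      have ha0 : 0 < a := by
        refine lt_of_le_of_ne ha fun h0 => ?_
        subst h0
        rw [zero_add] at hab
        rw [hab, zero_smul, zero_add, one_smul] at hso
        exact hv.2.2.2 e (CombType.mem_star.2 he) s hs.le hso
      have hb0 : 0 < b := by
        refine lt_of_le_of_ne hb fun h0 => ?_
        subst h0
        rw [add_zero] at hab
        rw [hab, zero_smul, add_zero, one_smul] at hso
        exact hw.2.2.2 e (CombType.mem_star.2 he) s hs.le hso
      have h1 : s * cross v (toPlane (C.outDir (T.mark i) e)) = a * cross v w := by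
        rw [← cross_smul_right, ← hso, cross_add_right, cross_smul_right, cross_smul_right,
          cross_self, mul_zero, add_zero]
      have h2 : s * cross (toPlane (C.outDir (T.mark i) e)) w = b * cross v w := by
        rw [← cross_smul_left, ← hso, cross_add_left, cross_smul_left, cross_smul_left,
          cross_self, mul_zero, zero_add]
      refine ⟨he, ?_, ?_⟩
      · exact pos_of_mul_pos_right (by rw [h1]; positivity) hs.le
      · exact pos_of_mul_pos_right (by rw [h2]; positivity) hs.le
    · rintro ⟨he, h1, h2⟩
      set o := toPlane (C.outDir (T.mark i) e)
      have hk : 0 < cross o w + cross v o := by linarith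
      -- The point where the ray of `o` hits the segment, found from Cramer's rule `cross v w • o =
      -- cross v o • w + cross o w • v`.
      have hso : (cross v w / (cross o w + cross v o)) • o =
          (cross v o / (cross o w + cross v o)) • w + (cross o w / (cross o w + cross v o)) • v := by
        have : cross v w • o = cross v o • w + cross o w • v := by
          ext <;> simp [cross] <;> ring
        rw [div_eq_inv_mul, div_eq_inv_mul, div_eq_inv_mul, mul_smul, mul_smul, mul_smul,
          ← smul_add, this]
      have hz : (cross v w / (cross o w + cross v o)) • o ∈ segment ℝ w v := by
        rw [hso]
        exact ⟨_, _, by positivity, by positivity, by field_simp; ring, rfl⟩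
      have hn := norm_lt_of_mem_segment hw.1 hv.1 hz
      refine ⟨C.pos (T.mark i) + (cross v w / (cross o w + cross v o)) • o, ?_, ?_⟩
      · rw [H.mem_openEdge_iff R hn]
        exact ⟨he, _, by positivity, rfl⟩
      · rw [mem_segment_translate]
        exact hz
  rw [Curve.segmentCount]
  have hset : (Finset.univ.filter fun e =>
      C.MeetsSegment (C.pos (T.mark i) + w) (C.pos (T.mark i) + v) e) =
      (T.star (T.mark i)).filter fun e => 0 < cross v (toPlane (C.outDir (T.mark i) e)) ∧
        0 < cross (toPlane (C.outDir (T.mark i) e)) w := by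
    ext e
    rw [Finset.mem_filter, Finset.mem_filter, CombType.mem_star, hmeets]
    simp
  rw [hset]
  refine Finset.sum_congr rfl fun e he => ?_
  obtain ⟨hes, h1, h2⟩ := Finset.mem_filter.1 he
  -- All crossing edges leave the vertex across the segment in the same sense, so the sign in
  -- `segmentCount` just turns `edgeDir` into `outDir`.
  have hpos : 0 < cross (v - w) (toPlane (C.outDir (T.mark i) e)) := by
    rw [cross_swap, cross_sub_right, cross_swap _ v]
    linarith
  rw [add_sub_add_left_eq_sub]
  rcases C.outDir_eq_or_neg (CombType.mem_star.1 hes) with h3 | h3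
  · rw [← h3, sign_pos hpos]; simp
  · rw [h3, toPlane_neg] at hpos
    have : cross (v - w) (toPlane (C.edgeDir e)) < 0 := by
      have h4 : cross (v - w) (-toPlane (C.edgeDir e)) = -cross (v - w) (toPlane (C.edgeDir e)) := by
        simp [cross]; ring
      linarith
    rw [sign_neg this, h3]; simp

lemma exists_near_point {v : ℝ × ℝ} (hv : v ∈ C.offFan (T.mark i) δ) (F : Finset ((ℝ × ℝ) × ℝ))
    (hF : ∀ f ∈ F, f.1 ≠ 0) : ∃ w ∈ C.offFan (T.mark i) δ,
      C.exponent (C.pos (T.mark i) + w) = C.exponent (C.pos (T.mark i) + v) ∧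
      ∀ f ∈ F, cross f.1 w ≠ f.2 := by
  classical
  have hnot : C.pos (T.mark i) + v ∈ (C.image)ᶜ := H.not_mem_image R hv
  obtain ⟨η, hη, hball⟩ := Metric.isOpen_iff.1 H.isClosed_image.isOpen_compl _ hnot
  obtain ⟨h1, h2⟩ := isOpen_dense_cross_ne
    (insert (((1, 0) : ℝ × ℝ), (0 : ℝ)) (insert (((0, 1) : ℝ × ℝ), (0 : ℝ)) F)) (by
      intro f hf
      simp only [Finset.mem_insert] at hf
      rcases hf with rfl | rfl | hf
      · simp
      · simp
      · exact hF f hf)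
  obtain ⟨w, ⟨hw1, hw2⟩, hw3⟩ := h2.inter_open_nonempty (Metric.ball v η ∩ Metric.ball 0 δ)
    (Metric.isOpen_ball.inter Metric.isOpen_ball) ⟨v, Metric.mem_ball_self hη, by simpa using hv.1⟩
  have hseg : ∀ y ∈ segment ℝ (C.pos (T.mark i) + v) (C.pos (T.mark i) + w), y ∉ C.image := by
    intro y hy
    refine hball ((convex_ball _ η).segment_subset (Metric.mem_ball_self hη) ?_ hy)
    simpa [Metric.mem_ball, dist_eq_norm] using hw1
  have hwX : w ∈ C.offFan (T.mark i) δ := by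
    refine ⟨by simpa using hw2, ?_, ?_, ?_⟩
    · have := hw3 ((0, 1), 0) (by simp)
      simpa [cross] using this
    · have := hw3 ((1, 0), 0) (by simp)
      simpa [cross] using this
    · intro e he t ht hwt
      refine hseg _ (right_mem_segment ℝ _ _) (mem_iUnion.2 ⟨e, ?_⟩)
      exact (H.mem_closedEdge_iff R (by simpa using hw2)).2 ⟨CombType.mem_star.1 he, t, ht, hwt⟩
  refine ⟨w, hwX, ?_, fun f hf => hw3 f (by simp [hf])⟩
  exact Curve.exponent_eq_of_disjoint (H.generic_of_mem R hv) (H.generic_of_mem R hwX) hseg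
    H.pos_mem_image

lemma isLocalFan : IsLocalFan (T.star (T.mark i)) (C.outDir (T.mark i)) (C.offFan (T.mark i) δ)
    (fun v => C.exponent (C.pos (T.mark i) + v)) where
  ne_zero e he := H.outDir_ne_zero (CombType.mem_star.1 he)
  jump v hv w hw hc := by
    have hvert : ∀ u, C.pos u ∉ segment ℝ (C.pos (T.mark i) + w) (C.pos (T.mark i) + v) := by
      intro u hu
      obtain ⟨z, hz, hzu⟩ : ∃ z ∈ segment ℝ w v, C.pos u = C.pos (T.mark i) + z := by
        rw [← segment_translate_image] at hu
        obtain ⟨z, hz, hzu⟩ := hu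
        exact ⟨z, hz, hzu.symm⟩
      have hn := norm_lt_of_mem_segment hw.1 hv.1 hz
      by_cases hui : u = T.mark i
      · subst hui
        have hz0 : z = 0 := by simpa using hzu.symm
        subst hz0
        -- The origin is not on the segment from `w` to `v`, because these vectors are linearly
        -- independent.
        obtain ⟨a, b, ha, hb, hab, h0⟩ := hz
        have e1 := congrArg (cross v) h0
        have e2 := congrArg (fun z => cross z w) h0
        simp only [cross_add_right, cross_add_left, cross_smul_right, cross_smul_left,
          cross_self, mul_zero, add_zero, zero_add] at e1 e2
        have z1 : cross v 0 = 0 := by simp [cross]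
        have z2 : cross 0 w = 0 := by simp [cross]
        rw [z1] at e1
        rw [z2] at e2
        nlinarith
      · have := R.vertex u hui
        rw [hzu, add_sub_cancel_left] at this
        linarith
    have h1 := Curve.exponent_sub (H.generic_of_mem R hw) (H.generic_of_mem R hv) hvert
    rw [H.segmentCount_eq R hv hw hc, map_sum] at h1
    rw [← h1]; abel
  perturb v hv F hF := by
    classical
    obtain ⟨w, hw, hwv, hne⟩ := H.exists_near_point R hv (F.image fun f => (f, 0)) (by
      intro f hf
      obtain ⟨g, hg, rfl⟩ := Finset.mem_image.1 hf
      exact hF g hg)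
    exact ⟨w, hw, hwv, fun f hf => hne (f, 0) (Finset.mem_image_of_mem _ hf)⟩
  exists_smul_mem w h1 h2 h3 := by
    have hw0 : 0 < ‖w‖ := norm_pos_iff.2 fun h => h1 (by simp [h])
    refine ⟨δ / (2 * ‖w‖), div_pos R.pos (by positivity), ?_, ?_, ?_, ?_⟩
    · rw [norm_smul, Real.norm_of_nonneg (div_nonneg R.pos.le (by positivity))]
      have := R.pos
      have : δ / (2 * ‖w‖) * ‖w‖ = δ / 2 := by field_simp
      linarith
    · exact mul_ne_zero (div_pos R.pos (by positivity)).ne' h1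
    · exact mul_ne_zero (div_pos R.pos (by positivity)).ne' h2
    · intro e he t ht hwt
      have hp : 0 < δ / (2 * ‖w‖) := div_pos R.pos (by positivity)
      refine h3 e he (t / (δ / (2 * ‖w‖))) (by positivity) ?_
      rw [div_eq_inv_mul, mul_smul, ← hwt, smul_smul, inv_mul_cancel₀ hp.ne', one_smul]
  cone v hv t ht ht1 := by
    have hmem : ∀ s : ℝ, 0 < s → s ≤ 1 → s • v ∈ C.offFan (T.mark i) δ := by
      intro s hs hs1
      refine ⟨?_, mul_ne_zero hs.ne' hv.2.1, mul_ne_zero hs.ne' hv.2.2.1, ?_⟩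
      · rw [norm_smul, Real.norm_of_nonneg hs.le]
        have := hv.1
        nlinarith [norm_nonneg v]
      · intro e he t' ht' hwt
        refine hv.2.2.2 e he (t' / s) (by positivity) ?_
        rw [div_eq_inv_mul, mul_smul, ← hwt, smul_smul, inv_mul_cancel₀ hs.ne', one_smul]
    refine ⟨hmem t ht ht1, ?_⟩
    refine Curve.exponent_eq_of_disjoint (H.generic_of_mem R hv)
      (H.generic_of_mem R (hmem t ht ht1)) ?_ H.pos_mem_image
    intro y hy
    rw [← segment_translate_image] at hy
    obtain ⟨z, ⟨a, b, ha, hb, hab, rfl⟩, rfl⟩ := hy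
    have : a • v + b • t • v = (a + b * t) • v := by module
    simp only [this]
    refine H.not_mem_image R (hmem _ ?_ ?_)
    · rcases eq_or_lt_of_le ha with h0 | h0
      · have : b = 1 := by linarith
        rw [this]; linarith
      · have := mul_nonneg hb ht.le
        linarith
    · nlinarith

lemma dualPolygon_eq : C.dualPolygon (C.pos (T.mark i)) = convexHull ℝ
    (toPlane '' ((fun v => C.exponent (C.pos (T.mark i) + v)) '' C.offFan (T.mark i) δ)) := by
  rw [Curve.dualPolygon]
  congr 1
  ext m
  constructor
  · intro hm
    have hev : ∀ᶠ x in 𝓝 (C.pos (T.mark i)), ‖x - C.pos (T.mark i)‖ < δ := by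
      filter_upwards [Metric.ball_mem_nhds (C.pos (T.mark i)) R.pos] with x hx
      rwa [Metric.mem_ball, dist_eq_norm] at hx
    obtain ⟨x, ⟨hg, hx⟩, hn⟩ := (hm.and_eventually hev).exists
    have hx' : C.pos (T.mark i) + (x - C.pos (T.mark i)) = x := by abel
    refine ⟨_, ⟨x - C.pos (T.mark i), H.mem_of_generic R hn (by rwa [hx']), rfl⟩, ?_⟩
    simp only [hx']
    exact hx
  · rintro ⟨_, ⟨v, hv, rfl⟩, rfl⟩
    -- The multiples `t • v` have the same exponent as `v` and tend to the marked point, so this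
    -- exponent belongs to a component with the point in its closure.
    have ht : Tendsto (fun t : ℝ => C.pos (T.mark i) + t • v) (𝓝[>] 0) (𝓝 (C.pos (T.mark i))) := by
      have : Continuous fun t : ℝ => C.pos (T.mark i) + t • v := by fun_prop
      simpa using (this.tendsto 0).mono_left nhdsWithin_le_nhds
    refine ht.frequently (Eventually.frequently ?_)
    filter_upwards [self_mem_nhdsWithin, mem_nhdsWithin_of_mem_nhds (Iic_mem_nhds one_pos)]
      with t ht0 ht1
    obtain ⟨h1, h2⟩ := (H.isLocalFan R).cone v hv t ht0 ht1
    exact ⟨H.generic_of_mem R h1, congrArg toPlane h2⟩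

open scoped Classical in
lemma imageLabel_eq (u : Normal) : C.imageLabel (C.pos (T.mark i)) u =
    ((T.star (T.mark i)).filter fun e => cross (toPlane u.1) (toPlane (C.outDir (T.mark i) e)) = 0 ∧
      0 < dot (toPlane u.1) (toPlane (C.outDir (T.mark i) e))).val.map C.weight := by
  have hu : toPlane u.1 ≠ 0 := toPlane_ne_zero.2 u.ne_zero
  have hsmall : ∀ᶠ s in 𝓝[>] (0 : ℝ), ‖s • toPlane u.1‖ < δ := by
    have : Tendsto (fun s : ℝ => ‖s • toPlane u.1‖) (𝓝[>] 0) (𝓝 0) := by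
      have : Continuous fun s : ℝ => ‖s • toPlane u.1‖ := by fun_prop
      simpa using (this.tendsto 0).mono_left nhdsWithin_le_nhds
    exact this.eventually_lt_const R.pos
  rw [Curve.imageLabel]
  congr 2
  ext e
  rw [Finset.mem_filter, Finset.mem_filter, CombType.mem_star]
  constructor
  · rintro ⟨-, he⟩
    obtain ⟨s, ⟨h1, h2⟩, hs⟩ := ((he.and hsmall).and self_mem_nhdsWithin).exists
    obtain ⟨hinc, t, ht, hst⟩ := (H.mem_closedEdge_iff R h2).1 h1
    have hs' : 0 < s := hs
    have ht0 : 0 < t := by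
      refine lt_of_le_of_ne ht fun h0 => ?_
      rw [← h0, zero_smul] at hst
      exact smul_ne_zero hs'.ne' hu hst
    refine ⟨hinc, ?_, ?_⟩
    · have := congrArg (cross (toPlane u.1)) hst
      rw [cross_smul_right, cross_smul_right, cross_self, mul_zero] at this
      exact (mul_eq_zero.1 this.symm).resolve_left ht0.ne'
    · have := congrArg (dotLin (toPlane u.1)) hst
      rw [map_smul, map_smul, dotLin_apply, dotLin_apply, smul_eq_mul, smul_eq_mul] at this
      have h5 := mul_pos hs' (dot_self_pos hu)
      rw [this] at h5
      exact pos_of_mul_pos_right h5 ht0.le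
  · rintro ⟨hinc, h1, h2⟩
    refine ⟨Finset.mem_univ _, ?_⟩
    filter_upwards [hsmall, self_mem_nhdsWithin] with s hs hs0
    refine (H.mem_closedEdge_iff R hs).2 ⟨hinc, ?_⟩
    have hk := eq_smul_of_cross_eq_zero hu h1
    have hk0 := div_pos h2 (dot_self_pos hu)
    set k := dot (toPlane u.1) (toPlane (C.outDir (T.mark i) e)) / dot (toPlane u.1) (toPlane u.1)
    have hs0' : 0 < s := hs0
    refine ⟨s / k, by positivity, ?_⟩
    rw [hk, smul_smul, div_mul_cancel₀ _ hk0.ne']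

end OnLine

/-! ### Primitive vectors and lattice lengths -/

lemma Normal.exists_bezout (u : Normal) : ∃ a b : ℤ, a * u.1.1 + b * u.1.2 = 1 := by
  obtain ⟨a, b, h⟩ := Int.isCoprime_iff_gcd_eq_one.2 u.2
  exact ⟨a, b, h⟩

lemma eq_gcd_smul {u : Normal} {o : ℤ × ℤ} (h0 : cross (toPlane u.1) (toPlane o) = 0)
    (h1 : 0 < dot (toPlane u.1) (toPlane o)) : o = (Int.gcd o.1 o.2 : ℤ) • u.1 := by
  obtain ⟨a, b, hab⟩ := u.exists_bezout
  have h0' : u.1.1 * o.2 - u.1.2 * o.1 = 0 := by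
    simp only [cross, toPlane] at h0; exact_mod_cast h0
  have h1' : 0 < u.1.1 * o.1 + u.1.2 * o.2 := by
    simp only [dot, toPlane] at h1; exact_mod_cast h1
  -- By Bézout this integer is the factor between `o` and the primitive vector `u`.
  set k := a * o.1 + b * o.2
  have e1 : o.1 = k * u.1.1 := by
    simp only [k]; linear_combination (-o.1) * hab - b * h0'
  have e2 : o.2 = k * u.1.2 := by
    simp only [k]; linear_combination (-o.2) * hab + a * h0'
  have hk : 0 < k := by
    by_contra hk
    rw [e1, e2] at h1'
    nlinarith [mul_self_nonneg u.1.1, mul_self_nonneg u.1.2]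
  have hg : (Int.gcd o.1 o.2 : ℤ) = k := by
    rw [e1, e2, Int.gcd_mul_left, u.2, mul_one, Int.natCast_natAbs, abs_of_pos hk]
  rw [hg]
  ext
  · simpa using e1
  · simpa using e2

open scoped Classical in
/-- The primitive vector in the direction of a nonzero lattice vector. -/
def normalOf (o : ℤ × ℤ) : Normal :=
  if h : o = 0 then ⟨(1, 0), by simp⟩ else
    ⟨(o.1 / Int.gcd o.1 o.2, o.2 / Int.gcd o.1 o.2), Int.gcd_ediv_gcd_ediv_gcd
      (Nat.pos_of_ne_zero fun h0 => h (by
        rw [Int.gcd_eq_zero_iff] at h0; exact Prod.ext h0.1 h0.2))⟩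

lemma gcd_pos_of_ne_zero {o : ℤ × ℤ} (h : o ≠ 0) : 0 < Int.gcd o.1 o.2 :=
  Nat.pos_of_ne_zero fun h0 => h (by
    rw [Int.gcd_eq_zero_iff] at h0; exact Prod.ext h0.1 h0.2)

lemma eq_gcd_smul_normalOf {o : ℤ × ℤ} (h : o ≠ 0) :
    o = (Int.gcd o.1 o.2 : ℤ) • (normalOf o).1 := by
  simp only [normalOf, h, dif_neg, not_false_eq_true]
  ext
  · simp [Int.mul_ediv_cancel' (Int.gcd_dvd_left o.1 o.2)]
  · simp [Int.mul_ediv_cancel' (Int.gcd_dvd_right o.1 o.2)]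

lemma parallel_iff_normalOf {u : Normal} {o : ℤ × ℤ} (h : o ≠ 0) :
    (cross (toPlane u.1) (toPlane o) = 0 ∧ 0 < dot (toPlane u.1) (toPlane o)) ↔
      normalOf o = u := by
  have hg : (0 : ℤ) < Int.gcd o.1 o.2 := by exact_mod_cast gcd_pos_of_ne_zero h
  have hn := eq_gcd_smul_normalOf h
  constructor
  · rintro ⟨h0, h1⟩
    have := eq_gcd_smul h0 h1
    rw [hn] at this
    conv_rhs at this => rw [← hn]
    exact Subtype.ext (smul_right_injective _ hg.ne' this)
  · rintro rfl
    have hp : toPlane o = (Int.gcd o.1 o.2 : ℝ) • toPlane (normalOf o).1 := by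
      conv_lhs => rw [hn, toPlane_zsmul]
      simp
    rw [hp, cross_smul_right, cross_self, mul_zero, ← dotLin_apply, map_smul, dotLin_apply]
    refine ⟨rfl, mul_pos (by exact_mod_cast hg) ?_⟩
    exact dot_self_pos (toPlane_ne_zero.2 (normalOf o).ne_zero)

lemma latticeLength_segment (a : ℤ × ℤ) (u : Normal) (W : ℕ) :
    latticeLength (segment ℝ (toPlane a) (toPlane (a + (W : ℤ) • rot u.1))) = W := by
  have hp0 : rot u.1 ≠ 0 := by
    intro h
    apply u.ne_zero
    simp only [rot, AddMonoidHom.coe_mk, ZeroHom.coe_mk, Prod.mk_eq_zero, neg_eq_zero] at h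
    exact Prod.ext h.2 h.1
  have hset : {m : ℤ × ℤ | toPlane m ∈ segment ℝ (toPlane a) (toPlane (a + (W : ℤ) • rot u.1))} =
      ((Finset.range (W + 1)).image fun k : ℕ => a + (k : ℤ) • rot u.1 : Finset (ℤ × ℤ)) := by
    ext m
    rw [mem_ofPred_eq, segment_eq_image', toPlane_add, toPlane_zsmul, add_sub_cancel_left]
    simp only [Finset.coe_image, mem_image, Finset.coe_range, mem_Iio]
    constructor
    · rintro ⟨s, hs, hm⟩
      obtain ⟨α, β, hab⟩ := u.exists_bezout
      have hab' : (α : ℝ) * u.1.1 + β * u.1.2 = 1 := by exact_mod_cast hab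
      have e1 : (m.1 : ℝ) = a.1 + s * W * u.1.2 := by
        have := congrArg Prod.fst hm
        simp [toPlane, rot] at this
        linarith
      have e2 : (m.2 : ℝ) = a.2 - s * W * u.1.1 := by
        have := congrArg Prod.snd hm
        simp [toPlane, rot] at this
        linarith
      -- The Bézout functional takes the value `1` on `rot u.1`, so it reads off the position on the
      -- segment as an integer.
      have hx : ((β * (m.1 - a.1) - α * (m.2 - a.2) : ℤ) : ℝ) = s * W := by
        push_cast
        rw [e1, e2]
        linear_combination (s * W) * hab'
      have hx0 : 0 ≤ β * (m.1 - a.1) - α * (m.2 - a.2) := by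
        have : (0 : ℝ) ≤ s * W := mul_nonneg hs.1 (Nat.cast_nonneg W)
        rw [← hx] at this
        exact_mod_cast this
      obtain ⟨k, hk⟩ := Int.eq_ofNat_of_zero_le hx0
      rw [hk] at hx
      simp only [Int.cast_natCast] at hx
      refine ⟨k, ?_, ?_⟩
      · have : (k : ℝ) ≤ W := by
          rw [hx]; exact mul_le_of_le_one_left (Nat.cast_nonneg W) hs.2
        have : k ≤ W := by exact_mod_cast this
        omega
      · rw [← hx] at e1 e2
        ext
        · have : (m.1 : ℤ) = a.1 + k * u.1.2 := by exact_mod_cast e1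
          simp [rot, this]
        · have : (m.2 : ℤ) = a.2 - k * u.1.1 := by exact_mod_cast e2
          simp [rot, this]; ring
    · rintro ⟨k, hk, rfl⟩
      have hk' : k ≤ W := by omega
      rcases Nat.eq_zero_or_pos W with h0 | h0
      · have : k = 0 := by omega
        subst this
        exact ⟨0, by simp, by simp⟩
      · have h0' : (0 : ℝ) < W := by exact_mod_cast h0
        refine ⟨k / W, ⟨by positivity, (div_le_one h0').2 (by exact_mod_cast hk')⟩, ?_⟩
        rw [toPlane_add, toPlane_zsmul, smul_smul]
        simp only [Int.cast_natCast]
        rw [div_mul_cancel₀ _ h0'.ne']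
  rw [latticeLength, hset, Set.ncard_coe_finset, Finset.card_image_of_injective, Finset.card_range]
  · simp
  · intro k l hkl
    have := smul_left_injective ℤ hp0 (add_left_cancel hkl)
    exact_mod_cast this

lemma mem_triangle {d : ℕ} {y : ℝ × ℝ} (h1 : 0 ≤ y.1) (h2 : 0 ≤ y.2) (h3 : y.1 + y.2 ≤ d) :
    y ∈ triangle d := by
  rw [triangle, mem_convexHull_iff]
  intro t ht hc
  have m1 : ((0 : ℝ), (0 : ℝ)) ∈ t := ht (by simp)
  have m2 : ((d : ℝ), (0 : ℝ)) ∈ t := ht (by simp)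
  have m3 : ((0 : ℝ), (d : ℝ)) ∈ t := ht (by simp)
  rcases Nat.eq_zero_or_pos d with h0 | h0
  · rw [h0, Nat.cast_zero] at h3
    have : y = (0, 0) := Prod.ext (by simp; linarith) (by simp; linarith)
    rw [this]; exact m1
  · have h0' : (0 : ℝ) < d := by exact_mod_cast h0
    have := hc.sum_mem (t := Finset.univ) (w := ![1 - y.1 / d - y.2 / d, y.1 / d, y.2 / d])
      (z := ![((0 : ℝ), (0 : ℝ)), ((d : ℝ), (0 : ℝ)), ((0 : ℝ), (d : ℝ))])
      (by
        have h5 : y.1 / d + y.2 / d ≤ 1 := by rw [← add_div, div_le_one h0']; exact h3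
        intro i _
        fin_cases i
        · simp; linarith
        · simp; positivity
        · simp; positivity)
      (by simp only [Fin.sum_univ_three, Matrix.cons_val]; ring)
      (by intro i _; fin_cases i <;> simpa)
    simp only [Fin.sum_univ_three] at this
    convert this using 1
    ext <;> simp [div_mul_cancel₀ _ h0'.ne']

lemma vertices_mem_triangle (d : ℕ) : ((0 : ℝ), (0 : ℝ)) ∈ triangle d ∧
    ((d : ℝ), (0 : ℝ)) ∈ triangle d ∧ ((0 : ℝ), (d : ℝ)) ∈ triangle d :=
  ⟨mem_triangle (by simp) (by simp) (by simp), mem_triangle (by simp) (by simp) (by simp),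
    mem_triangle (by simp) (by simp) (by simp)⟩

/-- A primitive `u` that is maximal on the triangle at two distinct lattice points is one of the end
directions, and the vanishing coordinate of `a` is the corresponding ray count. -/
lemma boundary_edge {d : ℕ} {u : Normal} {a b : ℤ × ℤ} {W : ℕ} (hW : 0 < W)
    (hab : b = a + (W : ℤ) • rot u.1) (a1 : 0 ≤ a.1) (a2 : 0 ≤ a.2) (a3 : a.1 + a.2 ≤ d)
    (b1 : 0 ≤ b.1) (b2 : 0 ≤ b.2) (b3 : b.1 + b.2 ≤ d)
    (ha : toPlane a ∈ face (triangle d) u) (hb : toPlane b ∈ face (triangle d) u) :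
    (u.1 = (-1, 0) ∧ a.1 = 0) ∨ (u.1 = (0, -1) ∧ a.2 = 0) ∨ (u.1 = (1, 1) ∧ a.1 + a.2 = d) := by
  obtain ⟨v1, v2, v3⟩ := vertices_mem_triangle d
  have key : ∀ c : ℤ × ℤ, toPlane c ∈ face (triangle d) u → 0 ≤ u.1.1 * c.1 + u.1.2 * c.2 ∧
      u.1.1 * d ≤ u.1.1 * c.1 + u.1.2 * c.2 ∧ u.1.2 * d ≤ u.1.1 * c.1 + u.1.2 * c.2 := by
    intro c hc
    have k1 := hc.2 _ v1
    have k2 := hc.2 _ v2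
    have k3 := hc.2 _ v3
    simp only [dot, toPlane, mul_zero, add_zero, zero_add] at k1 k2 k3
    exact ⟨by exact_mod_cast k1, by exact_mod_cast k2, by exact_mod_cast k3⟩
  obtain ⟨p1, p2, p3⟩ := key a ha
  obtain ⟨q1, q2, q3⟩ := key b hb
  have e1 : b.1 = a.1 + W * u.1.2 := by rw [hab]; simp [rot]
  have e2 : b.2 = a.2 - W * u.1.1 := by rw [hab]; simp [rot]; ring
  have hW' : (0 : ℤ) < W := by exact_mod_cast hW
  have hu := u.2
  obtain ⟨⟨x, y⟩, hxy⟩ := u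
  simp only at *
  -- With `m = max 0 x y` the maximum of `u` on the triangle is `m * d`. At a point `c` attaining it
  -- the nonnegative numbers `(m - x) * c.1`, `(m - y) * c.2` and `m * (d - c.1 - c.2)` have sum
  -- zero.
  obtain ⟨m, hm0, hmx, hmy, hmc⟩ : ∃ m : ℤ, 0 ≤ m ∧ x ≤ m ∧ y ≤ m ∧ (m = 0 ∨ m = x ∨ m = y) := by
    rcases le_total x y with h | h
    · rcases le_total 0 y with h' | h'
      · exact ⟨y, h', h, le_rfl, by simp⟩
      · exact ⟨0, le_rfl, by omega, h', by simp⟩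
    · rcases le_total 0 x with h' | h'
      · exact ⟨x, h', le_rfl, h, by simp⟩
      · exact ⟨0, le_rfl, h', by omega, by simp⟩
  have ka : m * d ≤ x * a.1 + y * a.2 := by
    rcases hmc with rfl | rfl | rfl
    · simpa using p1
    · exact p2
    · exact p3
  have kb : m * d ≤ x * b.1 + y * b.2 := by
    rcases hmc with rfl | rfl | rfl
    · simpa using q1
    · exact q2
    · exact q3
  have zero : ∀ c : ℤ × ℤ, 0 ≤ c.1 → 0 ≤ c.2 → c.1 + c.2 ≤ d → m * d ≤ x * c.1 + y * c.2 →
      (m - x) * c.1 = 0 ∧ (m - y) * c.2 = 0 ∧ m * (d - c.1 - c.2) = 0 := by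
    intro c c1 c2 c3 hc
    have t1 := mul_nonneg (sub_nonneg.2 hmx) c1
    have t2 := mul_nonneg (sub_nonneg.2 hmy) c2
    have t3 : 0 ≤ m * (d - c.1 - c.2) := mul_nonneg hm0 (by linarith)
    have : (m - x) * c.1 + (m - y) * c.2 + m * (d - c.1 - c.2) ≤ 0 := by nlinarith
    exact ⟨by linarith, by linarith, by linarith⟩
  obtain ⟨za1, za2, za3⟩ := zero a a1 a2 a3 ka
  obtain ⟨zb1, zb2, zb3⟩ := zero b b1 b2 b3 kb
  rcases eq_or_lt_of_le hmx with hx | hx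
  · rcases eq_or_lt_of_le hmy with hy | hy
    · right; right
      have hxy' : x = y := by omega
      subst hxy'
      simp only [Int.gcd_self] at hxy
      have hx1 : x = 1 := by omega
      refine ⟨by rw [hx1], ?_⟩
      rw [← hx, hx1] at za3
      omega
    · right; left
      have r1 : a.2 = 0 := (mul_eq_zero.1 za2).resolve_left (by omega)
      have r2 : b.2 = 0 := (mul_eq_zero.1 zb2).resolve_left (by omega)
      rw [r1, r2] at e2
      have hx0 : x = 0 := by
        have : (W : ℤ) * x = 0 := by linarith
        exact (mul_eq_zero.1 this).resolve_left hW'.ne'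
      subst hx0
      simp only [Int.gcd_zero_left] at hxy
      have : y = -1 := by omega
      exact ⟨by rw [this], r1⟩
  · left
    have r1 : a.1 = 0 := (mul_eq_zero.1 za1).resolve_left (by omega)
    have r2 : b.1 = 0 := (mul_eq_zero.1 zb1).resolve_left (by omega)
    rw [r1, r2] at e1
    have hy0 : y = 0 := by
      have : (W : ℤ) * y = 0 := by linarith
      exact (mul_eq_zero.1 this).resolve_left hW'.ne'
    subst hy0
    simp only [Int.gcd_zero_right] at hxy
    have : x = -1 := by
      rcases hmc with rfl | rfl | rfl <;> omega
    exact ⟨by rw [this], r1⟩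

/-! ### Labels and exponents at the marked points -/

namespace OnLine

variable {d n : ℕ} {r : Fin n → ℕ} {ε c : ℝ} {T : CombType d n} {C : Curve T}
  (H : OnLine r ε c C)
include H

open scoped Classical in
/-- The edges at the `i`-th marked vertex in direction `u`. -/
def edgesAt (C : Curve T) (i : Fin n) (u : Normal) : Finset T.Edge :=
  (T.star (T.mark i)).filter fun e => normalOf (C.outDir (T.mark i) e) = u

omit H in
lemma mem_edgesAt {i : Fin n} {u : Normal} {e : T.Edge} : e ∈ edgesAt C i u ↔
    T.Incident (T.mark i) e ∧ normalOf (C.outDir (T.mark i) e) = u := by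
  classical
  rw [edgesAt, Finset.mem_filter, CombType.mem_star]

open scoped Classical in
lemma filter_parallel_eq (i : Fin n) (u : Normal) : ((T.star (T.mark i)).filter fun e =>
    cross (toPlane u.1) (toPlane (C.outDir (T.mark i) e)) = 0 ∧
      0 < dot (toPlane u.1) (toPlane (C.outDir (T.mark i) e))) = edgesAt C i u := by
  refine Finset.filter_congr fun e he => ?_
  exact parallel_iff_normalOf (H.outDir_ne_zero (CombType.mem_star.1 he))

lemma outDir_eq_weight_smul {i : Fin n} {u : Normal} {e : T.Edge} (he : e ∈ edgesAt C i u) :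
    C.outDir (T.mark i) e = (C.weight e : ℤ) • u.1 := by
  obtain ⟨h1, rfl⟩ := mem_edgesAt.1 he
  rw [C.weight_eq h1]
  exact eq_gcd_smul_normalOf (H.outDir_ne_zero h1)

lemma weight_pos (e : T.Edge) : 0 < C.weight e := gcd_pos_of_ne_zero (H.edgeDir_ne_zero e)

lemma label_eq (i : Fin n) (u : Normal) :
    (C.dualMarkedPolygons i).label u = (edgesAt C i u).val.map C.weight := by
  obtain ⟨δ, R⟩ := H.exists_isRadius i
  have := H.imageLabel_eq R u
  rw [H.filter_parallel_eq] at this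
  exact this

lemma label_sum (i : Fin n) (u : Normal) :
    ((C.dualMarkedPolygons i).label u).sum = ∑ e ∈ edgesAt C i u, C.weight e := by
  rw [H.label_eq]; rfl

lemma sum_rot_edgesAt (i : Fin n) (u : Normal) :
    ∑ e ∈ edgesAt C i u, rot (C.outDir (T.mark i) e) =
      (((C.dualMarkedPolygons i).label u).sum : ℤ) • rot u.1 := by
  rw [H.label_sum, Nat.cast_sum, Finset.sum_smul]
  refine Finset.sum_congr rfl fun e he => ?_
  rw [H.outDir_eq_weight_smul he, map_zsmul]

lemma label_pos (i : Fin n) (u : Normal) : ∀ a ∈ (C.dualMarkedPolygons i).label u, 0 < a := by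
  intro a ha
  rw [H.label_eq, Multiset.mem_map] at ha
  obtain ⟨e, -, rfl⟩ := ha
  exact H.weight_pos e

lemma label_sum_pos_iff (i : Fin n) (u : Normal) :
    0 < ((C.dualMarkedPolygons i).label u).sum ↔ (edgesAt C i u).Nonempty := by
  rw [H.label_sum]
  constructor
  · intro h
    rw [Finset.nonempty_iff_ne_empty]
    intro h0
    simp [h0] at h
  · exact fun h => Finset.sum_pos (fun e _ => H.weight_pos e) h

/-- The star of the marked vertex is partitioned by the directions of its edges. -/
lemma size_eq (i : Fin n) :
    ∑ᶠ u, Multiset.card ((C.dualMarkedPolygons i).label u) = r i + 2 := by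
  classical
  have hcard : ∀ u, Multiset.card ((C.dualMarkedPolygons i).label u) = (edgesAt C i u).card := by
    intro u; rw [H.label_eq, Multiset.card_map]; rfl
  simp only [hcard]
  rw [finsum_eq_sum_of_support_subset (s := (T.star (T.mark i)).image fun e =>
    normalOf (C.outDir (T.mark i) e)), ← H.card_star_mark i,
    Finset.card_eq_sum_card_image fun e => normalOf (C.outDir (T.mark i) e)]
  · refine Finset.sum_congr rfl fun u _ => ?_
    rw [edgesAt]
  · intro u hu
    rw [Function.mem_support, Finset.card_ne_zero] at hu
    obtain ⟨e, he⟩ := hu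
    obtain ⟨h1, h2⟩ := mem_edgesAt.1 he
    exact Finset.mem_coe.2 (Finset.mem_image.2 ⟨e, CombType.mem_star.2 h1, h2⟩)

variable {i : Fin n} {δ : ℝ} (R : C.IsRadius (T.mark i) δ)
include R

/-- Both coordinates and their difference from `d` are ray counts. For the last one the point is
moved until its diagonal avoids the vertices. -/
lemma exponent_nonneg_le {v : ℝ × ℝ} (hv : v ∈ C.offFan (T.mark i) δ) :
    0 ≤ (C.exponent (C.pos (T.mark i) + v)).1 ∧ 0 ≤ (C.exponent (C.pos (T.mark i) + v)).2 ∧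
    (C.exponent (C.pos (T.mark i) + v)).1 + (C.exponent (C.pos (T.mark i) + v)).2 ≤ d := by
  classical
  obtain ⟨w, hw, hwv, hne⟩ := H.exists_near_point R hv (Finset.univ.image fun a : T.Vert =>
    (((1, 1) : ℝ × ℝ), cross (1, 1) (C.pos a - C.pos (T.mark i)))) (by simp)
  have hav : C.AvoidsVertices (1, 1) (C.pos (T.mark i) + w) := by
    intro a h0
    refine hne _ (Finset.mem_image_of_mem _ (Finset.mem_univ a)) ?_
    rw [← sub_sub, cross_sub_right, sub_eq_zero] at h0
    simpa [toPlane] using h0.symm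
  have hs := Curve.rayCount_sum (H.generic_of_mem R hw) hav
  rw [← hwv, Curve.exponent_eq]
  have k1 := Curve.rayCount_nonneg (C := C) (-1, 0) (C.pos (T.mark i) + w)
  have k2 := Curve.rayCount_nonneg (C := C) (0, -1) (C.pos (T.mark i) + w)
  have k3 := Curve.rayCount_nonneg (C := C) (1, 1) (C.pos (T.mark i) + w)
  exact ⟨k1, k2, by simp only; linarith⟩

lemma exponent_mem_triangle {v : ℝ × ℝ} (hv : v ∈ C.offFan (T.mark i) δ) :
    toPlane (C.exponent (C.pos (T.mark i) + v)) ∈ triangle d := by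
  obtain ⟨h1, h2, h3⟩ := H.exponent_nonneg_le R hv
  exact mem_triangle (by simpa [toPlane] using h1) (by simpa [toPlane] using h2)
    (by simp only [toPlane]; exact_mod_cast h3)

end OnLine

/-! ### Edges of the polygons on the boundary of the triangle -/

lemma Curve.edge_unique {d n : ℕ} {T : CombType d n} {v w : T.Vert} {e e' : T.Edge} (hne : v ≠ w)
    (h1 : T.Incident v e) (h2 : T.Incident w e) (h3 : T.Incident v e') (h4 : T.Incident w e') :
    e = e' := by
  rcases e with ⟨⟨a, b⟩, p1, p2⟩ | a
  · rcases e' with ⟨⟨a', b'⟩, p1', p2'⟩ | a'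
    · simp only [CombType.Incident] at h1 h2 h3 h4
      have : a = a' ∧ b = b' := by
        simp only at p1 p1'
        rcases h1 with rfl | rfl <;> rcases h3 with rfl | rfl
        · exact ⟨rfl, (h2.resolve_left hne).trans (h4.resolve_left hne).symm⟩
        · have e1 := h2.resolve_left hne
          have e2 := h4.resolve_right hne
          subst e1; subst e2
          exact absurd p1 p1'.not_gt
        · have e1 := h2.resolve_right hne
          have e2 := h4.resolve_left hne
          subst e1; subst e2
          exact absurd p1 p1'.not_gt
        · exact ⟨(h2.resolve_right hne).trans (h4.resolve_right hne).symm, rfl⟩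
      obtain ⟨rfl, rfl⟩ := this
      rfl
    · exact absurd ((show T.endAt a' = v from h3).symm.trans h4) hne
  · exact absurd ((show T.endAt a = v from h1).symm.trans h2) hne

namespace OnLine

variable {d n : ℕ} {r : Fin n → ℕ} {ε c : ℝ} {T : CombType d n} {C : Curve T}
  (H : OnLine r ε c C)
include H

lemma height_on_ray {i : Fin n} {u : Normal} {w : T.Vert} {τ : ℝ}
    (hw : C.pos w = C.pos (T.mark i) + τ • toPlane u.1) :
    height ε (C.pos w) = c + τ * height ε (toPlane u.1) := by
  rw [hw, height_add_smul, H.height_mark]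

/-- If all edges at the vertices on a ray starting at a marked point are parallel to the ray, then
there are no such vertices. -/
lemma no_vertex_on_ray {i : Fin n} {u : Normal} (hpar : ∀ w, ∀ τ : ℝ, 0 < τ →
    C.pos w = C.pos (T.mark i) + τ • toPlane u.1 → ∀ e, T.Incident w e →
      cross (toPlane u.1) (toPlane (C.outDir w e)) = 0) (w : T.Vert) (τ : ℝ) (hτ : 0 < τ) :
    C.pos w ≠ C.pos (T.mark i) + τ • toPlane u.1 := by
  classical
  have hu : toPlane u.1 ≠ 0 := toPlane_ne_zero.2 u.ne_zero
  have hhu : height ε (toPlane u.1) ≠ 0 := dot_irrational_ne_zero H.irr u.ne_zero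
  have hd := dot_self_pos hu
  intro hw
  set S := Finset.univ.filter fun w : T.Vert =>
    ∃ τ : ℝ, 0 < τ ∧ C.pos w = C.pos (T.mark i) + τ • toPlane u.1
  obtain ⟨w, hwS, hmin⟩ := S.exists_min_image
    (fun w => dot (toPlane u.1) (C.pos w - C.pos (T.mark i)))
    ⟨w, Finset.mem_filter.2 ⟨Finset.mem_univ _, τ, hτ, hw⟩⟩
  obtain ⟨-, τ, hτ, hw⟩ := Finset.mem_filter.1 hwS
  have hval : ∀ w' : T.Vert, ∀ τ' : ℝ, C.pos w' = C.pos (T.mark i) + τ' • toPlane u.1 →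
      dot (toPlane u.1) (C.pos w' - C.pos (T.mark i)) = τ' * dot (toPlane u.1) (toPlane u.1) := by
    intro w' τ' h
    rw [h, add_sub_cancel_left, ← dotLin_apply, map_smul]; rfl
  have hle : ∀ w' : T.Vert, ∀ τ' : ℝ, C.pos w' = C.pos (T.mark i) + τ' • toPlane u.1 →
      0 < τ' → τ ≤ τ' := by
    intro w' τ' h h0
    have := hmin w' (Finset.mem_filter.2 ⟨Finset.mem_univ _, τ', h0, h⟩)
    rw [hval w τ hw, hval w' τ' h] at this
    exact le_of_mul_le_mul_right this hd
  have hwh := H.height_on_ray hw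
  have hwm : w ∉ range T.mark := by
    rintro ⟨j, rfl⟩
    rw [H.height_mark] at hwh
    exact mul_ne_zero hτ.ne' hhu (by linarith)
  have hmul : ∀ e, T.Incident w e → ∃ k : ℝ, k ≠ 0 ∧ toPlane (C.outDir w e) = k • toPlane u.1 := by
    intro e he
    obtain ⟨k, hk⟩ := exists_smul_of_cross_eq_zero hu (hpar w τ hτ hw e he)
    refine ⟨k, ?_, hk⟩
    rintro rfl
    rw [zero_smul] at hk
    exact toPlane_ne_zero.2 (H.outDir_ne_zero he) hk
  have hsm : ∀ k : ℝ, height ε (k • toPlane u.1) = k * height ε (toPlane u.1) := by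
    intro k; simp [height, dot]; ring
  -- An edge not leading away points back towards the marked point. Without marked endpoint it would
  -- lead away from its other endpoint, which by minimality of `w` lies beyond the line, and from
  -- there the edge returns to the line. So it ends at a marked vertex, necessarily at `P_i`.
  have hback : ∀ e, T.Incident w e → ¬ C.Away ε c w e → T.Incident (T.mark i) e := by
    intro e he hna
    obtain ⟨k, hk0, hk⟩ := hmul e he
    have hkneg : k < 0 := by
      by_contra hk'
      have hkpos : 0 < k := lt_of_le_of_ne (not_lt.1 hk') hk0.symm
      apply hna
      refine ⟨hwm, he, fun h => ?_, fun h => ?_⟩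
      · rw [hk, hsm]
        rw [hwh] at h
        have : 0 < τ * height ε (toPlane u.1) := lt_of_le_of_ne (by linarith)
          (mul_ne_zero hτ.ne' hhu).symm
        exact mul_pos hkpos (pos_of_mul_pos_right this hτ.le)
      · rw [hk, hsm]
        rw [hwh] at h
        have h1 : τ * height ε (toPlane u.1) < 0 := by linarith
        have : height ε (toPlane u.1) < 0 := by
          by_contra h2
          have := mul_nonneg hτ.le (not_lt.1 h2)
          linarith
        exact mul_neg_of_pos_of_neg hkpos this
    have hother : ∀ w', w ≠ w' → T.Incident w' e → ∃ τ' : ℝ, τ' < τ ∧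
        C.pos w' = C.pos (T.mark i) + τ' • toPlane u.1 ∧
        toPlane (C.outDir w' e) = (-k) • toPlane u.1 := by
      intro w' hne hw'
      obtain ⟨h1, L, hL, h2⟩ := C.opposite he hw' hne
      refine ⟨τ + L * k, by nlinarith, ?_, ?_⟩
      · rw [h2, hk, hw]; module
      · rw [h1, toPlane_neg, hk, neg_smul]
    by_cases hmark : ∀ v, T.Incident v e → v ∉ range T.mark
    · exfalso
      obtain ⟨w', haw⟩ := H.exists_away_edge hmark
      have hne : w ≠ w' := by rintro rfl; exact hna haw
      obtain ⟨τ', hlt, hpos, hout⟩ := hother w' hne haw.2.1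
      have hh := H.height_on_ray hpos
      have h1 := haw.2.2.1
      have h2 := haw.2.2.2
      rw [hout, hsm, hh] at h1 h2
      have hneg : τ' ≤ 0 := by
        by_contra h0
        have := hle w' τ' hpos (not_le.1 h0)
        linarith
      have hn0 := H.height_ne haw.1
      rw [hh] at hn0
      rcases lt_or_gt_of_ne hhu with h3 | h3
      · have h4 : 0 ≤ τ' * height ε (toPlane u.1) := mul_nonneg_of_nonpos_of_nonpos hneg h3.le
        have := h1 (by linarith)
        nlinarith
      · have h4 : τ' * height ε (toPlane u.1) ≤ 0 := mul_nonpos_of_nonpos_of_nonneg hneg h3.le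
        have := h2 (lt_of_le_of_ne (by linarith) hn0)
        nlinarith
    · push Not at hmark
      obtain ⟨v, hv, j, rfl⟩ := hmark
      obtain ⟨τ', hlt, hpos, hout⟩ := hother (T.mark j) (by rintro rfl; exact hwm ⟨j, rfl⟩) hv
      have hh := H.height_on_ray hpos
      rw [H.height_mark] at hh
      have : τ' = 0 := by
        have : τ' * height ε (toPlane u.1) = 0 := by linarith
        exact (mul_eq_zero.1 this).resolve_right hhu
      rw [this, zero_smul, add_zero] at hpos
      rwa [H.inj hpos] at hv
  obtain ⟨e₀, he₀⟩ := H.exists_away hwm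
  -- Of at least three edges at `w` only one leads away, so two distinct edges would join `w` to the
  -- marked vertex.
  have hcard : 1 < ((T.star w).erase e₀).card := by
    rw [Finset.card_erase_of_mem (CombType.mem_star.2 he₀.2.1)]
    have := three_le_card_star hwm
    omega
  obtain ⟨e₁, h1, e₂, h2, h12⟩ := Finset.one_lt_card.1 hcard
  rw [Finset.mem_erase, CombType.mem_star] at h1 h2
  have b1 := hback e₁ h1.2 fun h => h1.1 (H.away_unique_edge h he₀)
  have b2 := hback e₂ h2.2 fun h => h2.1 (H.away_unique_edge h he₀)
  exact h12 (Curve.edge_unique (by rintro rfl; exact hwm ⟨i, rfl⟩) h1.2 b1 h2.2 b2)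

omit H in
/-- If the curve does not meet the rays in direction `u` starting at points close to a marked
point, then the edges at the vertices on the ray in direction `u` are parallel to this ray. -/
lemma parallel_of_rayCount_eq_zero {i : Fin n} {u : Normal} {v : ℝ × ℝ}
    (huv : 0 < cross (toPlane u.1) v)
    (hv : ∀ᶠ t in 𝓝[>] (0 : ℝ), C.rayCount u.1 (C.pos (T.mark i) + t • v) = 0)
    (w : T.Vert) (τ : ℝ) (hτ : 0 < τ) (hw : C.pos w = C.pos (T.mark i) + τ • toPlane u.1)
    (e : T.Edge) (he : T.Incident w e) : cross (toPlane u.1) (toPlane (C.outDir w e)) = 0 := by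
  classical
  by_contra hne
  have hu : toPlane u.1 ≠ 0 := toPlane_ne_zero.2 u.ne_zero
  -- By balancing some edge at `w` leaves the ray on the side of `v`; it meets the slightly shifted
  -- rays.
  obtain ⟨e, hes, hpos⟩ := Finset.exists_pos_of_sum_zero_of_exists_nonzero
    (s := T.star w) (fun e => cross (toPlane u.1) (toPlane (C.outDir w e))) (by
      have := congrArg (crossLin (toPlane u.1)) (congrArg toPlane (C.sum_outDir w))
      rw [toPlane_sum, map_sum, toPlane_zero, map_zero] at this
      exact this) ⟨e, CombType.mem_star.2 he, hne⟩
  have he := CombType.mem_star.1 hes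
  set o := toPlane (C.outDir w e)
  set κ := cross (toPlane u.1) v / cross (toPlane u.1) o
  have hκ : 0 < κ := div_pos huv hpos
  -- `κ` is chosen so that `κ • o` and `v` have equal distance from the line of `u`. Then `C.pos w +
  -- (t * κ) • o` lies on the ray starting at `t • v` from the marked point.
  obtain ⟨θ, hθ⟩ := exists_smul_of_cross_eq_zero hu (o := κ • o - v) (by
    rw [cross_sub_right, cross_smul_right, div_mul_cancel₀ _ hpos.ne', sub_self])
  obtain ⟨L, hL, hsub, -⟩ := C.exists_openParam e
  have l1 : ∀ᶠ t in 𝓝[>] (0 : ℝ), t * κ < L := by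
    have : Tendsto (fun t : ℝ => t * κ) (𝓝[>] 0) (𝓝 0) := by
      have : Continuous fun t : ℝ => t * κ := by fun_prop
      simpa using (this.tendsto 0).mono_left nhdsWithin_le_nhds
    exact this.eventually_lt_const hL
  have l2 : ∀ᶠ t in 𝓝[>] (0 : ℝ), 0 < τ + t * θ := by
    have : Tendsto (fun t : ℝ => τ + t * θ) (𝓝[>] 0) (𝓝 τ) := by
      have : Continuous fun t : ℝ => τ + t * θ := by fun_prop
      simpa using (this.tendsto 0).mono_left nhdsWithin_le_nhds
    exact this.eventually_const_lt hτ
  obtain ⟨t, ⟨h0, h1⟩, h2, ht⟩ := ((hv.and l1).and (l2.and self_mem_nhdsWithin)).exists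
  have ht' : 0 < t := ht
  have hmeet : C.MeetsRay u.1 (C.pos (T.mark i) + t • v) e := by
    refine ⟨C.pos w + (t * κ) • o, ?_, τ + t * θ, h2, ?_⟩
    · rw [C.openEdge_eq he]
      exact ⟨t * κ, hsub ⟨by positivity, h1⟩, rfl⟩
    · rw [hw, add_smul, mul_smul, mul_smul, ← hθ]; module
  have hterm : 0 < |latticeCross u.1 (C.edgeDir e)| := by
    rw [abs_pos]
    intro hz
    have hz' : cross (toPlane u.1) (toPlane (C.edgeDir e)) = 0 := by
      rw [← cast_latticeCross, hz, Int.cast_zero]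
    rcases C.outDir_eq_or_neg he with h | h
    · simp only [o, h] at hpos
      linarith
    · simp only [o, h, toPlane_neg] at hpos
      rw [show -toPlane (C.edgeDir e) = (-1 : ℝ) • toPlane (C.edgeDir e) by module,
        cross_smul_right, hz'] at hpos
      linarith
  have := Finset.sum_pos' (s := Finset.univ.filter fun e =>
    C.MeetsRay u.1 (C.pos (T.mark i) + t • v) e)
    (f := fun e => |latticeCross u.1 (C.edgeDir e)|) (fun e _ => abs_nonneg _)
    ⟨e, Finset.mem_filter.2 ⟨Finset.mem_univ _, hmeet⟩, hterm⟩
  rw [Curve.rayCount] at h0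
  linarith

/-- A bounded edge in direction `u` would end in a vertex on the ray; an unbounded one has a
primitive direction. -/
lemma weight_eq_one_of_rayCount {i : Fin n} {u : Normal} {v : ℝ × ℝ}
    (huv : 0 < cross (toPlane u.1) v)
    (hv : ∀ᶠ t in 𝓝[>] (0 : ℝ), C.rayCount u.1 (C.pos (T.mark i) + t • v) = 0)
    {e : T.Edge} (he : e ∈ edgesAt C i u) : C.weight e = 1 := by
  have hno := H.no_vertex_on_ray (parallel_of_rayCount_eq_zero huv hv)
  have hout := H.outDir_eq_weight_smul he
  have hinc := (mem_edgesAt.1 he).1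
  have hother : ∀ w, T.Incident w e → T.mark i = w := by
    intro w hw
    by_contra hne
    obtain ⟨-, L, hL, h2⟩ := C.opposite hinc hw hne
    rw [hout, toPlane_zsmul, smul_smul] at h2
    refine hno w _ (mul_pos hL ?_) h2
    have := H.weight_pos e
    exact_mod_cast this
  rcases e with ⟨⟨a, b⟩, h1, h2⟩ | ⟨j, a⟩
  · exact absurd ((hother a (Or.inl rfl)).symm.trans (hother b (Or.inr rfl))) h1.ne
  · fin_cases j <;> simp [Curve.weight, Curve.edgeDir, endDir]

/-- Both ends of a face are exponents of points on the two sides of the ray in direction `u`. The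
set `F` keeps track of their position relative to further directions, later that of the line. -/
lemma exists_face_data (i : Fin n) {δ : ℝ} (R : C.IsRadius (T.mark i) δ) (u : Normal)
    (F : Finset (ℝ × ℝ)) (hF : ∀ f ∈ F, f ≠ 0) :
    ∃ vp ∈ C.offFan (T.mark i) δ, ∃ vm ∈ C.offFan (T.mark i) δ,
      0 < cross (toPlane u.1) vp ∧ cross (toPlane u.1) vm < 0 ∧
      NearTo (T.star (T.mark i)) (C.outDir (T.mark i)) (toPlane u.1) vp ∧
      NearTo (T.star (T.mark i)) (C.outDir (T.mark i)) (toPlane u.1) vm ∧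
      (∀ f ∈ F, (0 < cross (toPlane u.1) f → 0 < cross vp f) ∧
        (cross (toPlane u.1) f < 0 → cross vp f < 0)) ∧
      (∀ f ∈ F, (0 < cross (toPlane u.1) f → 0 < cross vm f) ∧
        (cross (toPlane u.1) f < 0 → cross vm f < 0)) ∧
      face (C.dualMarkedPolygons i).carrier u =
        segment ℝ (toPlane (C.exponent (C.pos (T.mark i) + vp)))
          (toPlane (C.exponent (C.pos (T.mark i) + vm))) ∧
      C.exponent (C.pos (T.mark i) + vm) = C.exponent (C.pos (T.mark i) + vp) +
        (((C.dualMarkedPolygons i).label u).sum : ℤ) • rot u.1 := by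
  classical
  have hfan := H.isLocalFan R
  have hu : toPlane u.1 ≠ 0 := toPlane_ne_zero.2 u.ne_zero
  obtain ⟨vp, hp, vm, hm, h1, h2, h3, h4, h5, h6, h7⟩ := hfan.exists_sides hu F hF
  refine ⟨vp, hp, vm, hm, h1, h2, h3, h4, h6, h7, ?_, ?_⟩
  · have := hfan.face_eq hp hm h1 h2 h3 h4 h5
    rw [← H.dualPolygon_eq R] at this
    exact this
  · have := hfan.right_eq_left hp hm h1 h2 h3 h4 h5
    rw [H.filter_parallel_eq, H.sum_rot_edgesAt] at this
    exact this

lemma partition (i : Fin n) (u : Normal) : IsPartitionOf ((C.dualMarkedPolygons i).label u)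
    (latticeLength (face (C.dualMarkedPolygons i).carrier u)) := by
  obtain ⟨δ, R⟩ := H.exists_isRadius i
  obtain ⟨vp, -, vm, -, -, -, -, -, -, -, h1, h2⟩ := H.exists_face_data i R u ∅ (by simp)
  rw [h1, h2, latticeLength_segment]
  exact ⟨H.label_pos i u, rfl⟩

/-- On a boundary edge of the triangle one of `i`, `j`, `d - i - j` vanishes, and this number is the
count of the curve on rays in direction `u` next to the marked point. -/
lemma outside_label (i : Fin n) (u : Normal)
    (hface : face (C.dualMarkedPolygons i).carrier u ⊆ face (triangle d) u) :
    ∀ a ∈ (C.dualMarkedPolygons i).label u, a = 1 := by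
  obtain ⟨δ, R⟩ := H.exists_isRadius i
  obtain ⟨vp, hp, vm, hm, h1, -, -, -, -, -, h2, h3⟩ := H.exists_face_data i R u ∅ (by simp)
  have hfan := H.isLocalFan R
  intro a ha
  rw [H.label_eq, Multiset.mem_map] at ha
  obtain ⟨e, he, rfl⟩ := ha
  have hW := (H.label_sum_pos_iff i u).2 ⟨e, he⟩
  rw [h2] at hface
  obtain ⟨a1, a2, a3⟩ := H.exponent_nonneg_le R hp
  obtain ⟨b1, b2, b3⟩ := H.exponent_nonneg_le R hm
  have hb := boundary_edge hW h3 a1 a2 a3 b1 b2 b3 (hface (left_mem_segment ℝ _ _))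
    (hface (right_mem_segment ℝ _ _))
  refine H.weight_eq_one_of_rayCount h1 ?_ he
  have hu : toPlane u.1 ≠ 0 := toPlane_ne_zero.2 u.ne_zero
  have hav : ∀ a : T.Vert, ∀ᶠ t in 𝓝[>] (0 : ℝ),
      cross (toPlane u.1) (C.pos a - (C.pos (T.mark i) + t • vp)) ≠ 0 := by
    intro a
    have hform : ∀ t : ℝ, cross (toPlane u.1) (C.pos a - (C.pos (T.mark i) + t • vp)) =
        cross (toPlane u.1) (C.pos a - C.pos (T.mark i)) - t * cross (toPlane u.1) vp := by
      intro t; rw [← sub_sub, cross_sub_right, cross_smul_right]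
    by_cases h0 : cross (toPlane u.1) (C.pos a - C.pos (T.mark i)) = 0
    · filter_upwards [self_mem_nhdsWithin] with t ht
      rw [hform, h0, zero_sub, neg_ne_zero]
      exact mul_ne_zero (ne_of_gt ht) h1.ne'
    · have ht : Tendsto (fun t : ℝ => cross (toPlane u.1) (C.pos a - C.pos (T.mark i)) -
          t * cross (toPlane u.1) vp) (𝓝[>] 0)
          (𝓝 (cross (toPlane u.1) (C.pos a - C.pos (T.mark i)))) := by
        have : Continuous fun t : ℝ => cross (toPlane u.1) (C.pos a - C.pos (T.mark i)) -
          t * cross (toPlane u.1) vp := by fun_prop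
        simpa using (this.tendsto 0).mono_left nhdsWithin_le_nhds
      filter_upwards [ht.eventually_ne h0] with t ht
      rwa [hform]
  filter_upwards [eventually_all.2 hav, self_mem_nhdsWithin,
    mem_nhdsWithin_of_mem_nhds (Iic_mem_nhds one_pos)] with t hav ht0 ht1
  obtain ⟨hX, hE⟩ := hfan.cone vp hp t ht0 ht1
  have hg := H.generic_of_mem R hX
  rw [← hE, Curve.exponent_eq] at hb
  rcases hb with ⟨hu1, hb⟩ | ⟨hu1, hb⟩ | ⟨hu1, hb⟩
  · rw [hu1]; exact hb
  · rw [hu1]; exact hb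
  · rw [hu1] at hav ⊢
    have := Curve.rayCount_sum hg hav
    simp only at hb
    linarith

end OnLine

/-! ### Construction of lattice paths -/

/-- Bookkeeping common to both paths: `E` indexes the steps, `key` orders them, `st x` is the step
vector and `a x` its starting point, obtained by adding the earlier steps to `(0, d)`. -/
lemma exists_path {d n : ℕ} {ε : ℝ} {Q : Fin n → LabelledPolygon} {side : Normal → Prop}
    (E : Finset (Fin n × Normal))
    (hE : ∀ x, x ∈ E ↔ side x.2 ∧ (face (Q x.1).carrier x.2).Nontrivial)
    {α : Type*} [LinearOrder α] (key : Fin n × Normal → α) (hkey : InjOn key E)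
    (hmono : ∀ x ∈ E, ∀ y ∈ E, key x ≤ key y → x.1 ≤ y.1)
    (st a : Fin n × Normal → ℤ × ℤ)
    (ha : ∀ x ∈ E, a x = (0, (d : ℤ)) + ∑ y ∈ E with key y < key x, st y)
    (hlam : ∀ x ∈ E, 0 < lam ε (toPlane (st x)))
    (hface : ∀ x ∈ E, face (Q x.1).carrier x.2 = segment ℝ (toPlane (a x)) (toPlane (a x + st x)))
    (htri : ∀ x ∈ E, toPlane (a x) ∈ triangle d)
    (htotal : (0, (d : ℤ)) + ∑ y ∈ E, st y = ((d : ℤ), 0))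
    (hpart : ∀ x ∈ E, IsPartitionOf ((Q x.1).label x.2)
      (latticeLength (face (Q x.1).carrier x.2))) :
    ∃ γ : LabelledPath d ε, IsFormedBy γ Q side := by
  classical
  set m := (E.image key).card with hm
  -- Enumerating the keys increasingly and lifting them to `E` gives the order of the steps.
  set f := (E.image key).orderEmbOfFin hm.symm with hf
  have hex : ∀ k, ∃ x ∈ E, key x = f k := fun k => by
    simpa using Finset.mem_image.1 (Finset.orderEmbOfFin_mem (E.image key) hm.symm k)
  choose σ hσE hσ using hex
  have hσinj : Function.Injective σ := by
    intro k l h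
    have : f k = f l := by rw [← hσ, ← hσ, h]
    exact f.injective this
  have hσsurj : ∀ x ∈ E, ∃ k, σ k = x := by
    intro x hx
    have : key x ∈ range f := by
      rw [hf, Finset.range_orderEmbOfFin]
      exact Finset.mem_coe.2 (Finset.mem_image_of_mem key hx)
    obtain ⟨k, hk⟩ := this
    exact ⟨k, hkey (hσE k) hx (by rw [hσ, hk])⟩
  have hlt : ∀ k l, key (σ k) < key (σ l) ↔ k < l := by
    intro k l
    rw [hσ, hσ, f.lt_iff_lt]
  set vertex : Fin (m + 1) → ℤ × ℤ := fun k =>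
    (0, (d : ℤ)) + ∑ l : Fin m with l.castSucc < k, st (σ l) with hvertex
  have hcast : ∀ k : Fin m, vertex k.castSucc = a (σ k) := by
    intro k
    rw [ha _ (hσE k), hvertex]
    simp only
    congr 1
    rw [← Finset.sum_image (s := Finset.univ.filter fun l : Fin m => l.castSucc < k.castSucc)
      (g := σ) (f := st) (fun _ _ _ _ h => hσinj h)]
    congr 1
    ext x
    simp only [Finset.mem_image, Finset.mem_filter, Finset.mem_univ, true_and,
      Fin.castSucc_lt_castSucc_iff]
    constructor
    · rintro ⟨l, hl, rfl⟩
      exact ⟨hσE l, (hlt l k).2 hl⟩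
    · rintro ⟨hx, hxk⟩
      obtain ⟨l, rfl⟩ := hσsurj x hx
      exact ⟨l, (hlt l k).1 hxk, rfl⟩
  have hsucc : ∀ k : Fin m, vertex k.succ = vertex k.castSucc + st (σ k) := by
    intro k
    simp only [hvertex]
    rw [add_assoc]
    congr 1
    have : (Finset.univ.filter fun l : Fin m => l.castSucc < k.succ) =
        insert k (Finset.univ.filter fun l : Fin m => l.castSucc < k.castSucc) := by
      ext l
      simp only [Finset.mem_filter, Finset.mem_univ, true_and, Finset.mem_insert, Fin.lt_def,
        Fin.val_castSucc, Fin.val_succ, Fin.ext_iff]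
      omega
    rw [this, Finset.sum_insert (by simp), add_comm]
  have hlast : vertex (Fin.last m) = ((d : ℤ), 0) := by
    rw [← htotal, hvertex]
    simp only
    congr 1
    rw [Finset.filter_true_of_mem (fun l _ => Fin.castSucc_lt_last l),
      ← Finset.sum_image (g := σ) (f := st) (fun _ _ _ _ h => hσinj h)]
    congr 1
    ext x
    simp only [Finset.mem_image, Finset.mem_univ, true_and]
    exact ⟨fun ⟨k, hk⟩ => hk ▸ hσE k, hσsurj x⟩
  have hfaceσ : ∀ k, face (Q (σ k).1).carrier (σ k).2 =
      segment ℝ (toPlane (vertex k.castSucc)) (toPlane (vertex k.succ)) := by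
    intro k
    rw [hface _ (hσE k), hsucc, hcast]
  refine ⟨⟨m, vertex, fun k => (Q (σ k).1).label (σ k).2, ?_, ?_, hlast, ?_, ?_⟩, σ, hσinj, ?_,
    hfaceσ, fun k => rfl, ?_⟩
  · intro k
    induction k using Fin.lastCases with
    | last =>
      rw [hlast]
      exact mem_triangle (by simp [toPlane]) (by simp [toPlane]) (by simp [toPlane])
    | cast k => rw [hcast]; exact htri _ (hσE k)
  · simp [hvertex]
  · rw [Fin.strictMono_iff_lt_succ]
    intro k
    change lam ε (toPlane (vertex k.castSucc)) < lam ε (toPlane (vertex k.succ))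
    rw [hsucc]
    generalize vertex k.castSucc = b
    rw [IsLocalFan.lam_add_eq]
    linarith [hlam _ (hσE k)]
  · intro k
    rw [← hfaceσ]
    exact hpart _ (hσE k)
  · ext x
    rw [mem_ofPred_eq, ← hE]
    exact ⟨fun ⟨k, hk⟩ => hk ▸ hσE k, hσsurj x⟩
  · intro k l hkl
    refine hmono _ (hσE k) _ (hσE l) ?_
    rw [hσ, hσ]
    exact f.monotone hkl

namespace OnLine

variable {d n : ℕ} {r : Fin n → ℕ} {ε c : ℝ} {T : CombType d n} {C : Curve T}
  (H : OnLine r ε c C)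
include H

/-! ### Exponents along the line -/

omit H in
lemma height_line (A : ℝ × ℝ) (s : ℝ) : height ε (A + s • ((1, -ε) : ℝ × ℝ)) = height ε A := by
  simp [height, dot]; ring

omit H in
lemma line_injective {A : ℝ × ℝ} {s s' : ℝ}
    (h : A + s • ((1, -ε) : ℝ × ℝ) = A + s' • ((1, -ε) : ℝ × ℝ)) : s = s' := by
  simpa using congrArg Prod.fst h

variable {A : ℝ × ℝ} {t : Fin n → ℝ}
  (hline : ∀ i, C.pos (T.mark i) = A + t i • ((1, -ε) : ℝ × ℝ))
include hline

/-- A piece of the line without marked points does not meet the curve, by `mem_line`. -/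
lemma exponent_line_eq (hA : height ε A = c) {s s' : ℝ}
    (hs : C.IsGenericPoint (A + s • ((1, -ε) : ℝ × ℝ)))
    (hs' : C.IsGenericPoint (A + s' • ((1, -ε) : ℝ × ℝ)))
    (hno : ∀ j, (t j < s ∧ t j < s') ∨ (s < t j ∧ s' < t j)) :
    C.exponent (A + s' • ((1, -ε) : ℝ × ℝ)) = C.exponent (A + s • ((1, -ε) : ℝ × ℝ)) := by
  refine Curve.exponent_eq_of_disjoint hs hs' ?_ H.pos_mem_image
  rintro _ ⟨a, b, ha, hb, hab, rfl⟩ himg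
  have heq : a • (A + s • ((1, -ε) : ℝ × ℝ)) + b • (A + s' • ((1, -ε) : ℝ × ℝ)) =
      A + (a * s + b * s') • ((1, -ε) : ℝ × ℝ) := by
    have : a • (A + s • ((1, -ε) : ℝ × ℝ)) + b • (A + s' • ((1, -ε) : ℝ × ℝ)) =
      (a + b) • A + (a * s + b * s') • ((1, -ε) : ℝ × ℝ) := by module
    rw [this, hab, one_smul]
  rw [heq] at himg
  obtain ⟨e, he⟩ := mem_iUnion.1 himg
  obtain ⟨j, -, hj⟩ := H.mem_line he (by rw [height_line, hA])
  rw [hline] at hj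
  have := line_injective hj
  obtain rfl : b = 1 - a := by linarith
  rcases hno j with ⟨h1, h2⟩ | ⟨h1, h2⟩
  · have h3 := (convex_Ioi (t j)) h1 h2 ha hb hab
    simp only [smul_eq_mul, mem_Ioi] at h3
    linarith
  · have h3 := (convex_Iio (t j)) h1 h2 ha hb hab
    simp only [smul_eq_mul, mem_Iio] at h3
    linarith

/-- Test points on the line beside each marked point: consecutive marked points share a region, and
the outermost regions have exponents `(0, d)` and `(d, 0)`. -/
lemma exists_chain (hA : height ε A = c) (hε : 0 < ε) (ht : StrictMono t) :
    ∃ δ tl tr : Fin n → ℝ, (∀ i, C.IsRadius (T.mark i) (δ i)) ∧ (∀ i, 0 < tl i) ∧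
      (∀ i, 0 < tr i) ∧ (∀ i, tl i • ((-1, ε) : ℝ × ℝ) ∈ C.offFan (T.mark i) (δ i)) ∧
      (∀ i, tr i • ((1, -ε) : ℝ × ℝ) ∈ C.offFan (T.mark i) (δ i)) ∧
      (∀ i : Fin n, i.val = 0 →
        C.exponent (C.pos (T.mark i) + tl i • ((-1, ε) : ℝ × ℝ)) = (0, (d : ℤ))) ∧
      (∀ i : Fin n, i.val + 1 = n →
        C.exponent (C.pos (T.mark i) + tr i • ((1, -ε) : ℝ × ℝ)) = ((d : ℤ), 0)) ∧
      ∀ i j : Fin n, i.val + 1 = j.val →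
        C.exponent (C.pos (T.mark j) + tl j • ((-1, ε) : ℝ × ℝ)) =
        C.exponent (C.pos (T.mark i) + tr i • ((1, -ε) : ℝ × ℝ)) := by
  have hR := fun i => H.exists_isRadius i
  choose δ R using hR
  choose tl htl hL using fun i => (H.isLocalFan (R i)).exists_leftDir H.irr
  choose tr htr hRt using fun i => (H.isLocalFan (R i)).exists_rightDir H.irr
  have eL : ∀ i, C.pos (T.mark i) + tl i • ((-1, ε) : ℝ × ℝ) =
      A + (t i - tl i) • ((1, -ε) : ℝ × ℝ) := by
    intro i; rw [hline]; ext <;> simp <;> ring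
  have eR : ∀ i, C.pos (T.mark i) + tr i • ((1, -ε) : ℝ × ℝ) =
      A + (t i + tr i) • ((1, -ε) : ℝ × ℝ) := by
    intro i; rw [hline]; ext <;> simp <;> ring
  have hn0 : 0 < ‖((1, -ε) : ℝ × ℝ)‖ := norm_pos_iff.2 (by simp)
  -- A radius does not exceed the distance to another marked vertex, so the test points stay between
  -- neighbouring marked points.
  have hdist : ∀ i j, i ≠ j → δ i ≤ |t j - t i| * ‖((1, -ε) : ℝ × ℝ)‖ := by
    intro i j hij
    have := (R i).vertex (T.mark j) fun h => hij (H.mark_inj h).symm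
    rwa [hline, hline, add_sub_add_left_eq_sub, ← sub_smul, norm_smul, Real.norm_eq_abs] at this
  have bL : ∀ i j, i ≠ j → tl i < |t j - t i| := by
    intro i j hij
    have h1 := (hL i).1
    rw [show ((-1, ε) : ℝ × ℝ) = -(1, -ε) by simp, smul_neg, norm_neg, norm_smul,
      Real.norm_of_nonneg (htl i).le] at h1
    exact lt_of_mul_lt_mul_right (h1.trans_le (hdist i j hij)) hn0.le
  have bR : ∀ i j, i ≠ j → tr i < |t j - t i| := by
    intro i j hij
    have h1 := (hRt i).1
    rw [norm_smul, Real.norm_of_nonneg (htr i).le] at h1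
    exact lt_of_mul_lt_mul_right (h1.trans_le (hdist i j hij)) hn0.le
  have gL : ∀ i, C.IsGenericPoint (A + (t i - tl i) • ((1, -ε) : ℝ × ℝ)) := by
    intro i; rw [← eL]; exact H.generic_of_mem (R i) (hL i)
  have gR : ∀ i, C.IsGenericPoint (A + (t i + tr i) • ((1, -ε) : ℝ × ℝ)) := by
    intro i; rw [← eR]; exact H.generic_of_mem (R i) (hRt i)
  have cL : ∀ i j, j < i → t j < t i - tl i := by
    intro i j hij
    have h1 := bL i j hij.ne'
    have h2 := ht hij
    rw [abs_of_neg (by linarith)] at h1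
    linarith
  have cR : ∀ i j, i < j → t i + tr i < t j := by
    intro i j hij
    have h1 := bR i j hij.ne
    have h2 := ht hij
    rw [abs_of_pos (by linarith)] at h1
    linarith
  refine ⟨δ, tl, tr, R, htl, htr, hL, hRt, ?_, ?_, ?_⟩
  · intro i hi
    obtain ⟨s, h1, h2⟩ : ∃ s, C.FarLeft (A + s • ((1, -ε) : ℝ × ℝ)) ∧ s < t i := by
      -- Since `ε > 0`, the line of direction `(1, -ε)` runs to the upper left.
      have h1 : ∀ v, ∀ᶠ s : ℝ in atBot, A.1 + s < (C.pos v).1 ∧ (C.pos v).2 < A.2 + s * -ε := by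
        intro v
        have a1 : Tendsto (fun s : ℝ => A.1 + s) atBot atBot :=
          tendsto_atBot_add_const_left _ _ tendsto_id
        have a2 : Tendsto (fun s : ℝ => A.2 + s * -ε) atBot atTop :=
          tendsto_atTop_add_const_left _ _ (tendsto_id.atBot_mul_const_of_neg (by linarith))
        exact (a1.eventually_lt_atBot _).and (a2.eventually_gt_atTop _)
      obtain ⟨s, hs, hs'⟩ := ((eventually_all.2 h1).and (eventually_lt_atBot (t i))).exists
      exact ⟨s, fun v => by simpa using hs v, hs'⟩
    rw [eL, H.exponent_line_eq hline hA h1.generic (gL i), h1.exponent]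
    intro j
    right
    have hij : i ≤ j := by rw [Fin.le_def]; omega
    have := ht.monotone hij
    have := htl i
    constructor <;> linarith
  · intro i hi
    obtain ⟨s, h1, h2⟩ : ∃ s, C.FarRight (A + s • ((1, -ε) : ℝ × ℝ)) ∧ t i < s := by
      have h1 : ∀ v, ∀ᶠ s : ℝ in atTop, (C.pos v).1 < A.1 + s ∧ A.2 + s * -ε < (C.pos v).2 := by
        intro v
        have a1 : Tendsto (fun s : ℝ => A.1 + s) atTop atTop :=
          tendsto_atTop_add_const_left _ _ tendsto_id
        have a2 : Tendsto (fun s : ℝ => A.2 + s * -ε) atTop atBot :=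
          tendsto_atBot_add_const_left _ _ (tendsto_id.atTop_mul_const_of_neg (by linarith))
        exact (a1.eventually_gt_atTop _).and (a2.eventually_lt_atBot _)
      obtain ⟨s, hs, hs'⟩ := ((eventually_all.2 h1).and (eventually_gt_atTop (t i))).exists
      exact ⟨s, fun v => by simpa using hs v, hs'⟩
    rw [eR, H.exponent_line_eq hline hA h1.generic (gR i), h1.exponent]
    intro j
    left
    have hij : j ≤ i := by rw [Fin.le_def]; omega
    have := ht.monotone hij
    have := htr i
    constructor <;> linarith
  · intro i j hij
    rw [eL, eR]
    refine H.exponent_line_eq hline hA (gR i) (gL j) fun k => ?_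
    have hij' : i < j := by rw [Fin.lt_def]; omega
    have p1 := htr i
    have p2 := htl j
    have p3 := cL j i hij'
    have p4 := cR i j hij'
    by_cases hk : k ≤ i
    · left
      have := ht.monotone hk
      constructor <;> linarith
    · right
      have hk' : j ≤ k := by rw [Fin.le_def] at hk ⊢; omega
      have := ht.monotone hk'
      constructor <;> linarith

end OnLine

/-! ### The order of directions in a half plane -/

/-- The slope of a vector relative to the line of direction `(1, -ε)`, with the normal direction
oriented by the sign `s`. -/
def relSlope (ε : ℝ) (s : ℤ) (u : ℝ × ℝ) : ℝ := dot (1, -ε) u / (s * height ε u)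

lemma relSlope_lt_iff {ε : ℝ} {s : ℤ} {u o : ℝ × ℝ} (hu : 0 < s * height ε u)
    (ho : 0 < s * height ε o) : relSlope ε s o < relSlope ε s u ↔ 0 < s * cross u o := by
  rw [relSlope, relSlope, div_lt_div_iff₀ ho hu, ← sub_pos]
  -- The vectors `(1, -ε)` and `(ε, 1)` are orthogonal of equal length, so their coordinates compute
  -- the determinant up to the factor `1 + ε ^ 2`.
  have : dot (1, -ε) u * (s * height ε o) - dot (1, -ε) o * (s * height ε u) =
      (1 + ε ^ 2) * (s * cross u o) := by
    simp only [dot, height, cross]; ring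
  rw [this, mul_pos_iff_of_pos_left (by positivity)]

lemma height_smul (ε k : ℝ) (u : ℝ × ℝ) : height ε (k • u) = k * height ε u := by
  simp [height, dot]; ring

lemma normalOf_self (u : Normal) : normalOf u.1 = u :=
  (parallel_iff_normalOf u.ne_zero).1
    ⟨cross_self _, dot_self_pos (toPlane_ne_zero.2 u.ne_zero)⟩

/-- Parallel vectors in a half plane are positive multiples of each other. -/
lemma exists_pos_smul {ε : ℝ} {s : ℤ} {u o : ℝ × ℝ} (hu : 0 < s * height ε u)
    (ho : 0 < s * height ε o) (h0 : cross u o = 0) : ∃ k : ℝ, 0 < k ∧ o = k • u := by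
  have hne : u ≠ 0 := by rintro rfl; simp [height, dot] at hu
  obtain ⟨k, rfl⟩ := exists_smul_of_cross_eq_zero hne h0
  refine ⟨k, ?_, rfl⟩
  rw [height_smul, mul_left_comm] at ho
  exact pos_of_mul_pos_left ho hu.le

lemma relSlope_injOn {ε : ℝ} {s : ℤ} {u w : Normal} (hu : 0 < s * height ε (toPlane u.1))
    (hw : 0 < s * height ε (toPlane w.1))
    (h : relSlope ε s (toPlane u.1) = relSlope ε s (toPlane w.1)) : u = w := by
  have hs : (s : ℝ) ≠ 0 := by rintro h0; simp [h0] at hu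
  have h1 : ¬ 0 < s * cross (toPlane u.1) (toPlane w.1) := by
    rw [← relSlope_lt_iff hu hw]; exact h.not_gt
  have h2 : ¬ 0 < s * cross (toPlane w.1) (toPlane u.1) := by
    rw [← relSlope_lt_iff hw hu]; exact h.not_lt
  rw [cross_swap] at h2
  have h3 : (s : ℝ) * cross (toPlane u.1) (toPlane w.1) = 0 := by linarith
  have h4 := (mul_eq_zero.1 h3).resolve_left hs
  obtain ⟨k, hk, hw'⟩ := exists_pos_smul hu hw h4
  rw [← normalOf_self w]
  refine ((parallel_iff_normalOf w.ne_zero).1 ⟨h4, ?_⟩).symm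
  rw [hw', ← dotLin_apply, map_smul, dotLin_apply]
  exact mul_pos hk (dot_self_pos (toPlane_ne_zero.2 u.ne_zero))

namespace OnLine

variable {d n : ℕ} {r : Fin n → ℕ} {ε c : ℝ} {T : CombType d n} {C : Curve T}
  (H : OnLine r ε c C)
include H

lemma normalOf_side {i : Fin n} {e : T.Edge} (he : T.Incident (T.mark i) e) (s : ℤ) :
    0 < s * height ε (toPlane (normalOf (C.outDir (T.mark i) e)).1) ↔
      0 < s * height ε (toPlane (C.outDir (T.mark i) e)) := by
  have h1 := H.outDir_eq_weight_smul (mem_edgesAt.2 ⟨he, rfl⟩)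
  conv_rhs => rw [h1, toPlane_zsmul, height_smul, mul_left_comm]
  exact (mul_pos_iff_of_pos_left (by exact_mod_cast H.weight_pos e)).symm

lemma normalOf_cross {i : Fin n} {e : T.Edge} (he : T.Incident (T.mark i) e) (s : ℤ) (u : ℝ × ℝ) :
    0 < s * cross u (toPlane (normalOf (C.outDir (T.mark i) e)).1) ↔
      0 < s * cross u (toPlane (C.outDir (T.mark i) e)) := by
  have h1 := H.outDir_eq_weight_smul (mem_edgesAt.2 ⟨he, rfl⟩)
  conv_rhs => rw [h1, toPlane_zsmul, cross_smul_right, mul_left_comm]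
  exact (mul_pos_iff_of_pos_left (by exact_mod_cast H.weight_pos e)).symm

open scoped Classical in
/-- The faces of the polygon of a marked point with normal vectors in a half plane. -/
lemma exists_side_face {i : Fin n} {δ tl : ℝ} (R : C.IsRadius (T.mark i) δ) (htl : 0 < tl)
    (hL : tl • ((-1, ε) : ℝ × ℝ) ∈ C.offFan (T.mark i) δ) {s : ℤ} (hs : s = 1 ∨ s = -1)
    {u : Normal} (hu : 0 < s * height ε (toPlane u.1)) {a : ℤ × ℤ}
    (ha : a = C.exponent (C.pos (T.mark i) + tl • ((-1, ε) : ℝ × ℝ)) +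
      ∑ e ∈ T.star (T.mark i) with 0 < s * height ε (toPlane (C.outDir (T.mark i) e)) ∧
        0 < s * cross (toPlane u.1) (toPlane (C.outDir (T.mark i) e)),
        s • rot (C.outDir (T.mark i) e)) :
    face (C.dualMarkedPolygons i).carrier u = segment ℝ (toPlane a)
      (toPlane (a + s • (((C.dualMarkedPolygons i).label u).sum : ℤ) • rot u.1)) ∧
    toPlane a ∈ triangle d := by
  obtain ⟨vp, hp, vm, hm, h1, h2, np, nm, f1, f2, hface, hE⟩ :=
    H.exists_face_data i R u {((-1, ε) : ℝ × ℝ)} (by simp)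
  have hfan := H.isLocalFan R
  -- Edges in direction `u` itself lie on the far side of both slight rotations, hence are not among
  -- the steps before the face.
  have hpar : ∀ e ∈ T.star (T.mark i), 0 < s * height ε (toPlane (C.outDir (T.mark i) e)) →
      cross (toPlane u.1) (toPlane (C.outDir (T.mark i) e)) = 0 →
      cross vp (toPlane (C.outDir (T.mark i) e)) < 0 ∧
      0 < cross vm (toPlane (C.outDir (T.mark i) e)) := by
    intro e _ he h0
    obtain ⟨k, hk, h⟩ := exists_pos_smul hu he h0
    rw [h, cross_smul_right, cross_smul_right, cross_swap vp, cross_swap vm]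
    exact ⟨by nlinarith, by nlinarith⟩
  rcases hs with rfl | rfl
  · simp only [Int.cast_one, one_mul, one_smul] at *
    have hup : 0 < height ε vp := by
      have := (f1 (-1, ε) (by simp)).1 (by rwa [IsLocalFan.cross_leftDir])
      rwa [IsLocalFan.cross_leftDir] at this
    have hav : a = C.exponent (C.pos (T.mark i) + vp) := by
      rw [ha, hfan.above_left htl hL hp hup]
      congr 1
      refine Finset.sum_congr (Finset.filter_congr fun e he => ?_) fun _ _ => rfl
      constructor
      · rintro ⟨h3, h4⟩
        exact ⟨(np e he).1 h4, h3⟩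
      · rintro ⟨h3, h4⟩
        refine ⟨h4, ?_⟩
        by_contra h5
        rcases (not_lt.1 h5).lt_or_eq with h6 | h6
        · linarith [(np e he).2 h6]
        · linarith [(hpar e he h4 h6).1]
    rw [hav, ← hE]
    exact ⟨hface, H.exponent_mem_triangle R hp⟩
  -- Below the line the path turns counterclockwise: it reaches the face at `vm` and leaves it at
  -- `vp`.
  · simp only [Int.cast_neg, Int.cast_one, neg_mul, one_mul, neg_smul, one_smul, neg_pos] at *
    have hdown : height ε vm < 0 := by
      have := (f2 (-1, ε) (by simp)).2 (by rwa [IsLocalFan.cross_leftDir])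
      rwa [IsLocalFan.cross_leftDir] at this
    have hav : a = C.exponent (C.pos (T.mark i) + vm) := by
      rw [ha, hfan.below_left htl hL hm hdown, Finset.sum_neg_distrib, add_assoc,
        add_eq_left, add_neg_eq_zero]
      refine Finset.sum_congr (Finset.filter_congr fun e he => ?_) fun _ _ => rfl
      rw [cross_swap _ vm, neg_pos]
      constructor
      · rintro ⟨h3, h4⟩
        refine ⟨h3, ?_⟩
        by_contra h5
        rcases (not_lt.1 h5).lt_or_eq with h6 | h6
        · linarith [(nm e he).1 h6]
        · linarith [(hpar e he h3 h6.symm).2]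
      · rintro ⟨h3, h4⟩
        exact ⟨h3, (nm e he).2 h4⟩
    rw [hav]
    refine ⟨?_, H.exponent_mem_triangle R hm⟩
    rw [hface, segment_symm]
    congr 2
    rw [hE, add_neg_cancel_right]

open scoped Classical in
/-- The steps of a path over or under the fan of a marked point. -/
lemma right_eq_left_add_side {i : Fin n} {δ tl tr : ℝ} (R : C.IsRadius (T.mark i) δ) (htl : 0 < tl)
    (hL : tl • ((-1, ε) : ℝ × ℝ) ∈ C.offFan (T.mark i) δ) (htr : 0 < tr)
    (hR : tr • ((1, -ε) : ℝ × ℝ) ∈ C.offFan (T.mark i) δ) {s : ℤ} (hs : s = 1 ∨ s = -1) :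
    C.exponent (C.pos (T.mark i) + tr • ((1, -ε) : ℝ × ℝ)) =
      C.exponent (C.pos (T.mark i) + tl • ((-1, ε) : ℝ × ℝ)) +
      ∑ e ∈ T.star (T.mark i) with 0 < s * height ε (toPlane (C.outDir (T.mark i) e)),
        s • rot (C.outDir (T.mark i) e) := by
  have hfan := H.isLocalFan R
  rcases hs with rfl | rfl
  · simpa using hfan.right_eq_left_add htl hL htr hR
  · have := hfan.left_eq_right_add htl hL htr hR
    simp only [Int.cast_neg, Int.cast_one, neg_mul, one_mul, neg_smul, one_smul, neg_pos,
      Finset.sum_neg_distrib]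
    rw [this]
    abel

omit H in
lemma lam_smul_rot (s : ℤ) (o : ℤ × ℤ) :
    lam ε (toPlane (s • rot o)) = s * height ε (toPlane o) := by
  rw [toPlane_zsmul, ← lamLin_apply, map_smul, lamLin_apply, lam_rot]; rfl

lemma face_nontrivial_iff (i : Fin n) (u : Normal) :
    (face (C.dualMarkedPolygons i).carrier u).Nontrivial ↔ (edgesAt C i u).Nonempty := by
  obtain ⟨δ, R⟩ := H.exists_isRadius i
  obtain ⟨vp, -, vm, -, -, -, -, -, -, -, h1, h2⟩ := H.exists_face_data i R u ∅ (by simp)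
  rw [h1, h2, ← H.label_sum_pos_iff]
  constructor
  · intro h
    rw [Nat.pos_iff_ne_zero]
    intro h0
    rw [h0] at h
    simp at h
  · intro h
    refine ⟨_, left_mem_segment ℝ _ _, _, right_mem_segment ℝ _ _, fun h3 => ?_⟩
    have h4 := toPlane_injective h3
    rw [left_eq_add, smul_eq_zero] at h4
    rcases h4 with h4 | h4
    · exact h.ne' (by exact_mod_cast h4)
    · refine u.ne_zero ?_
      have h5 := congrArg Prod.fst h4
      have h6 := congrArg Prod.snd h4
      simp only [rot] at h5 h6
      ext
      · simpa using h6
      · simpa using h5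

end OnLine

/-! ### The upper and the lower lattice path -/

namespace OnLine

variable {d n : ℕ} {r : Fin n → ℕ} {ε c : ℝ} {T : CombType d n} {C : Curve T}
  (H : OnLine r ε c C)

open scoped Classical in
/-- The pairs of a marked point and an edge at this point in one of the half planes. -/
def flags (ε : ℝ) (C : Curve T) (s : ℤ) : Finset (Fin n × T.Edge) :=
  Finset.univ.filter fun f => f.2 ∈ T.star (T.mark f.1) ∧
    0 < s * height ε (toPlane (C.outDir (T.mark f.1) f.2))

/-- The direction of a flag. -/
def flagNormal (C : Curve T) (f : Fin n × T.Edge) : Fin n × Normal :=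
  (f.1, normalOf (C.outDir (T.mark f.1) f.2))

include H

open scoped Classical in
lemma filter_flagNormal_eq {s : ℤ} {x : Fin n × Normal} (hx : 0 < s * height ε (toPlane x.2.1)) :
    ((flags ε C s).filter fun f => flagNormal C f = x) =
      (edgesAt C x.1 x.2).map ⟨fun e => (x.1, e), Prod.mk_right_injective x.1⟩ := by
  ext ⟨j, e⟩
  simp only [flags, flagNormal, Finset.mem_filter, Finset.mem_univ, true_and, Finset.mem_map,
    mem_edgesAt, CombType.mem_star, Function.Embedding.coeFn_mk, Prod.ext_iff]
  constructor
  · rintro ⟨⟨h1, h2⟩, rfl, h3⟩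
    exact ⟨e, ⟨h1, h3⟩, rfl, rfl⟩
  · rintro ⟨e', ⟨h1, h2⟩, rfl, rfl⟩
    refine ⟨⟨h1, ?_⟩, rfl, h2⟩
    rw [← H.normalOf_side h1, h2]
    exact hx

open scoped Classical in
lemma mem_image_flagNormal {s : ℤ} {x : Fin n × Normal} :
    x ∈ (flags ε C s).image (flagNormal C) ↔
      0 < s * height ε (toPlane x.2.1) ∧ (edgesAt C x.1 x.2).Nonempty := by
  rw [Finset.mem_image]
  constructor
  · rintro ⟨⟨j, e⟩, hf, rfl⟩
    simp only [flags, Finset.mem_filter, Finset.mem_univ, true_and, CombType.mem_star] at hf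
    exact ⟨(H.normalOf_side hf.1 s).2 hf.2, e, mem_edgesAt.2 ⟨hf.1, rfl⟩⟩
  · rintro ⟨h1, e, he⟩
    have : (x.1, e) ∈ (flags ε C s).filter fun f => flagNormal C f = x := by
      rw [H.filter_flagNormal_eq h1, Finset.mem_map]
      exact ⟨e, he, rfl⟩
    exact ⟨_, (Finset.mem_filter.1 this).1, (Finset.mem_filter.1 this).2⟩

-- Several parallel edges at a marked point form a single edge of its polygon; the lemma resolves a
-- sum over polygon edges into one over edges of the curve.
open scoped Classical in
lemma sum_image_flagNormal {s : ℤ} (p : Fin n × Normal → Prop) :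
    ∑ y ∈ (flags ε C s).image (flagNormal C) with p y,
      s • (((C.dualMarkedPolygons y.1).label y.2).sum : ℤ) • rot y.2.1 =
    ∑ j, ∑ e ∈ T.star (T.mark j) with 0 < s * height ε (toPlane (C.outDir (T.mark j) e)) ∧
      p (j, normalOf (C.outDir (T.mark j) e)), s • rot (C.outDir (T.mark j) e) := by
  have h1 : ∀ y ∈ ((flags ε C s).image (flagNormal C)).filter p,
      s • (((C.dualMarkedPolygons y.1).label y.2).sum : ℤ) • rot y.2.1 =
      ∑ f ∈ ((flags ε C s).filter fun f => p (flagNormal C f)) with flagNormal C f = y,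
        s • rot (C.outDir (T.mark f.1) f.2) := by
    intro y hy
    rw [Finset.mem_filter, H.mem_image_flagNormal] at hy
    rw [← H.sum_rot_edgesAt, Finset.smul_sum, Finset.filter_filter]
    have : ((flags ε C s).filter fun f => p (flagNormal C f) ∧ flagNormal C f = y) =
        (flags ε C s).filter fun f => flagNormal C f = y :=
      Finset.filter_congr fun f _ => ⟨And.right, fun h => ⟨h ▸ hy.2, h⟩⟩
    rw [this, H.filter_flagNormal_eq hy.1.1, Finset.sum_map]
    rfl
  rw [Finset.sum_congr rfl h1, Finset.sum_fiberwise_of_maps_to]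
  · simp only [flags, Finset.filter_filter, Finset.sum_filter, Fintype.sum_prod_type]
    refine Finset.sum_congr rfl fun j _ => ?_
    rw [← Finset.sum_filter, ← Finset.sum_filter]
    refine Finset.sum_congr ?_ fun _ _ => rfl
    ext e
    simp [flagNormal, and_assoc]
  · intro f hf
    rw [Finset.mem_filter] at hf ⊢
    exact ⟨Finset.mem_image_of_mem _ hf.1, hf.2⟩

open scoped Classical in
/-- The path through the polygons of the marked points formed by the edges on one side. -/
lemma exists_side_path {δ tl tr : Fin n → ℝ} (R : ∀ i, C.IsRadius (T.mark i) (δ i))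
    (htl : ∀ i, 0 < tl i) (htr : ∀ i, 0 < tr i)
    (hL : ∀ i, tl i • ((-1, ε) : ℝ × ℝ) ∈ C.offFan (T.mark i) (δ i))
    (hR : ∀ i, tr i • ((1, -ε) : ℝ × ℝ) ∈ C.offFan (T.mark i) (δ i))
    (hfirst : ∀ i : Fin n, i.val = 0 →
      C.exponent (C.pos (T.mark i) + tl i • ((-1, ε) : ℝ × ℝ)) = (0, (d : ℤ)))
    (hlast : ∀ i : Fin n, i.val + 1 = n →
      C.exponent (C.pos (T.mark i) + tr i • ((1, -ε) : ℝ × ℝ)) = ((d : ℤ), 0))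
    (hchain : ∀ i j : Fin n, i.val + 1 = j.val →
      C.exponent (C.pos (T.mark j) + tl j • ((-1, ε) : ℝ × ℝ)) =
      C.exponent (C.pos (T.mark i) + tr i • ((1, -ε) : ℝ × ℝ)))
    {s : ℤ} (hs : s = 1 ∨ s = -1) : ∃ γ : LabelledPath d ε,
      IsFormedBy γ C.dualMarkedPolygons fun u => 0 < s * height ε (toPlane u.1) := by
  set Fs : Fin n → ℤ × ℤ := fun j => ∑ e ∈ T.star (T.mark j) with
    0 < s * height ε (toPlane (C.outDir (T.mark j) e)), s • rot (C.outDir (T.mark j) e) with hFs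
  have hstep : ∀ i, C.exponent (C.pos (T.mark i) + tr i • ((1, -ε) : ℝ × ℝ)) =
      C.exponent (C.pos (T.mark i) + tl i • ((-1, ε) : ℝ × ℝ)) + Fs i := fun i =>
    H.right_eq_left_add_side (R i) (htl i) (hL i) (htr i) (hR i) hs
  have hsumL : ∀ k, ∀ i : Fin n, i.val = k → (0, (d : ℤ)) + ∑ j with j < i, Fs j =
      C.exponent (C.pos (T.mark i) + tl i • ((-1, ε) : ℝ × ℝ)) := by
    intro k
    induction k with
    | zero =>
      intro i hi
      rw [hfirst i hi, Finset.filter_false_of_mem]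
      · simp
      · intro j _; rw [Fin.lt_def]; omega
    | succ k ih =>
      intro i hi
      set i' : Fin n := ⟨k, by omega⟩
      have : (Finset.univ.filter fun j => j < i) =
          insert i' (Finset.univ.filter fun j => j < i') := by
        ext j
        simp only [Finset.mem_filter, Finset.mem_univ, true_and, Finset.mem_insert, Fin.lt_def,
          Fin.ext_iff, i']
        omega
      rw [this, Finset.sum_insert (by simp), add_comm (Fs i'), ← add_assoc, ih i' rfl, ← hstep,
        hchain i' i (by simp [i', hi])]
  set E := (flags ε C s).image (flagNormal C) with hE
  set st : Fin n × Normal → ℤ × ℤ := fun y =>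
    s • (((C.dualMarkedPolygons y.1).label y.2).sum : ℤ) • rot y.2.1 with hst
  -- The polygons are passed in their order, and within a polygon the directions are passed from
  -- left to right.
  set key : Fin n × Normal → Fin n ×ₗ ℝ := fun x =>
    toLex (x.1, relSlope ε s (toPlane x.2.1)) with hkey
  have hsector : ∀ x ∈ E, (0, (d : ℤ)) + ∑ y ∈ E with key y < key x, st y =
      C.exponent (C.pos (T.mark x.1) + tl x.1 • ((-1, ε) : ℝ × ℝ)) +
      ∑ e ∈ T.star (T.mark x.1) with
        0 < s * height ε (toPlane (C.outDir (T.mark x.1) e)) ∧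
        0 < s * cross (toPlane x.2.1) (toPlane (C.outDir (T.mark x.1) e)),
        s • rot (C.outDir (T.mark x.1) e) := by
    intro x hx
    have hxs := (H.mem_image_flagNormal.1 hx).1
    have h1 : ∑ y ∈ E with key y < key x, st y = ∑ j, ∑ e ∈ T.star (T.mark j) with
        0 < s * height ε (toPlane (C.outDir (T.mark j) e)) ∧
        key (j, normalOf (C.outDir (T.mark j) e)) < key x, s • rot (C.outDir (T.mark j) e) := by
      convert H.sum_image_flagNormal (s := s) fun y => key y < key x
    set sec : Fin n → ℤ × ℤ := fun j => ∑ e ∈ T.star (T.mark j) with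
      0 < s * height ε (toPlane (C.outDir (T.mark j) e)) ∧
      0 < s * cross (toPlane x.2.1) (toPlane (C.outDir (T.mark j) e)),
      s • rot (C.outDir (T.mark j) e) with hsec
    -- In the lexicographic order an earlier marked point contributes all its steps, the point
    -- itself those of smaller slope, a later one none.
    have h2 : ∀ j, (∑ e ∈ T.star (T.mark j) with
        0 < s * height ε (toPlane (C.outDir (T.mark j) e)) ∧
        key (j, normalOf (C.outDir (T.mark j) e)) < key x, s • rot (C.outDir (T.mark j) e)) =
        (if j < x.1 then Fs j else 0) + if x.1 = j then sec j else 0 := by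
      intro j
      rcases lt_trichotomy j x.1 with h | h | h
      · rw [if_pos h, if_neg h.ne', add_zero]
        refine Finset.sum_congr (Finset.filter_congr fun e _ => ?_) fun _ _ => rfl
        simp [hkey, Prod.Lex.toLex_lt_toLex, h]
      · rw [if_neg h.not_lt, if_pos h.symm, zero_add]
        refine Finset.sum_congr (Finset.filter_congr fun e he => and_congr_right fun h0 => ?_)
          fun _ _ => rfl
        have he' := CombType.mem_star.1 he
        rw [← H.normalOf_cross he', ← relSlope_lt_iff hxs ((H.normalOf_side he' s).2 h0)]
        simp [hkey, Prod.Lex.toLex_lt_toLex, h]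
      · rw [if_neg h.not_gt, if_neg h.ne, add_zero, Finset.filter_false_of_mem,
          Finset.sum_empty]
        simp [hkey, Prod.Lex.toLex_lt_toLex, h.not_gt, h.ne']
    rw [h1, Finset.sum_congr rfl fun j _ => h2 j, Finset.sum_add_distrib, ← Finset.sum_filter,
      Finset.sum_ite_eq, if_pos (Finset.mem_univ _), ← add_assoc, hsumL _ x.1 rfl]
  have hside : ∀ x ∈ E, 0 < s * height ε (toPlane x.2.1) := fun x hx =>
    (H.mem_image_flagNormal.1 hx).1
  refine exists_path E (fun x => ?_) key ?_ ?_ st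
    (fun x => (0, (d : ℤ)) + ∑ y ∈ E with key y < key x, st y) (fun x _ => rfl) ?_ ?_ ?_ ?_ ?_
  · rw [H.face_nontrivial_iff]
    exact H.mem_image_flagNormal
  · intro x hx y hy hxy
    simp only [hkey, EmbeddingLike.apply_eq_iff_eq, Prod.mk.injEq] at hxy
    exact Prod.ext hxy.1 (relSlope_injOn (hside x hx) (hside y hy) hxy.2)
  · intro x _ y _ hxy
    exact Prod.Lex.monotone_fst (key x) (key y) hxy
  · intro x hx
    have hW := (H.label_sum_pos_iff _ _).2 (H.mem_image_flagNormal.1 hx).2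
    simp only [hst]
    rw [smul_comm, toPlane_zsmul, ← lamLin_apply, map_smul, lamLin_apply, lam_smul_rot]
    exact mul_pos (by exact_mod_cast hW) (hside x hx)
  · intro x hx
    exact (H.exists_side_face (R x.1) (htl x.1) (hL x.1) hs (hside x hx) (hsector x hx)).1
  · intro x hx
    exact (H.exists_side_face (R x.1) (htl x.1) (hL x.1) hs (hside x hx) (hsector x hx)).2
  · have h1 : ∑ y ∈ E, st y = ∑ j, Fs j := by
      have := H.sum_image_flagNormal (s := s) fun _ => True
      simpa only [Finset.filter_true, and_true] using this
    -- For `n = 0` the dimension condition would read `3 * d = 1`.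
    have hn : 0 < n := by
      have := H.dim
      rcases Nat.eq_zero_or_pos n with rfl | h
      · simp at this
      · exact h
    set i : Fin n := ⟨n - 1, by omega⟩
    have h2 : (Finset.univ : Finset (Fin n)) = insert i (Finset.univ.filter fun j => j < i) := by
      ext j
      simp only [Finset.mem_filter, Finset.mem_univ, true_and, true_iff, Finset.mem_insert,
        Fin.lt_def,
        Fin.ext_iff, i]
      have := j.isLt
      omega
    rw [h1, h2, Finset.sum_insert (by simp), add_comm (Fs i), ← add_assoc, hsumL _ i rfl, ← hstep]
    exact hlast i (Nat.sub_add_cancel hn)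
  · intro x _
    exact H.partition x.1 x.2

end OnLine

/-! ### Assembling the rag rug -/

namespace OnLine

variable {d n : ℕ} {r : Fin n → ℕ} {ε c : ℝ} {T : CombType d n} {C : Curve T}
  (H : OnLine r ε c C)
include H

lemma polytope (i : Fin n) : ∃ S : Finset (ℤ × ℤ), S.Nonempty ∧
    (C.dualMarkedPolygons i).carrier = convexHull ℝ (toPlane '' S) := by
  obtain ⟨δ, R⟩ := H.exists_isRadius i
  set S := (fun v => C.exponent (C.pos (T.mark i) + v)) '' C.offFan (T.mark i) δ with hS
  have hfin : S.Finite := by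
    refine (Finset.finite_toSet (Finset.Icc 0 (d : ℤ) ×ˢ Finset.Icc 0 (d : ℤ))).subset ?_
    rintro _ ⟨v, hv, rfl⟩
    obtain ⟨h1, h2, h3⟩ := H.exponent_nonneg_le R hv
    simp only [Finset.coe_product, Finset.coe_Icc, mem_prod, mem_Icc]
    omega
  refine ⟨hfin.toFinset, ?_, ?_⟩
  · rw [Set.Finite.toFinset_nonempty]
    obtain ⟨t, -, ht⟩ := (H.isLocalFan R).exists_leftDir H.irr
    exact ⟨_, _, ht, rfl⟩
  · rw [Set.Finite.coe_toFinset]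
    exact H.dualPolygon_eq R

lemma subset_triangle (i : Fin n) : (C.dualMarkedPolygons i).carrier ⊆ triangle d := by
  obtain ⟨δ, R⟩ := H.exists_isRadius i
  refine (H.dualPolygon_eq R).trans_subset (convexHull_min ?_ (convex_convexHull ℝ _))
  rintro _ ⟨_, ⟨v, hv, rfl⟩, rfl⟩
  exact H.exponent_mem_triangle R hv

lemma lam_lt_right {i : Fin n} {δ tr : ℝ} (R : C.IsRadius (T.mark i) δ) (htr : 0 < tr)
    (hR : tr • ((1, -ε) : ℝ × ℝ) ∈ C.offFan (T.mark i) δ) {y : ℝ × ℝ}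
    (hy : y ∈ (C.dualMarkedPolygons i).carrier) :
    lam ε y < lam ε (toPlane (C.exponent (C.pos (T.mark i) + tr • ((1, -ε) : ℝ × ℝ)))) ∨
      y = toPlane (C.exponent (C.pos (T.mark i) + tr • ((1, -ε) : ℝ × ℝ))) := by
  change y ∈ C.dualPolygon (C.pos (T.mark i)) at hy
  rw [H.dualPolygon_eq R] at hy
  rw [← mem_singleton_iff, ← segment_same ℝ]
  refine convexHull_lt_or_mem_segment (lamLin ε) rfl rfl ?_ hy
  rintro _ ⟨_, ⟨v, hv, rfl⟩, rfl⟩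
  rw [segment_same, mem_singleton_iff]
  rcases (H.isLocalFan R).le_right htr hR hv with h | h
  · exact Or.inr (congrArg toPlane h)
  · exact Or.inl h

lemma left_lt_lam {i : Fin n} {δ tl : ℝ} (R : C.IsRadius (T.mark i) δ) (htl : 0 < tl)
    (hL : tl • ((-1, ε) : ℝ × ℝ) ∈ C.offFan (T.mark i) δ) {y : ℝ × ℝ}
    (hy : y ∈ (C.dualMarkedPolygons i).carrier) :
    lam ε (toPlane (C.exponent (C.pos (T.mark i) + tl • ((-1, ε) : ℝ × ℝ)))) < lam ε y ∨
      y = toPlane (C.exponent (C.pos (T.mark i) + tl • ((-1, ε) : ℝ × ℝ))) := by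
  change y ∈ C.dualPolygon (C.pos (T.mark i)) at hy
  rw [H.dualPolygon_eq R] at hy
  rw [← mem_singleton_iff, ← segment_same ℝ, ← neg_lt_neg_iff]
  refine convexHull_lt_or_mem_segment (-lamLin ε) rfl rfl ?_ hy
  rintro _ ⟨_, ⟨v, hv, rfl⟩, rfl⟩
  rw [segment_same, mem_singleton_iff]
  rcases (H.isLocalFan R).left_le htl hL hv with h | h
  · exact Or.inr (congrArg toPlane h)
  · exact Or.inl (neg_lt_neg h)

/-- The `λ`-maximum of `Q_i` is at most the `λ`-minimum of a later `Q_j`, and each is attained at a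
single vertex; a common point must be the right vertex of `Q_i`. -/
lemma inter_subsingleton {δ tl tr : Fin n → ℝ} (R : ∀ i, C.IsRadius (T.mark i) (δ i))
    (htl : ∀ i, 0 < tl i) (htr : ∀ i, 0 < tr i)
    (hL : ∀ i, tl i • ((-1, ε) : ℝ × ℝ) ∈ C.offFan (T.mark i) (δ i))
    (hR : ∀ i, tr i • ((1, -ε) : ℝ × ℝ) ∈ C.offFan (T.mark i) (δ i))
    (hchain : ∀ i j : Fin n, i.val + 1 = j.val →
      C.exponent (C.pos (T.mark j) + tl j • ((-1, ε) : ℝ × ℝ)) =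
      C.exponent (C.pos (T.mark i) + tr i • ((1, -ε) : ℝ × ℝ)))
    {i j : Fin n} (hij : i < j) :
    ((C.dualMarkedPolygons i).carrier ∩ (C.dualMarkedPolygons j).carrier).Subsingleton := by
  have hle : ∀ k, ∀ j : Fin n, j.val = i.val + 1 + k →
      lam ε (toPlane (C.exponent (C.pos (T.mark i) + tr i • ((1, -ε) : ℝ × ℝ)))) ≤
      lam ε (toPlane (C.exponent (C.pos (T.mark j) + tl j • ((-1, ε) : ℝ × ℝ)))) := by
    intro k
    induction k with
    | zero =>
      intro j hj
      rw [hchain i j (by omega)]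
    | succ k ih =>
      intro j hj
      have hk := ih ⟨i.val + 1 + k, by omega⟩ rfl
      rw [hchain ⟨i.val + 1 + k, by omega⟩ j (by simp only; omega)]
      refine hk.trans ?_
      rcases (H.isLocalFan (R ⟨i.val + 1 + k, by omega⟩)).left_le (htl _) (hL _) (hR _) with h | h
      · exact (congrArg (fun m => lam ε (toPlane m)) h).ge
      · exact h.le
  have hij' := hle (j.val - (i.val + 1)) j (by rw [Fin.lt_def] at hij; omega)
  have hpt : ∀ y ∈ (C.dualMarkedPolygons i).carrier ∩ (C.dualMarkedPolygons j).carrier,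
      y = toPlane (C.exponent (C.pos (T.mark i) + tr i • ((1, -ε) : ℝ × ℝ))) := by
    rintro y ⟨h1, h2⟩
    rcases H.lam_lt_right (R i) (htr i) (hR i) h1 with h | h
    · exfalso
      rcases H.left_lt_lam (R j) (htl j) (hL j) h2 with h' | h'
      · linarith
      · rw [h'] at h; linarith
    · exact h
  intro y hy z hz
  rw [hpt y hy, hpt z hz]

/-- The dual marked polygons of a curve through points on a line form a rag rug. -/
lemma isRagRug (hε : 0 < ε) {A : ℝ × ℝ} {t : Fin n → ℝ}
    (hline : ∀ i, C.pos (T.mark i) = A + t i • ((1, -ε) : ℝ × ℝ)) (hA : height ε A = c)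
    (ht : StrictMono t) : IsRagRug d r ε C.dualMarkedPolygons := by
  obtain ⟨δ, tl, tr, R, htl, htr, hL, hR, hfirst, hlast, hchain⟩ := H.exists_chain hline hA hε ht
  have hpath := fun {s : ℤ} => H.exists_side_path (s := s) R htl htr hL hR hfirst hlast hchain
  refine ⟨H.polytope, H.subset_triangle, H.partition, H.outside_label, ?_, ?_, ?_, H.size_eq⟩
  · intro i j hij
    rcases lt_or_gt_of_ne hij with h | h
    · exact H.inter_subsingleton R htl htr hL hR hchain h
    · rw [inter_comm]
      exact H.inter_subsingleton R htl htr hL hR hchain h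
  · have h : PointsUp ε = fun u => 0 < ((1 : ℤ) : ℝ) * height ε (toPlane u.1) := by
      funext u; simp [PointsUp]
    rw [h]
    exact hpath (Or.inl rfl)
  · have h : PointsDown ε = fun u => 0 < ((-1 : ℤ) : ℝ) * height ε (toPlane u.1) := by
      funext u; simp [PointsDown]
    rw [h]
    exact hpath (Or.inr rfl)

end OnLine

end TropicalDescendant

end

theorem mainTheorem3 (d n : ℕ) (r : Fin n → ℕ)
    (hdim : 3 * d = n + ∑ i, r i + 1)
    (ε : ℝ) (hε : 0 < ε) (hirr : Irrational ε)
    (P : Fin n → ℝ × ℝ) (hP : TropicalDescendant.IsSpecialConfiguration d r ε P)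
    (T : TropicalDescendant.CombType d n) (hT : T.InPsiProduct r)
    (C : TropicalDescendant.Curve T) (hC : C.ev = P) :
    TropicalDescendant.IsRagRug d r ε C.dualMarkedPolygons := by
  obtain ⟨⟨-, hsimple⟩, A, t, hline, ht, -⟩ := hP
  have hpos : ∀ i, C.pos (T.mark i) = A + t i • ((1, -ε) : ℝ × ℝ) := fun i => by
    rw [← hline, ← hC]; rfl
  -- Simplicity enters as injectivity of `h` on vertices; the points are distinct because `t` is
  -- strictly increasing.
  have H : TropicalDescendant.OnLine r ε (TropicalDescendant.height ε A) C :=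
    { irr := hirr
      inj := (hsimple T C hT hC).inj
      psi := hT
      dim := hdim
      mark_inj := fun i j hij => ht.injective <|
        TropicalDescendant.OnLine.line_injective (A := A) (ε := ε) (by rw [← hpos, ← hpos, hij])
      height_mark := fun i => by rw [hpos, TropicalDescendant.OnLine.height_line] }
  exact H.isRagRug hε hpos rfl ht
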